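/- **Setting.** Let $3\le K\le M$ be integers, $\rho>0$, $s>\tfrac12$, $0\le\nu<\tfrac12$, $0<\gamma\le1$, and let $\tau>0$, $0<\epsilon\le1$, $\delta=\epsilon^{1/2}$, $t_n=n\tau$. Indices $j$ run through $\{-M,\dots,M-1\}$, sums and negatives of such indices are taken modulo $2M$ ($\equiv$ is congruence modulo $2M$, and $\pm M$ are identified), and $\mathbf k=(k_0,\dots,k_M)$ denotes an integer vector. Put $\omega_l=\sqrt{l^2+\rho}$, $\mathbf k\cdot\boldsymbol\omega=\sum_{l=0}^M k_l\omega_l$, $\operatorname{sinc}x=\frac{\sin x}{x}$ ($\operatorname{sinc}0=1$), $\sigma_l=\max(|l|,1)^{2s}$; $e(0)=2$, $e(l)=|l|$ for $0<|l|<K$, $e(l)=K$ for $|l|\ge K$; $\mu(\mathbf k)=\sum_{l}|k_l|e(l)$; $\langle j\rangle$ is the $|j|$-th unit vector; $m(j,\mathbf k)=\max\bigl(e(j),\max_{k_l\ne0}e(l)\bigr)$. Let $$\mathcal K=\{(j,\mathbf k):\max(|j|,\mu(\mathbf k))<2K,\ k_l=0\ \forall\, l\ge K\}\ \cup\ \{(j,\pm\langle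 (j-r)\bmod 2M\rangle+\mathbf k): |(j-r)\bmod 2M|\ge K,\ |r|<K,\ \mu(\mathbf k)<K\}$$ and $\mathcal K_j=\{\mathbf k:(j,\mathbf k)\in\mathcal K\}$. Consider the nonlinear wave equation $\partial_{tt}u-\partial_{xx}u+\rho u=u^2$ on the one-dimensional torus, discretized by spectral collocation with $2M$ Fourier modes in space and in time by the trigonometric integrator with step size $\tau$, $$u_j^{n+1}-2\cos(\tau\omega_j)u_j^n+u_j^{n-1}=\tau^2\psi(\tau\omega_j)\sum_{j_1+j_2\equiv j}\phi(\tau\omega_{j_1})u^n_{j_1}\,\phi(\tau\omega_{j_2})u^n_{j_2},\qquad 2\tau\operatorname{sinc}(\tau\omega_j)\dot u_j^n=u_j^{n+1}-u_j^{n-1},$$ where $\phi$ is real-valued, even and bounded with $\phi(0)=1$, and $\psi=\operatorname{sinc}\cdot\phi$ (symplectic method). The initial data $(u_j^0,\dot u_j^0)$ come from real functions, $u_{-j}^0=\overline{u_j^0}$, $\dot u_{-j}^0=\overline{\dot u_j^0}$, and the mode energies are $E_j^0=\tfrac12|\omega_ju_j^0|^2+\tfrac12|\dot u_j^0|^2$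 (with $E^0_M=E^0_{-M}$). **Non-resonance condition.** $|\sin(\tfrac12\tau(\omega_j\pm\mathbf k\cdot\boldsymbol\omega))|\ge\gamma\tau\epsilon^{\nu/2}$ for all $(j,\mathbf k)\in\mathcal K$ with $\mathbf k\ne\mp\langle j\rangle$, and $|\sin(\tfrac12\tau(\omega_j\pm\mathbf k\cdot\boldsymbol\omega))|\ge\gamma\tau$ for all $(j,\mathbf k)\in\mathcal K$ with $|j|\le K$, $\mathbf k\ne\langle j\rangle$ and $\mathbf k\ne-\langle j\rangle$. **Modulation functions.** For $(j,\mathbf k)\in\mathcal K$ let $$z_j^{\mathbf k}=\delta^{m(j,\mathbf k)}\sum_{m=m(j,\mathbf k)}^{2K-1}\delta^{(m-m(j,\mathbf k))(1-2\nu)}z_{j,m}^{\mathbf k}$$ be the modulation functions of the modulated Fourier expansion $u_j^n\approx\sum_{\mathbf k\in\mathcal K_j}z_j^{\mathbf k}(\epsilon^{\nu/2}t_n)\mathrm e^{\mathrm i(\mathbf k\cdot\boldsymbol\omega)t_n}$. Here $z_{j,m}^{\mathbf k}=0$ for $m<m(j,\mathbf k)$, and, recursively in $m=1,\dots,2K-1$,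 the $z_{j,m}^{\mathbf k}$ with $m(j,\mathbf k)\le m$ are the polynomials satisfying, with $h=\tau\epsilon^{\nu/2}$, $$\mathrm e^{\mathrm i(\mathbf k\cdot\boldsymbol\omega)\tau}z_{j,m}^{\mathbf k}(x+h)-2\cos(\tau\omega_j)z_{j,m}^{\mathbf k}(x)+\mathrm e^{-\mathrm i(\mathbf k\cdot\boldsymbol\omega)\tau}z_{j,m}^{\mathbf k}(x-h)$$ $$=\tau^2\psi(\tau\omega_j)\sum_{j_1+j_2\equiv j}\ \sum_{\substack{\mathbf k^1\in\mathcal K_{j_1},\ \mathbf k^2\in\mathcal K_{j_2}\\ \mathbf k^1+\mathbf k^2=\mathbf k}}\delta^{2(m(j_1,\mathbf k^1)+m(j_2,\mathbf k^2)-m(j,\mathbf k))\nu}\sum_{m_1+m_2=m}\phi(\tau\omega_{j_1})z^{\mathbf k^1}_{j_1,m_1}(x)\,\phi(\tau\omega_{j_2})z^{\mathbf k^2}_{j_2,m_2}(x)$$ (sum over $m_1,m_2\ge1$). Under the non-resonance condition this determines $z_{j,m}^{\mathbf k}$ uniquely for $\mathbf k\ne\pm\langle j\rangle$, and up to an additive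 constant for $\mathbf k=\pm\langle j\rangle$; these constants are fixed by requiring $$\sum_{\mathbf k\in\mathcal K_j}\delta^{2(m(j,\mathbf k)-e(j))\nu}z_{j,m}^{\mathbf k}(0)=a_{j,m},\qquad \sum_{\mathbf k\in\mathcal K_j}\delta^{2(m(j,\mathbf k)-e(j))\nu}\bigl(\mathrm e^{\mathrm i(\mathbf k\cdot\boldsymbol\omega)\tau}z_{j,m}^{\mathbf k}(h)-\mathrm e^{-\mathrm i(\mathbf k\cdot\boldsymbol\omega)\tau}z_{j,m}^{\mathbf k}(-h)\bigr)=2\tau\operatorname{sinc}(\tau\omega_j)\,b_{j,m}$$ for $m\ge e(j)$, where $(a_{j,m},b_{j,m})=\delta^{-e(j)}(u_j^0,\dot u_j^0)$ if $m=e(j)$ and $(a_{j,m},b_{j,m})=(0,0)$ otherwise. The almost-invariant energies are, for $l=0,\dots,M$, $$\mathcal E_l(t)=-\frac{\mathrm i}{2}\sum_{j=-M}^{M-1}\sum_{\mathbf k\in\mathcal K_j}\frac{k_l\omega_l}{\tau\operatorname{sinc}(\tau\omega_j)}\,z_{-j}^{-\mathbf k}(\epsilon^{\nu/2}t)\,\mathrm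 e^{\mathrm i(\mathbf k\cdot\boldsymbol\omega)\tau}\,z_j^{\mathbf k}(\epsilon^{\nu/2}(t+\tau)).$$ **Theorem.** Given $K,\nu,s,\rho,\gamma$, a constant $C_0$ and a bound $B$ for $|\phi|$, there are $\epsilon_0>0$ and $C>0$, depending only on these quantities (in particular not on $\epsilon$, $\tau$, $M$, and on the initial data only through $C_0$), such that the following holds. If $0<\epsilon\le\epsilon_0$, if the non-resonance condition holds, and if $$\sum_{l=0}^M\sigma_l\epsilon^{-e(l)}E_l^0\le C_0,$$ then, for all $n\ge 0$ with $0\le t_n\le1$, $$\sum_{l=0}^M\sigma_l\epsilon^{-e(l)}\bigl|\mathcal E_l(t_n)-\mathcal E_l(0)\bigr|\le C\epsilon^{K(1-2\nu)/2}$$ and $$\epsilon^{-e(1)}\bigl|\mathcal E_1(t_n)-\mathcal E_1(0)\bigr|\le C\,\epsilon^{(K-1)(1-2\nu)/2}\,\epsilon^{K(1-2\nu)/2}.$$ -/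

import Mathlib

noncomputable section

namespace TrigInt

open Polynomial

/-! Spatial indices `j ∈ {-M, …, M-1}` are always added and negated modulo `2M`, so they are
modelled by `ZMod (2 * M)`. Multi-indices `k = (k_0, …, k_M)` are functions `Fin (M + 1) → ℤ`. -/

/-- `|j|`, the absolute value of the representative of `j` in `{-M, …, M-1}`
(taking `{-M+1, …, M}` instead gives the same absolute value). -/
def absIdx {M : ℕ} (j : ZMod (2 * M)) : ℕ := j.valMinAbs.natAbs

/-- The `|j|`-th unit vector `⟨j⟩` of length `M + 1`. -/
def unitVec {M : ℕ} (j : ZMod (2 * M)) : Fin (M + 1) → ℤ :=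
  fun l => if (l : ℕ) = absIdx j then 1 else 0

/-- The frequency `ω_l = √(l² + ρ)`. -/
def freq (ρ : ℝ) (l : ℕ) : ℝ := Real.sqrt ((l : ℝ) ^ 2 + ρ)

/-- The energy profile `e(l)`. -/
def profile (K l : ℕ) : ℕ := if l = 0 then 2 else if l < K then l else K

/-- The weight `σ_l = max(l, 1)^{2s}`. -/
def weight (s : ℝ) (l : ℕ) : ℝ := (max (l : ℝ) 1) ^ (2 * s)

/-- `μ(k) = ∑_l |k_l| e(l)`. -/
def mu (K : ℕ) {M : ℕ} (k : Fin (M + 1) → ℤ) : ℕ :=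
  ∑ l : Fin (M + 1), (k l).natAbs * profile K l

/-- `k · ω = ∑_l k_l ω_l`. -/
def dotFreq (ρ : ℝ) {M : ℕ} (k : Fin (M + 1) → ℤ) : ℝ :=
  ∑ l : Fin (M + 1), (k l : ℝ) * freq ρ l

/-- Membership of `(j, k)` in the index set `𝒦`. -/
def InK (K : ℕ) {M : ℕ} (j : ZMod (2 * M)) (k : Fin (M + 1) → ℤ) : Prop :=
  (max (absIdx j) (mu K k) < 2 * K ∧ ∀ l : Fin (M + 1), K ≤ (l : ℕ) → k l = 0) ∨
  ∃ (r : ℤ) (h : Fin (M + 1) → ℤ), K ≤ absIdx (j - (r : ZMod (2 * M))) ∧ |r| < (K : ℤ) ∧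
    mu K h < K ∧
    (k = unitVec (j - (r : ZMod (2 * M))) + h ∨ k = -unitVec (j - (r : ZMod (2 * M))) + h)

theorem natAbs_le_mu {K : ℕ} (hK : 1 ≤ K) {M : ℕ} (k : Fin (M + 1) → ℤ) (l : Fin (M + 1)) :
    (k l).natAbs ≤ mu K k := by
  have h1 : 1 ≤ profile K l := by
    unfold profile
    split_ifs <;> omega
  calc (k l).natAbs ≤ (k l).natAbs * profile K l := Nat.le_mul_of_pos_right _ h1
    _ ≤ mu K k := Finset.single_le_sum (f := fun l : Fin (M + 1) => (k l).natAbs * profile K l)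
        (fun _ _ => Nat.zero_le _) (Finset.mem_univ l)

theorem finite_InK (K : ℕ) {M : ℕ} (j : ZMod (2 * M)) :
    {k : Fin (M + 1) → ℤ | InK K j k}.Finite := by
  refine (Set.Finite.pi' (fun _ : Fin (M + 1) =>
    Set.finite_Icc (-(2 * K : ℤ)) (2 * K : ℤ))).subset ?_
  rintro k (⟨h1, -⟩ | ⟨r, h, -, -, hh, hk⟩) l
  · have h2 : mu K k < 2 * K := lt_of_le_of_lt (le_max_right _ _) h1
    have h3 := natAbs_le_mu (by omega : 1 ≤ K) k l
    simp only [Set.mem_Icc]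
    omega
  · have h3 := natAbs_le_mu (by omega : 1 ≤ K) h l
    have h4 : unitVec (j - (r : ZMod (2 * M))) l = 0 ∨ unitVec (j - (r : ZMod (2 * M))) l = 1 := by
      unfold unitVec
      split_ifs <;> simp
    simp only [Set.mem_Icc]
    rcases hk with rfl | rfl <;> simp only [Pi.add_apply, Pi.neg_apply] <;> omega

/-- `𝒦_j = {k : (j, k) ∈ 𝒦}`, a finite set. -/
def modes (K : ℕ) {M : ℕ} (j : ZMod (2 * M)) : Finset (Fin (M + 1) → ℤ) :=
  (finite_InK K j).toFinset

/-- The non-resonance condition with constant `γ`: the weak one on all of `𝒦`, and the strong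
one for `|j| ≤ K`. -/
def NonResonant (K M : ℕ) (ρ ν γ ε τ : ℝ) : Prop :=
  (∀ (j : ZMod (2 * M)) (k : Fin (M + 1) → ℤ), InK K j k →
    (k ≠ -unitVec j →
      γ * τ * ε ^ (ν / 2) ≤ |Real.sin (τ * (freq ρ (absIdx j) + dotFreq ρ k) / 2)|) ∧
    (k ≠ unitVec j →
      γ * τ * ε ^ (ν / 2) ≤ |Real.sin (τ * (freq ρ (absIdx j) - dotFreq ρ k) / 2)|)) ∧
  (∀ (j : ZMod (2 * M)) (k : Fin (M + 1) → ℤ), InK K j k → absIdx j ≤ K →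
    k ≠ unitVec j → k ≠ -unitVec j →
      γ * τ ≤ |Real.sin (τ * (freq ρ (absIdx j) + dotFreq ρ k) / 2)| ∧
      γ * τ ≤ |Real.sin (τ * (freq ρ (absIdx j) - dotFreq ρ k) / 2)|)

/-- Fourier coefficients of a trigonometric polynomial that is real in the collocation points. -/
def IsRealValued {M : ℕ} (u : ZMod (2 * M) → ℂ) : Prop :=
  ∀ j, u (-j) = (starRingEnd ℂ) (u j)

/-- The mode energy of the data `(u, v)`, where `v` is the velocity. -/
def modeEnergy (ρ : ℝ) {M : ℕ} (u v : ZMod (2 * M) → ℂ) (j : ZMod (2 * M)) : ℝ :=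
  ‖(freq ρ (absIdx j) : ℂ) * u j‖ ^ 2 / 2 + ‖v j‖ ^ 2 / 2

/-- `m(j, k)`: the maximum of `e(j)` and of all `e(l)` with `k_l ≠ 0`. -/
def level (K : ℕ) {M : ℕ} (j : ZMod (2 * M)) (k : Fin (M + 1) → ℤ) : ℕ :=
  max (profile K (absIdx j))
    ((Finset.univ.filter fun l : Fin (M + 1) => k l ≠ 0).sup fun l => profile K (l : ℕ))

/-- For a polynomial `z`,
`e^{i(k·ω)τ} z(x + h) - 2 cos(τω_j) z(x) + e^{-i(k·ω)τ} z(x - h) = ∑_l (symbolCoeff l) z^{(l)}(x)`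
with `h = τ ε^{ν/2}`; these are the coefficients on the right. -/
def symbolCoeff (ρ ν ε τ : ℝ) {M : ℕ} (j : ZMod (2 * M)) (k : Fin (M + 1) → ℤ) (l : ℕ) : ℂ :=
  ((τ * ε ^ (ν / 2) : ℝ) : ℂ) ^ l / (l.factorial : ℂ) *
      (Complex.exp (Complex.I * (dotFreq ρ k * τ : ℝ)) +
        (-1) ^ l * Complex.exp (-(Complex.I * (dotFreq ρ k * τ : ℝ))))
    - (if l = 0 then 2 * (Real.cos (τ * freq ρ (absIdx j)) : ℂ) else 0)

/-- The polynomial solution `z` of `∑_l a_l z^{(l)} = p` in the case `a_0 ≠ 0`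
(a terminating Neumann series). -/
def offDiagSol (a : ℕ → ℂ) (p : ℂ[X]) : ℂ[X] :=
  ∑ n ∈ Finset.range (p.natDegree + 1),
    ((∑ l ∈ Finset.Icc 1 p.natDegree,
      (-a l / a 0) • (derivative : Module.End ℂ ℂ[X]) ^ l) ^ n) ((a 0)⁻¹ • p)

/-- The derivative `z'` of the polynomial solutions `z` of `∑_l a_l z^{(l)} = p` in the case
`a_0 = 0`, `a_1 ≠ 0`. -/
def diagDeriv (a : ℕ → ℂ) (p : ℂ[X]) : ℂ[X] :=
  ∑ n ∈ Finset.range (p.natDegree + 1),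
    ((∑ l ∈ Finset.Icc 1 p.natDegree,
      (-a (l + 1) / a 1) • (derivative : Module.End ℂ ℂ[X]) ^ l) ^ n) ((a 1)⁻¹ • p)

/-- The antiderivative of a polynomial that vanishes at `0`. -/
def antideriv (p : ℂ[X]) : ℂ[X] :=
  ∑ n ∈ Finset.range (p.natDegree + 1), C (p.coeff n / ((n : ℂ) + 1)) * X ^ (n + 1)

section Construction

variable (K : ℕ) {M : ℕ} [NeZero M] (ρ ν ε τ : ℝ) (φ ψ : ℝ → ℝ) (u v : ZMod (2 * M) → ℂ)

/-- The right-hand side of the equation for the coefficient `z_{j,m}^k` (with `δ = √ε`):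
`τ² ψ(τω_j) ∑ δ^{2(m(j₁,k¹) + m(j₂,k²) - m(j,k))ν} φ(τω_{j₁}) z_{j₁,m₁}^{k¹} φ(τω_{j₂}) z_{j₂,m₂}^{k²}`,
the sum being over `j₁ + j₂ ≡ j`, `k¹ + k² = k` and `m₁ + m₂ = m`. -/
def rhsPoly (z : ℕ → ZMod (2 * M) → (Fin (M + 1) → ℤ) → ℂ[X]) (m : ℕ) (j : ZMod (2 * M))
    (k : Fin (M + 1) → ℤ) : ℂ[X] :=
  C ((τ ^ 2 * ψ (τ * freq ρ (absIdx j)) : ℝ) : ℂ) *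
    ∑ j₁ : ZMod (2 * M), ∑ k₁ ∈ (modes K j₁).filter (fun k₁ => k - k₁ ∈ modes K (j - j₁)),
      C ((Real.sqrt ε ^
        (2 * ((level K j₁ k₁ : ℝ) + level K (j - j₁) (k - k₁) - level K j k) * ν) : ℝ) : ℂ) *
      ∑ q ∈ Finset.HasAntidiagonal.antidiagonal m,
        (C (φ (τ * freq ρ (absIdx j₁)) : ℂ) * z q.1 j₁ k₁) *
        (C (φ (τ * freq ρ (absIdx (j - j₁))) : ℂ) * z q.2 (j - j₁) (k - k₁))

/-- The coefficient `z_{j,m}^k`, for `k = ±⟨j⟩` only up to its value at `0`, computed from the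
coefficients `z` of order less than `m`. -/
def preCoeff (z : ℕ → ZMod (2 * M) → (Fin (M + 1) → ℤ) → ℂ[X]) (m : ℕ) (j : ZMod (2 * M))
    (k : Fin (M + 1) → ℤ) : ℂ[X] :=
  if m < level K j k then 0
  else if k = unitVec j ∨ k = -unitVec j then
    antideriv (diagDeriv (symbolCoeff ρ ν ε τ j k) (rhsPoly K ρ ν ε τ φ ψ z m j k))
  else offDiagSol (symbolCoeff ρ ν ε τ j k) (rhsPoly K ρ ν ε τ φ ψ z m j k)

/-- The part of `(2τ sinc(τω_j))⁻¹ (e^{i(k·ω)τ} q(h) - e^{-i(k·ω)τ} q(-h))`, `h = τ ε^{ν/2}`, that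
contains the derivatives of `q` at `0`, in its Taylor expansion around `0`, i.e.
`sinc(τω_j)⁻¹ (ε^{ν/2} cos(τ k·ω) q'(0) + (i/2) τ ε^ν sin(τ k·ω) q''(0) + …)`. -/
def velocityTail (j : ZMod (2 * M)) (k : Fin (M + 1) → ℤ) (q : ℂ[X]) : ℂ :=
  (Complex.exp (Complex.I * (dotFreq ρ k * τ : ℝ)) *
      (q.eval ((τ * ε ^ (ν / 2) : ℝ) : ℂ) - q.eval 0) -
    Complex.exp (-(Complex.I * (dotFreq ρ k * τ : ℝ))) *
      (q.eval (-((τ * ε ^ (ν / 2) : ℝ) : ℂ)) - q.eval 0)) /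
  ((2 * τ * Real.sinc (τ * freq ρ (absIdx j)) : ℝ) : ℂ)

/-- The initial value `z_{j,m}^{±⟨j⟩}(0)` (`sg = ±1`), obtained from the requirement that the
expansion reproduces the initial data `(u, v)`. -/
def diagInit (sg : ℝ) (z : ℕ → ZMod (2 * M) → (Fin (M + 1) → ℤ) → ℂ[X]) (m : ℕ)
    (j : ZMod (2 * M)) : ℂ :=
  (-Complex.I * ∑ k ∈ (modes K j).filter (fun k => k ≠ unitVec j ∧ k ≠ -unitVec j),
      ((Real.sqrt ε ^ (2 * ((level K j k : ℝ) - profile K (absIdx j)) * ν) *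
        (freq ρ (absIdx j) + sg * dotFreq ρ k *
          (Real.sinc (τ * dotFreq ρ k) / Real.sinc (τ * freq ρ (absIdx j)))) : ℝ) : ℂ) *
      (preCoeff K ρ ν ε τ φ ψ z m j k).eval 0
    - (sg : ℂ) * ∑ k ∈ modes K j,
      ((Real.sqrt ε ^ (2 * ((level K j k : ℝ) - profile K (absIdx j)) * ν) : ℝ) : ℂ) *
      velocityTail ρ ν ε τ j k (preCoeff K ρ ν ε τ φ ψ z m j k)
    + (if m = profile K (absIdx j) then
        ((Real.sqrt ε ^ (-(profile K (absIdx j) : ℝ)) : ℝ) : ℂ) *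
          (Complex.I * freq ρ (absIdx j) * u j + (sg : ℂ) * v j)
      else 0)) /
  (2 * Complex.I * freq ρ (absIdx j))

/-- The coefficients of order `m`, computed from the coefficients `z` of order less than `m`. -/
def nextCoeff (z : ℕ → ZMod (2 * M) → (Fin (M + 1) → ℤ) → ℂ[X]) (m : ℕ) (j : ZMod (2 * M))
    (k : Fin (M + 1) → ℤ) : ℂ[X] :=
  if k ∈ modes K j ∧ level K j k ≤ m then
    preCoeff K ρ ν ε τ φ ψ z m j k +
      (if k = unitVec j then C (diagInit K ρ ν ε τ φ ψ u v 1 z m j)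
      else if k = -unitVec j then C (diagInit K ρ ν ε τ φ ψ u v (-1) z m j)
      else 0)
  else 0

/-- `coeffTable N m j k` is `z_{j,m}^k` for `m ≤ N`, and `0` for `m > N`. -/
def coeffTable : ℕ → ℕ → ZMod (2 * M) → (Fin (M + 1) → ℤ) → ℂ[X]
  | 0 => fun _ _ _ => 0
  | N + 1 => Function.update (coeffTable N) (N + 1)
      (nextCoeff K ρ ν ε τ φ ψ u v (coeffTable N) (N + 1))

/-- The modulation function
`z_j^k = δ^{m(j,k)} ∑_{m = m(j,k)}^{2K-1} δ^{(m - m(j,k))(1-2ν)} z_{j,m}^k`, `δ = √ε`,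
of the modulated Fourier expansion of the numerical solution with initial data `(u, v)`. -/
def modFun (j : ZMod (2 * M)) (k : Fin (M + 1) → ℤ) : ℂ[X] :=
  ∑ m ∈ Finset.Icc (level K j k) (2 * K - 1),
    C ((Real.sqrt ε ^ (level K j k : ℝ) *
      Real.sqrt ε ^ (((m : ℝ) - level K j k) * (1 - 2 * ν)) : ℝ) : ℂ) *
    coeffTable K ρ ν ε τ φ ψ u v (2 * K - 1) m j k

/-- The almost-invariant energy `𝓔_l(t)`. -/
def almostInvEnergy (l : Fin (M + 1)) (t : ℝ) : ℂ :=
  -(Complex.I / 2) * ∑ j : ZMod (2 * M), ∑ k ∈ modes K j,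
    (((k l : ℝ) * freq ρ l / (τ * Real.sinc (τ * freq ρ (absIdx j))) : ℝ) : ℂ) *
    (modFun K ρ ν ε τ φ ψ u v (-j) (-k)).eval ((ε ^ (ν / 2) * t : ℝ) : ℂ) *
    Complex.exp (Complex.I * (dotFreq ρ k * τ : ℝ)) *
    (modFun K ρ ν ε τ φ ψ u v j k).eval ((ε ^ (ν / 2) * (t + τ) : ℝ) : ℂ)

end Construction

end TrigInt

end

open TrigInt

namespace TrigInt

open Polynomial

/-! The energies `𝓔_l` are discrete Noether quantities. Index the modulation functions by `a = (j,
k)`. Up to a defect, they solve a second-order difference system whose nonlinearity is the gradient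
of the cubic potential `∑ g(a) g(b) g(c)` over `a + b + c = 0`. This potential does not change when
`g(j, k)` is multiplied by `exp(i k_l θ)`, because `k_l` is additive
(`sum_additive_mul_cubic_eq_zero`). Pairing the equation for `z_j^k` with `k_l z_{-j}^{-k}` yields
`𝓔_l(t + τ) - 𝓔_l(t)`: the cosine term cancels by antisymmetry, the potential contributes nothing,
and only the defect remains (`Admissible.almostInvEnergy_step`). The relation `ψ = sinc · φ` makes
the filters enter the potential symmetrically.

The defect consists of the products of total order at least `2K` (`Admissible.modFun_equation`). To
bound it, the coefficients `z_{j,m}^k` are estimated in a weighted `ℓ²` norm, uniformly in `M`, `ε`,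
`τ` (`exists_sum_weight_mul_modeMass_sq_le`). On polynomials the difference operator is a
differential operator of infinite order, inverted by a terminating Neumann series. Small divisors
cost `ε^{ν/2}` if `|j| > K` or if `k = ±⟨j⟩`; exactly there every interaction raises the level by at
least one (`level_lt_add`), and the powers of `√ε` in the recursion pay for the loss. For `|j| ≤ K`
the strong non-resonance condition leaves no loss. Since `s > 1/2`, the weighted space is a
convolution algebra, so the quadratic recursion closes.

For the powers of `ε`, let `L` be the level of `(j, k)`. In the change of `𝓔_l`, the factor
`z_{-j}^{-k}` carries `√ε^L` and the defect `√ε^{2K(1-2ν)+2νL}`, and `L ≥ e(l)` when `k_l ≠ 0`.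
After division by `ε^{e(l)}` the exponent of `√ε` is at least `(2K - e(l))(1 - 2ν)`, which is at
least `K(1 - 2ν)` in general and `(2K - 1)(1 - 2ν)` for `l = 1`. Each step contributes a factor `τ`,
and `nτ ≤ 1`. -/

/-! ### The sum of the absolute values of the coefficients of a polynomial -/

/-- The sum of the absolute values of the coefficients. -/
noncomputable def coeffNorm (p : ℂ[X]) : ℝ := p.sum fun _ a => ‖a‖

theorem coeffNorm_eq_sum_range {p : ℂ[X]} {n : ℕ} (h : p.natDegree < n) :
    coeffNorm p = ∑ i ∈ Finset.range n, ‖p.coeff i‖ :=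
  p.sum_over_range' (by simp) n h

theorem coeffNorm_nonneg (p : ℂ[X]) : 0 ≤ coeffNorm p :=
  Finset.sum_nonneg fun _ _ => norm_nonneg _

@[simp] theorem coeffNorm_zero : coeffNorm 0 = 0 := by simp [coeffNorm]

theorem coeffNorm_add_le (p q : ℂ[X]) : coeffNorm (p + q) ≤ coeffNorm p + coeffNorm q := by
  set n := max p.natDegree q.natDegree + 1
  have hp : p.natDegree < n := by omega
  have hq : q.natDegree < n := by omega
  have hpq : (p + q).natDegree < n := by
    have := natDegree_add_le p q
    omega
  rw [coeffNorm_eq_sum_range hp, coeffNorm_eq_sum_range hq, coeffNorm_eq_sum_range hpq,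
    ← Finset.sum_add_distrib]
  exact Finset.sum_le_sum fun i _ => by
    rw [coeff_add]
    exact norm_add_le _ _

theorem coeffNorm_sum_le {ι : Type*} (s : Finset ι) (f : ι → ℂ[X]) :
    coeffNorm (∑ i ∈ s, f i) ≤ ∑ i ∈ s, coeffNorm (f i) :=
  Finset.le_sum_of_subadditive coeffNorm coeffNorm_zero.le coeffNorm_add_le s f

theorem coeffNorm_monomial (n : ℕ) (a : ℂ) : coeffNorm (monomial n a) = ‖a‖ :=
  sum_monomial_index _ _ (by simp)

theorem coeffNorm_C (a : ℂ) : coeffNorm (C a) = ‖a‖ := coeffNorm_monomial 0 a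

/-- Polynomial multiplication is convolution of coefficients, so this is `ℓ¹ * ℓ¹ ⊆ ℓ¹`. It lets the
quadratic right-hand side be estimated factor by factor. -/
theorem coeffNorm_mul_le (p q : ℂ[X]) : coeffNorm (p * q) ≤ coeffNorm p * coeffNorm q := by
  rw [mul_eq_sum_sum]
  refine (coeffNorm_sum_le _ _).trans ?_
  rw [coeffNorm, coeffNorm, Polynomial.sum, Polynomial.sum, Finset.sum_mul_sum]
  refine Finset.sum_le_sum fun i _ => ?_
  rw [Polynomial.sum]
  refine (coeffNorm_sum_le _ _).trans (Finset.sum_le_sum fun j _ => ?_)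
  rw [coeffNorm_monomial, norm_mul]

theorem coeffNorm_C_mul_le (a : ℂ) (p : ℂ[X]) : coeffNorm (C a * p) ≤ ‖a‖ * coeffNorm p := by
  simpa [coeffNorm_C] using coeffNorm_mul_le (C a) p

theorem coeffNorm_smul_le (a : ℂ) (p : ℂ[X]) : coeffNorm (a • p) ≤ ‖a‖ * coeffNorm p := by
  rw [smul_eq_C_mul]
  exact coeffNorm_C_mul_le a p

theorem norm_eval_le_coeffNorm (p : ℂ[X]) {x : ℂ} (hx : ‖x‖ ≤ 1) :
    ‖p.eval x‖ ≤ coeffNorm p := by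
  rw [eval_eq_sum, coeffNorm, Polynomial.sum, Polynomial.sum]
  refine (norm_sum_le _ _).trans (Finset.sum_le_sum fun i _ => ?_)
  rw [norm_mul, norm_pow]
  exact mul_le_of_le_one_right (norm_nonneg _) (pow_le_one₀ (norm_nonneg _) hx)

/-- The constant term drops out, which leaves a free factor `‖x‖`. For `x = ±h` this factor cancels
the small denominator in `velocityTail`; `A` will be `γ⁻¹`, since `h` need not be below `1`. -/
theorem norm_eval_sub_eval_zero_le {p : ℂ[X]} {D : ℕ} (hp : p.natDegree ≤ D) {A : ℝ} (hA : 1 ≤ A)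
    {x : ℂ} (hx : ‖x‖ ≤ A) : ‖p.eval x - p.eval 0‖ ≤ ‖x‖ * A ^ D * coeffNorm p := by
  have hn : p.natDegree < D + 1 := by omega
  rw [eval_eq_sum_range' hn, eval_eq_sum_range' hn, coeffNorm_eq_sum_range hn,
    ← Finset.sum_sub_distrib, Finset.mul_sum]
  refine (norm_sum_le _ _).trans (Finset.sum_le_sum fun i hi => ?_)
  rw [← mul_sub, norm_mul, mul_comm]
  refine mul_le_mul_of_nonneg_right ?_ (norm_nonneg _)
  rcases i with _ | i
  · simp only [pow_zero, sub_self, norm_zero]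
    positivity
  · have hi' : i ≤ D := by
      have := Finset.mem_range.1 hi
      omega
    rw [zero_pow (Nat.succ_ne_zero i), sub_zero, norm_pow, pow_succ']
    exact mul_le_mul_of_nonneg_left
      ((pow_le_pow_left₀ (norm_nonneg _) hx i).trans (pow_le_pow_right₀ hA hi')) (norm_nonneg _)

theorem coeffNorm_derivative_le {p : ℂ[X]} {D : ℕ} (hp : p.natDegree ≤ D) :
    coeffNorm (derivative p) ≤ D * coeffNorm p := by
  have h1 : (derivative p).natDegree < D + 1 := by
    have := natDegree_derivative_le p
    omega
  have h2 : p.natDegree < D + 1 + 1 := by omega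
  rw [coeffNorm_eq_sum_range h1, coeffNorm_eq_sum_range h2, Finset.mul_sum,
    Finset.sum_range_succ' _ (D + 1)]
  refine le_add_of_le_of_nonneg (Finset.sum_le_sum fun i hi => ?_) (by positivity)
  rw [coeff_derivative, norm_mul, mul_comm]
  by_cases hD : i + 1 ≤ D
  · refine mul_le_mul_of_nonneg_right ?_ (norm_nonneg _)
    rw [show (i : ℂ) + 1 = ((i + 1 : ℕ) : ℂ) by push_cast; ring, Complex.norm_natCast]
    exact_mod_cast hD
  · rw [coeff_eq_zero_of_natDegree_lt (by omega)]
    simp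

theorem coeffNorm_iterate_derivative_le {p : ℂ[X]} {D : ℕ} (hp : p.natDegree ≤ D) (l : ℕ) :
    coeffNorm (derivative^[l] p) ≤ (D : ℝ) ^ l * coeffNorm p := by
  induction l with
  | zero => simp
  | succ l ih =>
    rw [Function.iterate_succ_apply', pow_succ', mul_assoc]
    refine (coeffNorm_derivative_le
      ((natDegree_iterate_derivative p l).trans ((Nat.sub_le _ _).trans hp))).trans ?_
    exact mul_le_mul_of_nonneg_left ih (by positivity)

theorem coeffNorm_antideriv_le (p : ℂ[X]) : coeffNorm (antideriv p) ≤ coeffNorm p := by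
  rw [antideriv, coeffNorm_eq_sum_range (Nat.lt_succ_self p.natDegree)]
  refine (coeffNorm_sum_le _ _).trans (Finset.sum_le_sum fun i _ => ?_)
  rw [C_mul_X_pow_eq_monomial, coeffNorm_monomial, norm_div,
    show (i : ℂ) + 1 = ((i + 1 : ℕ) : ℂ) by push_cast; ring, Complex.norm_natCast]
  refine div_le_self (norm_nonneg _) ?_
  push_cast
  linarith [(Nat.cast_nonneg i : (0 : ℝ) ≤ i)]

theorem derivative_antideriv (p : ℂ[X]) : derivative (antideriv p) = p := by
  conv_rhs => rw [p.as_sum_range_C_mul_X_pow]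
  rw [antideriv, derivative_sum]
  refine Finset.sum_congr rfl fun i _ => ?_
  have : (i : ℂ) + 1 ≠ 0 := Nat.cast_add_one_ne_zero i
  rw [derivative_C_mul_X_pow, Nat.add_sub_cancel]
  push_cast
  rw [div_mul_cancel₀ _ this]

theorem natDegree_antideriv_le (p : ℂ[X]) : (antideriv p).natDegree ≤ p.natDegree + 1 := by
  refine natDegree_sum_le_of_forall_le _ _ fun i hi => (natDegree_C_mul_X_pow_le _ _).trans ?_
  have := Finset.mem_range.1 hi
  omega

/-! ### Terminating Neumann series -/

/-- The differential operator `∑_{1 ≤ l ≤ d} c_l D^l`. -/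
noncomputable def diffOp (c : ℕ → ℂ) (d : ℕ) : Module.End ℂ ℂ[X] :=
  ∑ l ∈ Finset.Icc 1 d, c l • (derivative : Module.End ℂ ℂ[X]) ^ l

theorem diffOp_apply (c : ℕ → ℂ) (d : ℕ) (q : ℂ[X]) :
    diffOp c d q = ∑ l ∈ Finset.Icc 1 d, c l • derivative^[l] q := by
  simp [diffOp, LinearMap.sum_apply, LinearMap.smul_apply, Module.End.pow_apply]

theorem degree_derivative_lt_of_lt {q : ℂ[X]} {n : ℕ} (hq : q.degree < (n + 1 : ℕ)) :
    (derivative q).degree < n := by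
  rw [degree_lt_iff_coeff_zero] at hq ⊢
  intro m hm
  rw [coeff_derivative, hq (m + 1) (by omega), zero_mul]

theorem degree_diffOp_lt (c : ℕ → ℂ) (d : ℕ) {q : ℂ[X]} {n : ℕ} (hq : q.degree < (n + 1 : ℕ)) :
    (diffOp c d q).degree < n := by
  rw [diffOp_apply, ← mem_degreeLT]
  refine Submodule.sum_mem _ fun l hl => Submodule.smul_mem _ _ ?_
  obtain ⟨l, rfl⟩ : ∃ l', l = l' + 1 := ⟨l - 1, by have := (Finset.mem_Icc.1 hl).1; omega⟩
  rw [Function.iterate_succ_apply, mem_degreeLT]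
  have h : ∀ (l : ℕ) (p : ℂ[X]), p.degree < n → (derivative^[l] p).degree < n := by
    intro l
    induction l with
    | zero => exact fun p hp => hp
    | succ l ih =>
      exact fun p hp => ih _ (lt_of_le_of_lt (degree_derivative_le) hp)
  exact h l _ (degree_derivative_lt_of_lt hq)

/-- Every summand of `diffOp` differentiates at least once, so each application lowers the degree.
This is why the Neumann series is finite and exact. -/
theorem diffOp_pow_eq_zero (c : ℕ → ℂ) (d n : ℕ) {q : ℂ[X]} (hq : q.degree < n) :
    (diffOp c d ^ n) q = 0 := by
  induction n generalizing q with
  | zero =>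
    have : q = 0 := by
      rw [← degree_eq_bot]
      simpa using hq
    simp [this]
  | succ n ih =>
    rw [pow_succ, Module.End.mul_apply]
    exact ih (degree_diffOp_lt c d hq)

theorem natDegree_diffOp_pow_le (c : ℕ → ℂ) (d n : ℕ) (q : ℂ[X]) :
    ((diffOp c d ^ n) q).natDegree ≤ q.natDegree := by
  induction n with
  | zero => simp
  | succ n ih =>
    rw [pow_succ', Module.End.mul_apply, diffOp_apply]
    refine natDegree_sum_le_of_forall_le _ _ fun l _ => (natDegree_smul_le _ _).trans ?_
    exact (natDegree_iterate_derivative _ l).trans ((Nat.sub_le _ _).trans ih)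

theorem coeffNorm_diffOp_pow_le {c : ℕ → ℂ} {A : ℝ} (hA : 0 ≤ A) (hc : ∀ l, 1 ≤ l → ‖c l‖ ≤ A ^ l)
    {d D : ℕ} (hd : d ≤ D) {q : ℂ[X]} (hq : q.natDegree ≤ D) (n : ℕ) :
    coeffNorm ((diffOp c d ^ n) q) ≤ (∑ l ∈ Finset.Icc 1 D, (A * D) ^ l) ^ n * coeffNorm q := by
  induction n with
  | zero => simp
  | succ n ih =>
    rw [pow_succ', Module.End.mul_apply, diffOp_apply, pow_succ', mul_assoc]
    refine (coeffNorm_sum_le _ _).trans ?_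
    refine le_trans ?_ (mul_le_mul_of_nonneg_left ih (by positivity))
    rw [Finset.sum_mul]
    refine (Finset.sum_le_sum fun l hl => ?_).trans
      (Finset.sum_le_sum_of_subset_of_nonneg (Finset.Icc_subset_Icc_right hd)
        fun l _ _ => mul_nonneg (by positivity) (coeffNorm_nonneg _))
    refine (coeffNorm_smul_le _ _).trans ?_
    rw [mul_pow, mul_assoc]
    exact mul_le_mul (hc l (Finset.mem_Icc.1 hl).1)
      (coeffNorm_iterate_derivative_le ((natDegree_diffOp_pow_le c d n q).trans hq) l)
      (coeffNorm_nonneg _) (by positivity)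

/-- The bound for the terminating Neumann series on polynomials of degree at most `D`. -/
noncomputable def neumannBound (A : ℝ) (D : ℕ) : ℝ :=
  ∑ n ∈ Finset.range (D + 1), (∑ l ∈ Finset.Icc 1 D, (A * D) ^ l) ^ n

theorem neumannBound_nonneg {A : ℝ} (hA : 0 ≤ A) (D : ℕ) : 0 ≤ neumannBound A D := by
  unfold neumannBound
  positivity

theorem offDiagSol_eq (a : ℕ → ℂ) (p : ℂ[X]) :
    offDiagSol a p = ∑ n ∈ Finset.range (p.natDegree + 1),
      (diffOp (fun l => -a l / a 0) p.natDegree ^ n) ((a 0)⁻¹ • p) := by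
  simp only [offDiagSol, diffOp]

/-- If `a_0 = 0`, the operator factors through one derivative. The diagonal equation is then an
invertible one for `z'`, with shifted symbol. -/
theorem diagDeriv_eq (a : ℕ → ℂ) (p : ℂ[X]) :
    diagDeriv a p = offDiagSol (fun l => a (l + 1)) p := by
  simp only [diagDeriv, offDiagSol, zero_add]

theorem natDegree_offDiagSol_le (a : ℕ → ℂ) (p : ℂ[X]) :
    (offDiagSol a p).natDegree ≤ p.natDegree := by
  rw [offDiagSol_eq]
  exact natDegree_sum_le_of_forall_le _ _ fun n _ =>
    (natDegree_diffOp_pow_le _ _ _ _).trans (natDegree_smul_le _ _)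

theorem coeffNorm_offDiagSol_le {a : ℕ → ℂ} {A : ℝ} (hA : 0 ≤ A)
    (ha : ∀ l, 1 ≤ l → ‖a l / a 0‖ ≤ A ^ l) {p : ℂ[X]} {D : ℕ} (hp : p.natDegree ≤ D) :
    coeffNorm (offDiagSol a p) ≤ neumannBound A D * (‖a 0‖⁻¹ * coeffNorm p) := by
  rw [offDiagSol_eq, neumannBound, Finset.sum_mul]
  refine (coeffNorm_sum_le _ _).trans ?_
  have hq : ((a 0)⁻¹ • p).natDegree ≤ D := (natDegree_smul_le _ _).trans hp
  have h0 : 0 ≤ ‖a 0‖⁻¹ * coeffNorm p := mul_nonneg (by positivity) (coeffNorm_nonneg p)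
  refine (Finset.sum_le_sum fun n _ => ?_).trans
      (Finset.sum_le_sum_of_subset_of_nonneg
        (Finset.range_subset_range.2 (Nat.add_le_add_right hp 1))
        fun n _ _ => mul_nonneg (by positivity) h0)
  refine (coeffNorm_diffOp_pow_le hA (fun l hl => ?_) hp hq n).trans
    (mul_le_mul_of_nonneg_left ?_ (by positivity))
  · rw [neg_div, norm_neg]
    exact ha l hl
  · rw [← norm_inv]
    exact coeffNorm_smul_le _ _

theorem sum_smul_iterate_derivative_offDiagSol {a : ℕ → ℂ} (ha : a 0 ≠ 0) (p : ℂ[X]) {N : ℕ}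
    (hN : p.natDegree < N) :
    ∑ l ∈ Finset.range N, a l • derivative^[l] (offDiagSol a p) = p := by
  set z := offDiagSol a p with hz
  have hzd := natDegree_offDiagSol_le a p
  -- Telescoping: `(1 - T) ∑ Tⁿ q = q` because `T^(deg p + 1) q = 0`.
  have key : z - diffOp (fun l => -a l / a 0) p.natDegree z = (a 0)⁻¹ • p := by
    set T := diffOp (fun l => -a l / a 0) p.natDegree with hT
    have h1 : T z = ∑ n ∈ Finset.range (p.natDegree + 1), (T ^ (n + 1)) ((a 0)⁻¹ • p) := by
      rw [hz, offDiagSol_eq, map_sum]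
      exact Finset.sum_congr rfl fun n _ => by rw [pow_succ', Module.End.mul_apply]
    have h2 : z = ∑ n ∈ Finset.range (p.natDegree + 1), (T ^ n) ((a 0)⁻¹ • p) := by
      rw [hz, offDiagSol_eq]
    rw [h1, h2, ← Finset.sum_sub_distrib,
      Finset.sum_range_sub' (fun n => (T ^ n) ((a 0)⁻¹ • p)),
      diffOp_pow_eq_zero _ _ (p.natDegree + 1), sub_zero, pow_zero, Module.End.one_apply]
    refine lt_of_le_of_lt degree_le_natDegree ?_
    exact Nat.cast_lt.2 (lt_of_le_of_lt (natDegree_smul_le (a 0)⁻¹ p) (Nat.lt_add_one _))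
  -- Derivatives beyond the degree vanish, so one fixed cut-off `N` serves for all orders `m`.
  have h3 : ∑ l ∈ Finset.range N, a l • derivative^[l] z =
      ∑ l ∈ Finset.range (p.natDegree + 1), a l • derivative^[l] z := by
    symm
    have hN' : p.natDegree + 1 ≤ N := hN
    refine Finset.sum_subset (Finset.range_subset_range.2 hN') fun l _ hl => ?_
    rw [iterate_derivative_eq_zero, smul_zero]
    rw [Finset.mem_range, not_lt] at hl
    exact lt_of_le_of_lt hzd (Nat.lt_of_succ_le hl)
  have h4 : Finset.Ico 1 (p.natDegree + 1) = Finset.Icc 1 p.natDegree := by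
    ext x
    simp only [Finset.mem_Ico, Finset.mem_Icc]
    omega
  rw [h3, Finset.sum_range_eq_add_Ico _ (Nat.add_pos_right _ Nat.one_pos), h4]
  rw [diffOp_apply, sub_eq_iff_eq_add] at key
  have h5 : a 0 • z = p + ∑ l ∈ Finset.Icc 1 p.natDegree, -(a l • derivative^[l] z) := by
    conv_lhs => rw [key]
    rw [smul_add, smul_smul, mul_inv_cancel₀ ha, one_smul, Finset.smul_sum]
    refine congrArg (p + ·) (Finset.sum_congr rfl fun l _ => ?_)
    rw [smul_smul, mul_div_cancel₀ _ ha, neg_smul]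
  rw [Function.iterate_zero_apply, h5, Finset.sum_neg_distrib, neg_add_cancel_right]

theorem sum_smul_iterate_derivative_antideriv_diagDeriv {a : ℕ → ℂ} (ha0 : a 0 = 0) (ha : a 1 ≠ 0)
    (p : ℂ[X]) {N : ℕ} (hN : p.natDegree < N) :
    ∑ l ∈ Finset.range (N + 1), a l • derivative^[l] (antideriv (diagDeriv a p)) = p := by
  have h1 : (fun l => a (l + 1)) 0 ≠ 0 := by simpa only [zero_add] using ha
  have h2 := sum_smul_iterate_derivative_offDiagSol (a := fun l => a (l + 1)) h1 p hN
  rw [Finset.sum_range_succ', ha0, zero_smul, add_zero, diagDeriv_eq]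
  refine Eq.trans (Finset.sum_congr rfl fun l _ => ?_) h2
  rw [Function.iterate_succ_apply, derivative_antideriv]

theorem eval_add_eq_sum (z : ℂ[X]) {N : ℕ} (hN : z.natDegree < N) (x h : ℂ) :
    z.eval (x + h) =
      ∑ l ∈ Finset.range N, h ^ l / (l.factorial : ℂ) * (derivative^[l] z).eval x := by
  rw [add_comm, ← taylor_eval, eval_eq_sum_range' (by rwa [natDegree_taylor])]
  refine Finset.sum_congr rfl fun l _ => ?_
  have hl : (l.factorial : ℂ) ≠ 0 := Nat.cast_ne_zero.2 (Nat.factorial_ne_zero l)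
  have : derivative^[l] z = l.factorial • hasseDeriv l z := by
    rw [← factorial_smul_hasseDeriv, LinearMap.smul_apply]
  rw [taylor_coeff, this, eval_smul, nsmul_eq_mul]
  field_simp

/-- The symbol of the difference operator of the trigonometric integrator. -/
theorem sum_symbolCoeff_mul_eval (ρ ν ε τ : ℝ) {M : ℕ} (j : ZMod (2 * M)) (k : Fin (M + 1) → ℤ)
    (z : ℂ[X]) {N : ℕ} (hN : z.natDegree < N) (x : ℂ) :
    (∑ l ∈ Finset.range N, symbolCoeff ρ ν ε τ j k l • derivative^[l] z).eval x =
      Complex.exp (Complex.I * (dotFreq ρ k * τ : ℝ)) *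
          z.eval (x + ((τ * ε ^ (ν / 2) : ℝ) : ℂ))
        - 2 * (Real.cos (τ * freq ρ (absIdx j)) : ℂ) * z.eval x
        + Complex.exp (-(Complex.I * (dotFreq ρ k * τ : ℝ))) *
          z.eval (x - ((τ * ε ^ (ν / 2) : ℝ) : ℂ)) := by
  rw [sub_eq_add_neg x, eval_add_eq_sum z hN, eval_add_eq_sum z hN, eval_finsetSum,
    Finset.mul_sum, Finset.mul_sum]
  have h0 : 2 * (Real.cos (τ * freq ρ (absIdx j)) : ℂ) * z.eval x =
      ∑ l ∈ Finset.range N, (if l = 0 then 2 * (Real.cos (τ * freq ρ (absIdx j)) : ℂ) else 0) *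
        (derivative^[l] z).eval x := by
    rw [Finset.sum_eq_single_of_mem 0 (Finset.mem_range.2 (by omega)) (fun l _ hl => by simp [hl])]
    simp
  rw [h0, ← Finset.sum_sub_distrib, ← Finset.sum_add_distrib]
  refine Finset.sum_congr rfl fun l _ => ?_
  rw [eval_smul, smul_eq_mul, symbolCoeff, neg_pow]
  ring

/-! ### Index sets -/

section Indices

variable {K M : ℕ}

theorem absIdx_neg (j : ZMod (2 * M)) : absIdx (-j) = absIdx j :=
  ZMod.natAbs_valMinAbs_neg j

theorem absIdx_le_add (j j₁ : ZMod (2 * M)) : absIdx j ≤ absIdx j₁ + absIdx (j - j₁) := by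
  have h := ZMod.natAbs_valMinAbs_add_le j₁ (j - j₁)
  rw [add_sub_cancel] at h
  exact h.trans (Int.natAbs_add_le _ _)

theorem absIdx_le [NeZero M] (j : ZMod (2 * M)) : absIdx j ≤ M := by
  have h := ZMod.natAbs_valMinAbs_le j
  unfold absIdx
  omega

theorem eq_or_eq_neg_of_absIdx_eq {j : ZMod (2 * M)} {l : ℕ} (h : absIdx j = l) :
    j = (l : ZMod (2 * M)) ∨ j = -(l : ZMod (2 * M)) := by
  have hj := ZMod.coe_valMinAbs j
  unfold absIdx at h
  rcases Int.natAbs_eq j.valMinAbs with h1 | h1 <;> rw [h1, h] at hj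
  · left
    rw [← hj]
    push_cast
    rfl
  · right
    rw [← hj]
    push_cast
    rfl

theorem absIdx_intCast_le (r : ℤ) : absIdx (r : ZMod (2 * M)) ≤ r.natAbs := by
  rcases Nat.eq_zero_or_pos M with rfl | hM
  · exact le_of_eq rfl
  · have : NeZero (2 * M) := ⟨by omega⟩
    exact ZMod.natAbs_min_of_le_div_two (2 * M) _ _ (by simp) (ZMod.natAbs_valMinAbs_le _)

theorem sum_comp_absIdx_le [NeZero M] {f : ℕ → ℝ} (hf : ∀ l, 0 ≤ f l) :
    ∑ j : ZMod (2 * M), f (absIdx j) ≤ 2 * ∑ l ∈ Finset.range (M + 1), f l := by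
  have hmaps : ∀ j ∈ (Finset.univ : Finset (ZMod (2 * M))), absIdx j ∈ Finset.range (M + 1) :=
    fun j _ => Finset.mem_range.2 (Nat.lt_succ_of_le (absIdx_le j))
  rw [← Finset.sum_fiberwise_of_maps_to hmaps, Finset.mul_sum]
  refine Finset.sum_le_sum fun l _ => ?_
  have hcard : (Finset.univ.filter fun j : ZMod (2 * M) => absIdx j = l).card ≤ 2 := by
    refine (Finset.card_le_card (t := {(l : ZMod (2 * M)), -(l : ZMod (2 * M))})
      fun j hj => ?_).trans Finset.card_le_two
    simpa using eq_or_eq_neg_of_absIdx_eq (Finset.mem_filter.1 hj).2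
  rw [Finset.sum_congr rfl (fun j hj => by rw [(Finset.mem_filter.1 hj).2]), Finset.sum_const,
    nsmul_eq_mul]
  exact mul_le_mul_of_nonneg_right (by exact_mod_cast hcard) (hf l)

theorem unitVec_neg (j : ZMod (2 * M)) : unitVec (-j) = unitVec j := by
  unfold unitVec
  rw [absIdx_neg]

theorem unitVec_apply_self [NeZero M] (j : ZMod (2 * M)) :
    unitVec j ⟨absIdx j, Nat.lt_succ_of_le (absIdx_le j)⟩ = 1 := by
  simp [unitVec]

theorem unitVec_ne_neg [NeZero M] (j : ZMod (2 * M)) : unitVec j ≠ -unitVec j := by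
  intro h
  have := congrFun h ⟨absIdx j, Nat.lt_succ_of_le (absIdx_le j)⟩
  rw [Pi.neg_apply, unitVec_apply_self] at this
  omega

theorem dotFreq_neg (ρ : ℝ) (k : Fin (M + 1) → ℤ) : dotFreq ρ (-k) = -dotFreq ρ k := by
  simp [dotFreq, Finset.sum_neg_distrib]

theorem dotFreq_unitVec [NeZero M] (ρ : ℝ) (j : ZMod (2 * M)) :
    dotFreq ρ (unitVec j) = freq ρ (absIdx j) := by
  unfold dotFreq
  rw [Finset.sum_eq_single (⟨absIdx j, Nat.lt_succ_of_le (absIdx_le j)⟩ : Fin (M + 1))]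
  · rw [unitVec_apply_self]
    simp
  · intro l _ hl
    have : (l : ℕ) ≠ absIdx j := fun h => hl (Fin.ext h)
    simp [unitVec, this]
  · simp

theorem mu_neg (k : Fin (M + 1) → ℤ) : mu K (-k) = mu K k := by simp [mu]

theorem InK.neg {j : ZMod (2 * M)} {k : Fin (M + 1) → ℤ} (h : InK K j k) : InK K (-j) (-k) := by
  rcases h with ⟨h1, h2⟩ | ⟨r, h, h1, h2, h3, h4⟩
  · left
    rw [absIdx_neg, mu_neg]
    exact ⟨h1, fun l hl => by rw [Pi.neg_apply, h2 l hl, neg_zero]⟩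
  · right
    have hr : -j - ((-r : ℤ) : ZMod (2 * M)) = -(j - (r : ZMod (2 * M))) := by
      push_cast
      ring
    refine ⟨-r, -h, ?_, by rwa [abs_neg], by rwa [mu_neg], ?_⟩
    · rwa [hr, absIdx_neg]
    · rw [hr, unitVec_neg]
      rcases h4 with rfl | rfl
      · right
        rw [neg_add]
      · left
        rw [neg_add, neg_neg]

theorem mem_modes {j : ZMod (2 * M)} {k : Fin (M + 1) → ℤ} : k ∈ modes K j ↔ InK K j k := by
  simp [modes]

theorem neg_mem_modes {j : ZMod (2 * M)} {k : Fin (M + 1) → ℤ} (h : k ∈ modes K j) :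
    -k ∈ modes K (-j) :=
  mem_modes.2 (mem_modes.1 h).neg

theorem sum_modes_neg_apply {R : Type*} [AddCommMonoid R] (j : ZMod (2 * M))
    (f : (Fin (M + 1) → ℤ) → R) : ∑ k ∈ modes K j, f (-k) = ∑ k ∈ modes K (-j), f k := by
  refine Finset.sum_bij' (fun k _ => -k) (fun k _ => -k) (fun k hk => neg_mem_modes hk)
    (fun k hk => ?_) (by simp) (by simp) (by simp)
  simpa using neg_mem_modes hk

theorem sum_modes_neg [NeZero M] {R : Type*} [AddCommMonoid R]
    (f : ZMod (2 * M) → (Fin (M + 1) → ℤ) → R) :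
    ∑ j, ∑ k ∈ modes K j, f (-j) (-k) = ∑ j, ∑ k ∈ modes K j, f j k := by
  rw [← Equiv.sum_comp (Equiv.neg (ZMod (2 * M))) (fun j => ∑ k ∈ modes K j, f j k)]
  exact Finset.sum_congr rfl fun j _ => sum_modes_neg_apply j (f (-j))

theorem profile_pos (hK : 1 ≤ K) (l : ℕ) : 1 ≤ profile K l := by
  unfold profile
  split_ifs <;> omega

theorem profile_le (hK : 2 ≤ K) (l : ℕ) : profile K l ≤ K := by
  unfold profile
  split_ifs <;> omega

theorem profile_eq_of_le (hK : 1 ≤ K) {l : ℕ} (h : K ≤ l) : profile K l = K := by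
  unfold profile
  split_ifs <;> omega

theorem profile_le_add (hK : 2 ≤ K) {l l₁ l₂ : ℕ} (h : l ≤ l₁ + l₂) :
    profile K l ≤ profile K l₁ + profile K l₂ := by
  unfold profile
  split_ifs <;> omega

/-- The condition `K < l` is sharp: `l₁ = 1`, `l₂ = K - 1` gives only `K` for `l = K`. Hence the
mode `|j| = K` falls under the strong non-resonance condition. -/
theorem lt_profile_add (hK : 2 ≤ K) {l l₁ l₂ : ℕ} (h : l ≤ l₁ + l₂) (hl : K < l) :
    K + 1 ≤ profile K l₁ + profile K l₂ := by
  unfold profile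
  split_ifs <;> omega

theorem level_neg (j : ZMod (2 * M)) (k : Fin (M + 1) → ℤ) : level K (-j) (-k) = level K j k := by
  simp [level, absIdx_neg]

theorem profile_le_level (j : ZMod (2 * M)) (k : Fin (M + 1) → ℤ) :
    profile K (absIdx j) ≤ level K j k := le_max_left _ _

theorem profile_le_level_of_ne_zero (j : ZMod (2 * M)) {k : Fin (M + 1) → ℤ} {l : Fin (M + 1)}
    (hl : k l ≠ 0) : profile K l ≤ level K j k :=
  le_max_of_le_right (Finset.le_sup (f := fun l : Fin (M + 1) => profile K (l : ℕ))
    (Finset.mem_filter.2 ⟨Finset.mem_univ l, hl⟩))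

theorem level_le {j : ZMod (2 * M)} {k : Fin (M + 1) → ℤ} {n : ℕ}
    (h : profile K (absIdx j) ≤ n) (h' : ∀ l, k l ≠ 0 → profile K (l : ℕ) ≤ n) :
    level K j k ≤ n :=
  max_le h (Finset.sup_le fun l hl => h' l (Finset.mem_filter.1 hl).2)

theorem level_le_self (hK : 2 ≤ K) (j : ZMod (2 * M)) (k : Fin (M + 1) → ℤ) : level K j k ≤ K :=
  level_le (profile_le hK _) fun _ _ => profile_le hK _

theorem one_le_level (hK : 1 ≤ K) (j : ZMod (2 * M)) (k : Fin (M + 1) → ℤ) : 1 ≤ level K j k :=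
  (profile_pos hK _).trans (profile_le_level j k)

theorem ne_zero_or_sub_ne_zero {k k₁ : Fin (M + 1) → ℤ} {l : Fin (M + 1)} (h : k l ≠ 0) :
    k₁ l ≠ 0 ∨ (k - k₁) l ≠ 0 := by
  rw [Pi.sub_apply]
  omega

/-- Subadditivity makes the exponents of `√ε` in `rhsPoly` nonnegative, so these weights are at most
`1`. -/
theorem level_le_add (hK : 2 ≤ K) (j j₁ : ZMod (2 * M)) (k k₁ : Fin (M + 1) → ℤ) :
    level K j k ≤ level K j₁ k₁ + level K (j - j₁) (k - k₁) := by
  refine level_le ((profile_le_add hK (absIdx_le_add j j₁)).trans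
    (Nat.add_le_add (profile_le_level _ _) (profile_le_level _ _))) fun l hl => ?_
  rcases ne_zero_or_sub_ne_zero (k₁ := k₁) hl with h | h
  · exact (profile_le_level_of_ne_zero j₁ h).trans (Nat.le_add_right _ _)
  · exact (profile_le_level_of_ne_zero (j - j₁) h).trans (Nat.le_add_left _ _)

theorem level_unitVec {j : ZMod (2 * M)} {k : Fin (M + 1) → ℤ}
    (hk : k = unitVec j ∨ k = -unitVec j) : level K j k = profile K (absIdx j) := by
  refine le_antisymm (level_le le_rfl fun l hl => ?_) (profile_le_level j k)
  have : (l : ℕ) = absIdx j := by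
    by_contra h
    rcases hk with rfl | rfl <;> simp [unitVec, h] at hl
  rw [this]

/-- Interactions that feed a diagonal mode, or a mode with `|j| > K`, raise the level. -/
theorem level_lt_add [NeZero M] (hK : 2 ≤ K) (j j₁ : ZMod (2 * M)) (k k₁ : Fin (M + 1) → ℤ)
    (h : K < absIdx j ∨ k = unitVec j ∨ k = -unitVec j) :
    level K j k + 1 ≤ level K j₁ k₁ + level K (j - j₁) (k - k₁) := by
  rcases h with h | h
  · have h1 := level_le_self hK j k
    have h2 := lt_profile_add hK (absIdx_le_add j j₁) h
    have h3 := profile_le_level (K := K) j₁ k₁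
    have h4 := profile_le_level (K := K) (j - j₁) (k - k₁)
    omega
  · rw [level_unitVec h]
    -- Since `k` does not vanish at `|j|`, neither does one of its two summands. That factor has
    -- level at least `e(j)`, and the other has level at least `1`.
    have hl : k ⟨absIdx j, Nat.lt_succ_of_le (absIdx_le j)⟩ ≠ 0 := by
      rcases h with rfl | rfl
      · rw [unitVec_apply_self]
        exact one_ne_zero
      · rw [Pi.neg_apply, unitVec_apply_self]
        exact neg_ne_zero.2 one_ne_zero
    have h1 := one_le_level (by omega : 1 ≤ K) j₁ k₁
    have h2 := one_le_level (by omega : 1 ≤ K) (j - j₁) (k - k₁)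
    rcases ne_zero_or_sub_ne_zero (k₁ := k₁) hl with h | h
    · have := profile_le_level_of_ne_zero (K := K) j₁ h
      simp only at this
      omega
    · have := profile_le_level_of_ne_zero (K := K) (j - j₁) h
      simp only at this
      omega

/-- This makes the non-resonance condition available for `k = ⟨j⟩`, where it bounds `sin(τω_j)` from
below. -/
theorem inK_unitVec (hK : 2 ≤ K) (j : ZMod (2 * M)) : InK K j (unitVec j) := by
  by_cases h : K ≤ absIdx j
  · right
    refine ⟨0, 0, by simpa using h, by simp; omega, by simp [mu]; omega, Or.inl (by simp)⟩
  · left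
    refine ⟨max_lt (by omega) ?_, fun l hl => ?_⟩
    · have : mu K (unitVec j) ≤ profile K (absIdx j) := by
        unfold mu
        by_cases hM : absIdx j < M + 1
        · rw [Finset.sum_eq_single (⟨absIdx j, hM⟩ : Fin (M + 1))]
          · simp [unitVec]
          · intro l _ hl
            have : (l : ℕ) ≠ absIdx j := fun h => hl (Fin.ext h)
            simp [unitVec, this]
          · simp
        · rw [Finset.sum_eq_zero]
          · exact Nat.zero_le _
          · intro l _
            have : (l : ℕ) ≠ absIdx j := by have := l.2; omega
            simp [unitVec, this]
      have := profile_le hK (absIdx j)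
      omega
    · have : (l : ℕ) ≠ absIdx j := by omega
      simp [unitVec, this]

theorem sum_natAbs_le_mu (hK : 1 ≤ K) (k : Fin (M + 1) → ℤ) : ∑ l, (k l).natAbs ≤ mu K k :=
  Finset.sum_le_sum fun l _ => Nat.le_mul_of_pos_right _ (profile_pos hK l)

theorem sum_natAbs_unitVec_le (j : ZMod (2 * M)) : ∑ l, (unitVec j l).natAbs ≤ 1 := by
  by_cases hM : absIdx j < M + 1
  · rw [Finset.sum_eq_single (⟨absIdx j, hM⟩ : Fin (M + 1))]
    · simp [unitVec]
    · intro l _ hl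
      have : (l : ℕ) ≠ absIdx j := fun h => hl (Fin.ext h)
      simp [unitVec, this]
    · simp
  · rw [Finset.sum_eq_zero]
    · exact Nat.zero_le _
    · intro l _
      have : (l : ℕ) ≠ absIdx j := by have := l.2; omega
      simp [unitVec, this]

theorem InK.sum_natAbs_le {j : ZMod (2 * M)} {k : Fin (M + 1) → ℤ} (h : InK K j k) (hK : 1 ≤ K) :
    ∑ l, (k l).natAbs ≤ 2 * K := by
  rcases h with ⟨h1, -⟩ | ⟨r, h, -, -, h3, h4⟩
  · have := sum_natAbs_le_mu hK k
    omega
  · have h5 := sum_natAbs_le_mu hK h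
    have h6 := sum_natAbs_unitVec_le (j - (r : ZMod (2 * M)))
    have h7 : ∑ l, (k l).natAbs ≤
        ∑ l, ((unitVec (j - (r : ZMod (2 * M))) l).natAbs + (h l).natAbs) := by
      refine Finset.sum_le_sum fun l _ => ?_
      rcases h4 with rfl | rfl
      · exact Int.natAbs_add_le _ _
      · refine (Int.natAbs_add_le _ _).trans ?_
        rw [Pi.neg_apply, Int.natAbs_neg]
    rw [Finset.sum_add_distrib] at h7
    omega

/-- A multi-index attached to `j` involves no frequency far above `|j|`. In the second part of `𝒦`,
`μ(h) < K` forces `h` to vanish at all `l ≥ K`, where `e(l) = K`; only the unit vector at `|j - r| ≤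
|j| + K` remains. This lets the weight of `l` be exchanged for that of `j`. -/
theorem InK.le_absIdx_add {j : ZMod (2 * M)} {k : Fin (M + 1) → ℤ} (h : InK K j k) (hK : 1 ≤ K)
    {l : Fin (M + 1)} (hl : k l ≠ 0) : (l : ℕ) ≤ absIdx j + K := by
  by_contra hlt
  rcases h with ⟨-, h2⟩ | ⟨r, h, -, h2, h3, h4⟩
  · exact hl (h2 l (by omega))
  · have h5 : h l = 0 := by
      have h6 : (h l).natAbs * profile K l ≤ mu K h :=
        Finset.single_le_sum (f := fun l : Fin (M + 1) => (h l).natAbs * profile K l)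
          (fun _ _ => Nat.zero_le _) (Finset.mem_univ l)
      rw [profile_eq_of_le hK (by omega)] at h6
      by_contra h7
      have h8 : 1 ≤ (h l).natAbs := Int.natAbs_pos.2 h7
      have := Nat.mul_le_mul_right K h8
      omega
    have h6 : (l : ℕ) = absIdx (j - (r : ZMod (2 * M))) := by
      by_contra h7
      rcases h4 with rfl | rfl <;> simp [unitVec, h5, h7] at hl
    have h7 := ZMod.natAbs_valMinAbs_add_le j (-(r : ZMod (2 * M)))
    have h8 := Int.natAbs_add_le j.valMinAbs (-(r : ZMod (2 * M))).valMinAbs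
    have h9 : absIdx (-(r : ZMod (2 * M))) ≤ r.natAbs := by
      rw [absIdx_neg]
      exact absIdx_intCast_le r
    rw [← sub_eq_add_neg] at h7
    rw [Int.abs_eq_natAbs] at h2
    unfold absIdx at *
    omega

end Indices

/-! ### Weights -/

section Weights

theorem one_le_weight {s : ℝ} (hs : 1 / 2 < s) (l : ℕ) : 1 ≤ weight s l :=
  Real.one_le_rpow (le_max_right _ _) (by linarith)

theorem weight_pos {s : ℝ} (hs : 1 / 2 < s) (l : ℕ) : 0 < weight s l :=
  zero_lt_one.trans_le (one_le_weight hs l)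

theorem weight_le_mul {s : ℝ} (hs : 1 / 2 < s) {c : ℝ} (hc : 0 ≤ c) {l l' : ℕ}
    (h : max (l : ℝ) 1 ≤ c * max (l' : ℝ) 1) : weight s l ≤ c ^ (2 * s) * weight s l' := by
  unfold weight
  rw [← Real.mul_rpow hc (by positivity)]
  exact Real.rpow_le_rpow (by positivity) h (by linarith)

theorem weight_le_add {s : ℝ} (hs : 1 / 2 < s) {l l₁ l₂ : ℕ} (h : l ≤ l₁ + l₂) :
    weight s l ≤ 2 ^ (2 * s) * (weight s l₁ + weight s l₂) := by
  have h' : (l : ℝ) ≤ l₁ + l₂ := by exact_mod_cast h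
  have h0 : (0 : ℝ) ≤ 2 ^ (2 * s) := by positivity
  rw [mul_add]
  rcases le_total l₁ l₂ with h1 | h1
  · have h1' : (l₁ : ℝ) ≤ l₂ := by exact_mod_cast h1
    refine (weight_le_mul hs zero_le_two (l' := l₂) (max_le ?_ ?_)).trans
      (le_add_of_nonneg_left (mul_nonneg h0 (weight_pos hs _).le))
    · linarith [le_max_left (l₂ : ℝ) 1]
    · linarith [le_max_right (l₂ : ℝ) 1]
  · have h1' : (l₂ : ℝ) ≤ l₁ := by exact_mod_cast h1
    refine (weight_le_mul hs zero_le_two (l' := l₁) (max_le ?_ ?_)).trans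
      (le_add_of_nonneg_right (mul_nonneg h0 (weight_pos hs _).le))
    · linarith [le_max_left (l₁ : ℝ) 1]
    · linarith [le_max_right (l₁ : ℝ) 1]

theorem summable_inv_weight {s : ℝ} (hs : 1 / 2 < s) : Summable fun l : ℕ => (weight s l)⁻¹ := by
  rw [← summable_nat_add_iff 1]
  have h := (summable_nat_add_iff 1).2 (Real.summable_nat_rpow_inv.2 (by linarith : 1 < 2 * s))
  refine h.congr fun l => ?_
  unfold weight
  rw [max_eq_left]
  push_cast
  linarith [(Nat.cast_nonneg l : (0 : ℝ) ≤ l)]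

/-- The algebra property of the weighted `ℓ²` norm, uniformly in the dimension. -/
theorem exists_sum_weight_mul_conv_sq_le {s : ℝ} (hs : 1 / 2 < s) :
    ∃ A : ℝ, 0 ≤ A ∧ ∀ (M : ℕ) [NeZero M] (f : ZMod (2 * M) → ℝ),
      ∑ j, weight s (absIdx j) * (∑ j₁, f j₁ * f (j - j₁)) ^ 2 ≤
        A * (∑ j, weight s (absIdx j) * f j ^ 2) ^ 2 := by
  set S := ∑' l : ℕ, (weight s l)⁻¹ with hS
  have hS0 : 0 ≤ S := tsum_nonneg fun l => inv_nonneg.2 (weight_pos hs l).le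
  refine ⟨2 ^ (2 * s) * (2 * S + 2 * S), by positivity, fun M _ f => ?_⟩
  set σ : ZMod (2 * M) → ℝ := fun j => weight s (absIdx j) with hσ
  have hσ0 : ∀ j, 0 < σ j := fun j => weight_pos hs _
  have hsum : ∑ j, (σ j)⁻¹ ≤ 2 * S := by
    refine (sum_comp_absIdx_le (f := fun l => (weight s l)⁻¹)
      fun l => inv_nonneg.2 (weight_pos hs l).le).trans ?_
    exact mul_le_mul_of_nonneg_left ((summable_inv_weight hs).sum_le_tsum _
      fun l _ => inv_nonneg.2 (weight_pos hs l).le) zero_le_two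
  -- Cauchy–Schwarz after splitting off `(σ_{j₁} σ_{j-j₁})^{-1/2}`.
  have hcs : ∀ j, (∑ j₁, f j₁ * f (j - j₁)) ^ 2 ≤ (∑ j₁, (σ j₁ * σ (j - j₁))⁻¹) *
      ∑ j₁, (σ j₁ * f j₁ ^ 2) * (σ (j - j₁) * f (j - j₁) ^ 2) := by
    intro j
    refine Finset.sum_sq_le_sum_mul_sum_of_sq_le_mul _ (fun j₁ _ => ?_) (fun j₁ _ => ?_)
      fun j₁ _ => ?_
    · exact inv_nonneg.2 (mul_pos (hσ0 _) (hσ0 _)).le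
    · have := hσ0 j₁
      have := hσ0 (j - j₁)
      positivity
    · have h1 := (hσ0 j₁).ne'
      have h2 := (hσ0 (j - j₁)).ne'
      refine le_of_eq ?_
      field_simp
  -- By `weight_le_add`, `σ_j / (σ_{j₁} σ_{j-j₁})` is at most a constant times `1/σ_{j₁} +
  -- 1/σ_{j-j₁}`. Both sums are bounded independently of `M` because `2s > 1`.
  have hker : ∀ j, σ j * ∑ j₁, (σ j₁ * σ (j - j₁))⁻¹ ≤ 2 ^ (2 * s) * (2 * S + 2 * S) := by
    intro j
    calc σ j * ∑ j₁, (σ j₁ * σ (j - j₁))⁻¹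
        ≤ ∑ j₁, 2 ^ (2 * s) * ((σ j₁)⁻¹ + (σ (j - j₁))⁻¹) := by
          rw [Finset.mul_sum]
          refine Finset.sum_le_sum fun j₁ _ => ?_
          have h1 := hσ0 j₁
          have h2 := hσ0 (j - j₁)
          refine (mul_le_mul_of_nonneg_right (weight_le_add hs (absIdx_le_add j j₁))
            (inv_nonneg.2 (mul_pos h1 h2).le)).trans (le_of_eq ?_)
          change 2 ^ (2 * s) * (σ j₁ + σ (j - j₁)) * _ = _
          field_simp
          ring
      _ = 2 ^ (2 * s) * (∑ j₁, (σ j₁)⁻¹ + ∑ j₁, (σ j₁)⁻¹) := by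
          rw [← Finset.mul_sum, Finset.sum_add_distrib]
          congr 2
          exact Equiv.sum_comp (Equiv.subLeft j) fun j₁ => (σ j₁)⁻¹
      _ ≤ _ := mul_le_mul_of_nonneg_left (add_le_add hsum hsum) (by positivity)
  calc ∑ j, σ j * (∑ j₁, f j₁ * f (j - j₁)) ^ 2
      ≤ ∑ j, 2 ^ (2 * s) * (2 * S + 2 * S) *
          ∑ j₁, (σ j₁ * f j₁ ^ 2) * (σ (j - j₁) * f (j - j₁) ^ 2) := by
        refine Finset.sum_le_sum fun j _ => ?_
        refine (mul_le_mul_of_nonneg_left (hcs j) (hσ0 j).le).trans ?_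
        rw [← mul_assoc]
        refine mul_le_mul_of_nonneg_right (hker j) (Finset.sum_nonneg fun j₁ _ => ?_)
        have := hσ0 j₁
        have := hσ0 (j - j₁)
        positivity
    _ = _ := by
        rw [← Finset.mul_sum, Finset.sum_comm, sq]
        congr 1
        rw [Finset.sum_mul]
        refine Finset.sum_congr rfl fun j₁ _ => ?_
        rw [← Finset.mul_sum]
        congr 1
        exact Equiv.sum_comp (Equiv.subRight j₁) fun j => σ j * f j ^ 2

theorem freq_pos {ρ : ℝ} (hρ : 0 < ρ) (l : ℕ) : 0 < freq ρ l :=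
  Real.sqrt_pos.2 (by positivity)

theorem exists_weight_mul_freq_le {s ρ : ℝ} (hs : 1 / 2 < s) (hρ : 0 < ρ) (K : ℕ) :
    ∃ A : ℝ, 0 ≤ A ∧ ∀ l l' : ℕ, l ≤ l' + K →
      weight s l * freq ρ l ≤ A * (weight s l' * freq ρ l') := by
  refine ⟨((K : ℝ) + 1) ^ (2 * s) * Real.sqrt (((K : ℝ) + 1) ^ 2 * (1 + ρ⁻¹)), by positivity,
    fun l l' h => ?_⟩
  have h' : (l : ℝ) ≤ l' + K := by exact_mod_cast h
  have hK : (0 : ℝ) ≤ K := Nat.cast_nonneg K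
  have hl' : (0 : ℝ) ≤ l' := Nat.cast_nonneg l'
  have hl : (0 : ℝ) ≤ l := Nat.cast_nonneg l
  have hmax : max (l : ℝ) 1 ≤ ((K : ℝ) + 1) * max (l' : ℝ) 1 := by
    have h1 := le_max_left (l' : ℝ) 1
    have h2 := le_max_right (l' : ℝ) 1
    refine max_le ?_ ?_ <;> nlinarith
  have h1 := weight_le_mul hs (by positivity) hmax
  have h2 : freq ρ l ≤ Real.sqrt (((K : ℝ) + 1) ^ 2 * (1 + ρ⁻¹)) * freq ρ l' := by
    unfold freq
    rw [← Real.sqrt_mul (by positivity)]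
    refine Real.sqrt_le_sqrt ?_
    have h3 : (l : ℝ) ^ 2 ≤ ((K : ℝ) + 1) ^ 2 * ((l' : ℝ) ^ 2 + 1) := by
      have h4 : (l : ℝ) ^ 2 ≤ (l' + K) ^ 2 := pow_le_pow_left₀ hl h' 2
      nlinarith [sq_nonneg ((K : ℝ) * l' - 1)]
    have h5 : ((K : ℝ) + 1) ^ 2 * (1 + ρ⁻¹) * ((l' : ℝ) ^ 2 + ρ) =
        ((K : ℝ) + 1) ^ 2 * ((l' : ℝ) ^ 2 + 1) + ((K : ℝ) + 1) ^ 2 * ρ +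
          ((K : ℝ) + 1) ^ 2 * ρ⁻¹ * (l' : ℝ) ^ 2 := by
      field_simp
      ring
    have h6 : ρ ≤ ((K : ℝ) + 1) ^ 2 * ρ := le_mul_of_one_le_left hρ.le (by nlinarith)
    have h7 : 0 ≤ ((K : ℝ) + 1) ^ 2 * ρ⁻¹ * (l' : ℝ) ^ 2 := by positivity
    linarith
  calc weight s l * freq ρ l ≤ (((K : ℝ) + 1) ^ (2 * s) * weight s l') *
        (Real.sqrt (((K : ℝ) + 1) ^ 2 * (1 + ρ⁻¹)) * freq ρ l') :=
        mul_le_mul h1 h2 (freq_pos hρ l).le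
          (mul_nonneg (by positivity) (weight_pos hs l').le)
    _ = _ := by ring

end Weights

/-! ### The symbol of the difference operator under the non-resonance condition -/

/-- The assumptions on the parameters of the method. -/
structure Admissible (K M : ℕ) (ρ ν γ B ε τ : ℝ) (φ ψ : ℝ → ℝ) : Prop where
  three_le : 3 ≤ K
  nu_nonneg : 0 ≤ ν
  nu_lt : ν < 1 / 2
  rho_pos : 0 < ρ
  gamma_pos : 0 < γ
  gamma_le : γ ≤ 1
  tau_pos : 0 < τ
  eps_pos : 0 < ε
  eps_le : ε ≤ 1
  filter_le : ∀ ξ, |φ ξ| ≤ B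
  filter_eq : ∀ ξ, ψ ξ = Real.sinc ξ * φ ξ
  nonRes : NonResonant K M ρ ν γ ε τ

theorem norm_exp_add_pow_mul_exp_le (l : ℕ) (x : ℝ) :
    ‖Complex.exp (Complex.I * (x : ℂ)) + (-1) ^ l * Complex.exp (-(Complex.I * (x : ℂ)))‖ ≤ 2 := by
  refine (norm_add_le _ _).trans ?_
  have h : -(Complex.I * (x : ℂ)) = Complex.I * ((-x : ℝ) : ℂ) := by
    push_cast
    ring
  rw [h, norm_mul, norm_pow, norm_neg, norm_one, one_pow, one_mul,
    Complex.norm_exp_I_mul_ofReal, Complex.norm_exp_I_mul_ofReal]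
  norm_num

theorem exp_add_exp_neg (x : ℝ) :
    Complex.exp (Complex.I * (x : ℂ)) + Complex.exp (-(Complex.I * (x : ℂ))) =
      2 * ((Real.cos x : ℝ) : ℂ) := by
  rw [Complex.ofReal_cos, Complex.cos]
  ring_nf

theorem exp_sub_exp_neg (x : ℝ) :
    Complex.exp (Complex.I * (x : ℂ)) - Complex.exp (-(Complex.I * (x : ℂ))) =
      2 * Complex.I * ((Real.sin x : ℝ) : ℂ) := by
  rw [Complex.ofReal_sin, Complex.sin]
  ring_nf
  rw [Complex.I_sq]
  ring

section Symbol

variable {M : ℕ} (ρ ν ε τ : ℝ) (j : ZMod (2 * M)) (k : Fin (M + 1) → ℤ)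

theorem symbolCoeff_zero : symbolCoeff ρ ν ε τ j k 0 =
    ((4 * Real.sin (τ * (freq ρ (absIdx j) + dotFreq ρ k) / 2) *
      Real.sin (τ * (freq ρ (absIdx j) - dotFreq ρ k) / 2) : ℝ) : ℂ) := by
  unfold symbolCoeff
  rw [pow_zero, pow_zero, one_mul, exp_add_exp_neg, if_pos rfl, Nat.factorial_zero, Nat.cast_one,
    div_one, one_mul]
  have h := Real.cos_sub_cos (dotFreq ρ k * τ) (τ * freq ρ (absIdx j))
  have h1 : Real.sin ((dotFreq ρ k * τ - τ * freq ρ (absIdx j)) / 2) =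
      -Real.sin (τ * (freq ρ (absIdx j) - dotFreq ρ k) / 2) := by
    rw [← Real.sin_neg]
    ring_nf
  have h2 : (dotFreq ρ k * τ + τ * freq ρ (absIdx j)) / 2 =
      τ * (freq ρ (absIdx j) + dotFreq ρ k) / 2 := by ring
  rw [h1, h2] at h
  rw [← mul_sub, ← Complex.ofReal_sub, h]
  push_cast
  ring

theorem symbolCoeff_one : symbolCoeff ρ ν ε τ j k 1 =
    ((2 * (τ * ε ^ (ν / 2)) * Real.sin (dotFreq ρ k * τ) : ℝ) : ℂ) * Complex.I := by
  unfold symbolCoeff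
  rw [pow_one, pow_one, neg_one_mul, ← sub_eq_add_neg, exp_sub_exp_neg, if_neg one_ne_zero,
    Nat.factorial_one, Nat.cast_one, div_one, sub_zero]
  push_cast
  ring

theorem norm_symbolCoeff_le (hh : 0 ≤ τ * ε ^ (ν / 2)) {l : ℕ} (hl : l ≠ 0) :
    ‖symbolCoeff ρ ν ε τ j k l‖ ≤ 2 * (τ * ε ^ (ν / 2)) ^ l := by
  unfold symbolCoeff
  rw [if_neg hl, sub_zero, norm_mul, norm_div, norm_pow, Complex.norm_real, Real.norm_of_nonneg hh,
    Complex.norm_natCast, mul_comm]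
  refine mul_le_mul (norm_exp_add_pow_mul_exp_le l _) (div_le_self (pow_nonneg hh l) ?_)
    (by positivity) zero_le_two
  exact_mod_cast Nat.one_le_iff_ne_zero.2 (Nat.factorial_ne_zero l)

end Symbol

theorem abs_sin_add_le (x y : ℝ) : |Real.sin (x + y)| ≤ |Real.sin x| + |Real.sin y| := by
  rw [Real.sin_add]
  refine (abs_add_le _ _).trans ?_
  rw [abs_mul, abs_mul]
  have h1 := Real.abs_cos_le_one x
  have h2 := Real.abs_cos_le_one y
  have h3 := abs_nonneg (Real.sin x)
  have h4 := abs_nonneg (Real.sin y)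
  nlinarith

theorem abs_sin_sub_le (x y : ℝ) : |Real.sin (x - y)| ≤ |Real.sin x| + |Real.sin y| := by
  rw [sub_eq_add_neg]
  refine (abs_sin_add_le _ _).trans ?_
  rw [Real.sin_neg, abs_neg]

theorem mul_sinc (x y : ℝ) (hx : x ≠ 0) : y * Real.sinc (x * y) = Real.sin (x * y) / x := by
  by_cases hy : y = 0
  · simp [hy]
  · rw [Real.sinc_of_ne_zero (mul_ne_zero hx hy)]
    field_simp

theorem add_div_mul_le {c p q : ℝ} (hc : 0 < c) (hp : c ≤ p) (hq : c ≤ q) :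
    (p + q) / (p * q) ≤ 2 / c := by
  have hp0 := hc.trans_le hp
  have hq0 := hc.trans_le hq
  rw [div_le_div_iff₀ (mul_pos hp0 hq0) hc]
  nlinarith [mul_le_mul_of_nonneg_left hp hq0.le, mul_le_mul_of_nonneg_left hq hp0.le]

namespace Admissible

variable {K M : ℕ} {ρ ν γ B ε τ : ℝ} {φ ψ : ℝ → ℝ}

theorem bound_nonneg (H : Admissible K M ρ ν γ B ε τ φ ψ) : 0 ≤ B :=
  (abs_nonneg _).trans (H.filter_le 0)

theorem loss_pos (H : Admissible K M ρ ν γ B ε τ φ ψ) : 0 < ε ^ (ν / 2) :=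
  Real.rpow_pos_of_pos H.eps_pos _

theorem loss_le_one (H : Admissible K M ρ ν γ B ε τ φ ψ) : ε ^ (ν / 2) ≤ 1 :=
  Real.rpow_le_one H.eps_pos.le H.eps_le (by linarith [H.nu_nonneg])

theorem step_pos (H : Admissible K M ρ ν γ B ε τ φ ψ) : 0 < τ * ε ^ (ν / 2) :=
  mul_pos H.tau_pos H.loss_pos

/-- For `k = ⟨j⟩` the argument `τ(ω_j + k·ω)/2` equals `τω_j`. -/
theorem abs_sin_diag [NeZero M] (H : Admissible K M ρ ν γ B ε τ φ ψ) (j : ZMod (2 * M)) :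
    γ * (τ * ε ^ (ν / 2)) ≤ |Real.sin (τ * freq ρ (absIdx j))| := by
  have h := (H.nonRes.1 j _ (inK_unitVec (by have := H.three_le; omega) j)).1 (unitVec_ne_neg j)
  rw [dotFreq_unitVec] at h
  rw [← mul_assoc]
  refine h.trans (le_of_eq ?_)
  ring_nf

theorem abs_sin_diag_pos [NeZero M] (H : Admissible K M ρ ν γ B ε τ φ ψ) (j : ZMod (2 * M)) :
    0 < |Real.sin (τ * freq ρ (absIdx j))| :=
  (mul_pos H.gamma_pos H.step_pos).trans_le (H.abs_sin_diag j)

/-- No bound on `τ` is assumed; it follows from non-resonance, since a sine is at most `1`. Powers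
of `h` can thus be absorbed into constants depending on `γ`. -/
theorem step_le [NeZero M] (H : Admissible K M ρ ν γ B ε τ φ ψ) : τ * ε ^ (ν / 2) ≤ γ⁻¹ := by
  rw [le_inv_comm₀ H.step_pos H.gamma_pos, ← one_div, le_div_iff₀ H.step_pos]
  exact (H.abs_sin_diag 0).trans (Real.abs_sin_le_one _)

theorem one_le_inv_gamma (H : Admissible K M ρ ν γ B ε τ φ ψ) : 1 ≤ γ⁻¹ :=
  (one_le_inv₀ H.gamma_pos).2 H.gamma_le

theorem sinc_eq (H : Admissible K M ρ ν γ B ε τ φ ψ) (j : ZMod (2 * M)) :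
    Real.sinc (τ * freq ρ (absIdx j)) =
    Real.sin (τ * freq ρ (absIdx j)) / (τ * freq ρ (absIdx j)) :=
  Real.sinc_of_ne_zero (mul_pos H.tau_pos (freq_pos H.rho_pos _)).ne'

theorem sinc_ne_zero [NeZero M] (H : Admissible K M ρ ν γ B ε τ φ ψ) (j : ZMod (2 * M)) :
    Real.sinc (τ * freq ρ (absIdx j)) ≠ 0 := by
  rw [H.sinc_eq]
  exact div_ne_zero (abs_pos.1 (H.abs_sin_diag_pos j))
    (mul_pos H.tau_pos (freq_pos H.rho_pos _)).ne'

/-- The factor `sinc` in `ψ` supplies `sin(τω_j)/ω_j`. The sine compensates the denominator in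
`modeGain`, and `1/ω_j` gives the gain of one derivative. -/
theorem tau_sq_mul_abs_filter_le (H : Admissible K M ρ ν γ B ε τ φ ψ) (j : ZMod (2 * M)) :
    τ ^ 2 * |ψ (τ * freq ρ (absIdx j))| ≤
      τ * |Real.sin (τ * freq ρ (absIdx j))| / freq ρ (absIdx j) * B := by
  have hω := freq_pos H.rho_pos (absIdx j)
  rw [H.filter_eq, abs_mul, H.sinc_eq, abs_div, abs_of_pos (mul_pos H.tau_pos hω), ← mul_assoc]
  refine (mul_le_mul_of_nonneg_left (H.filter_le _) ?_).trans (le_of_eq ?_)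
  · have := H.tau_pos
    positivity
  · have := H.tau_pos.ne'
    have := hω.ne'
    field_simp

section OffDiag

variable {j : ZMod (2 * M)} {k : Fin (M + 1) → ℤ}

theorem abs_sin_offDiag (H : Admissible K M ρ ν γ B ε τ φ ψ) (hk : k ∈ modes K j)
    (h1 : k ≠ unitVec j) (h2 : k ≠ -unitVec j) :
    γ * (τ * ε ^ (ν / 2)) ≤ |Real.sin (τ * (freq ρ (absIdx j) + dotFreq ρ k) / 2)| ∧
      γ * (τ * ε ^ (ν / 2)) ≤ |Real.sin (τ * (freq ρ (absIdx j) - dotFreq ρ k) / 2)| := by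
  have h := H.nonRes.1 j k (mem_modes.1 hk)
  rw [← mul_assoc]
  exact ⟨h.1 h2, h.2 h1⟩

theorem symbolCoeff_zero_ne_zero (H : Admissible K M ρ ν γ B ε τ φ ψ) (hk : k ∈ modes K j)
    (h1 : k ≠ unitVec j) (h2 : k ≠ -unitVec j) : symbolCoeff ρ ν ε τ j k 0 ≠ 0 := by
  have h := H.abs_sin_offDiag hk h1 h2
  have h0 := mul_pos H.gamma_pos H.step_pos
  rw [symbolCoeff_zero]
  exact Complex.ofReal_ne_zero.2 (mul_ne_zero (mul_ne_zero four_ne_zero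
    (abs_pos.1 (h0.trans_le h.1))) (abs_pos.1 (h0.trans_le h.2)))

theorem norm_symbolCoeff_div_le [NeZero M] (H : Admissible K M ρ ν γ B ε τ φ ψ) (hk : k ∈ modes K j)
    (h1 : k ≠ unitVec j) (h2 : k ≠ -unitVec j) (l : ℕ) (hl : 1 ≤ l) :
    ‖symbolCoeff ρ ν ε τ j k l / symbolCoeff ρ ν ε τ j k 0‖ ≤ γ⁻¹ ^ l := by
  obtain ⟨ha, hb⟩ := H.abs_sin_offDiag hk h1 h2
  have hstep := H.step_le
  have hh := H.step_pos
  have hγ := H.gamma_pos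
  rw [norm_div, symbolCoeff_zero, Complex.norm_real, Real.norm_eq_abs, abs_mul, abs_mul,
    abs_of_pos (by norm_num : (0 : ℝ) < 4)]
  set h := τ * ε ^ (ν / 2) with hdef
  have hc : 0 < γ * h := mul_pos hγ hh
  -- For `l ≥ 2` the factor `h^l` absorbs both small divisors. For `l = 1` there is only one `h`,
  -- and the sine in `a_1` has to be bounded by the sum of the two divisors.
  rcases Nat.lt_or_ge 1 l with hl2 | hl1
  · obtain ⟨n, rfl⟩ : ∃ n, l = n + 2 := ⟨l - 2, by omega⟩
    have h3 := norm_symbolCoeff_le ρ ν ε τ j k hh.le (by omega : n + 2 ≠ 0)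
    have h4 : 4 * (γ * h) * (γ * h) ≤ 4 * |Real.sin (τ * (freq ρ (absIdx j) + dotFreq ρ k) / 2)| *
        |Real.sin (τ * (freq ρ (absIdx j) - dotFreq ρ k) / 2)| :=
      mul_le_mul (mul_le_mul_of_nonneg_left ha (by norm_num)) hb hc.le (by positivity)
    refine (div_le_div₀ (by positivity) h3 (by positivity) h4).trans ?_
    rw [← hdef, pow_add, pow_add]
    have h5 : h ^ n ≤ γ⁻¹ ^ n := pow_le_pow_left₀ hh.le hstep n
    calc 2 * (h ^ n * h ^ 2) / (4 * (γ * h) * (γ * h)) = h ^ n * γ⁻¹ ^ 2 / 2 := by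
          field_simp
          norm_num
      _ ≤ h ^ n * γ⁻¹ ^ 2 := half_le_self (by positivity)
      _ ≤ _ := mul_le_mul_of_nonneg_right h5 (by positivity)
  · obtain rfl : l = 1 := le_antisymm hl1 hl
    rw [symbolCoeff_one, norm_mul, Complex.norm_I, mul_one, Complex.norm_real, Real.norm_eq_abs,
      abs_mul, ← hdef, abs_of_pos (by positivity : 0 < 2 * h), pow_one]
    set p := |Real.sin (τ * (freq ρ (absIdx j) + dotFreq ρ k) / 2)| with hp
    set q := |Real.sin (τ * (freq ρ (absIdx j) - dotFreq ρ k) / 2)| with hq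
    have hs : |Real.sin (dotFreq ρ k * τ)| ≤ p + q := by
      rw [show dotFreq ρ k * τ = τ * (freq ρ (absIdx j) + dotFreq ρ k) / 2 -
        τ * (freq ρ (absIdx j) - dotFreq ρ k) / 2 by ring]
      exact abs_sin_sub_le _ _
    have hp0 := hc.trans_le ha
    have hq0 := hc.trans_le hb
    calc 2 * h * |Real.sin (dotFreq ρ k * τ)| / (4 * p * q) ≤ 2 * h * (p + q) / (4 * p * q) := by
          gcongr
      _ = h / 2 * ((p + q) / (p * q)) := by
          field_simp
          norm_num
      _ ≤ h / 2 * (2 / (γ * h)) :=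
          mul_le_mul_of_nonneg_left (add_div_mul_le hc ha hb) (by positivity)
      _ = γ⁻¹ := by field_simp

end OffDiag

section Diag

variable {j : ZMod (2 * M)} {k : Fin (M + 1) → ℤ}

theorem symbolCoeff_zero_of_diag [NeZero M] (hk : k = unitVec j ∨ k = -unitVec j) :
    symbolCoeff ρ ν ε τ j k 0 = 0 := by
  rw [symbolCoeff_zero]
  rcases hk with rfl | rfl <;> simp [dotFreq_neg, dotFreq_unitVec]

theorem abs_sin_dotFreq_of_diag [NeZero M] (hk : k = unitVec j ∨ k = -unitVec j) :
    |Real.sin (dotFreq ρ k * τ)| = |Real.sin (τ * freq ρ (absIdx j))| := by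
  rcases hk with rfl | rfl
  · rw [dotFreq_unitVec, mul_comm]
  · rw [dotFreq_neg, dotFreq_unitVec, neg_mul, Real.sin_neg, abs_neg, mul_comm]

theorem norm_symbolCoeff_one_of_diag [NeZero M] (H : Admissible K M ρ ν γ B ε τ φ ψ)
    (hk : k = unitVec j ∨ k = -unitVec j) : ‖symbolCoeff ρ ν ε τ j k 1‖ =
      2 * (τ * ε ^ (ν / 2)) * |Real.sin (τ * freq ρ (absIdx j))| := by
  rw [symbolCoeff_one, norm_mul, Complex.norm_I, mul_one, Complex.norm_real, Real.norm_eq_abs,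
    abs_mul, abs_of_pos (mul_pos two_pos H.step_pos), abs_sin_dotFreq_of_diag hk]

theorem symbolCoeff_one_ne_zero [NeZero M] (H : Admissible K M ρ ν γ B ε τ φ ψ)
    (hk : k = unitVec j ∨ k = -unitVec j) : symbolCoeff ρ ν ε τ j k 1 ≠ 0 := by
  rw [← norm_pos_iff, H.norm_symbolCoeff_one_of_diag hk]
  exact mul_pos (mul_pos two_pos H.step_pos) (H.abs_sin_diag_pos j)

theorem norm_symbolCoeff_succ_div_le [NeZero M] (H : Admissible K M ρ ν γ B ε τ φ ψ)
    (hk : k = unitVec j ∨ k = -unitVec j) (l : ℕ) (hl : 1 ≤ l) :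
    ‖symbolCoeff ρ ν ε τ j k (l + 1) / symbolCoeff ρ ν ε τ j k 1‖ ≤ γ⁻¹ ^ l := by
  have hstep := H.step_le
  have hh := H.step_pos
  have hγ := H.gamma_pos
  have h3 := norm_symbolCoeff_le ρ ν ε τ j k hh.le (by omega : l + 1 ≠ 0)
  have h4 := H.abs_sin_diag j
  rw [norm_div, H.norm_symbolCoeff_one_of_diag hk]
  set h := τ * ε ^ (ν / 2) with hdef
  obtain ⟨n, rfl⟩ : ∃ n, l = n + 1 := ⟨l - 1, by omega⟩
  refine (div_le_div₀ (by positivity) h3 (by positivity)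
    (mul_le_mul_of_nonneg_left h4 (by positivity))).trans ?_
  calc 2 * h ^ (n + 1 + 1) / (2 * h * (γ * h)) = h ^ n * γ⁻¹ := by
        field_simp
        ring
    _ ≤ γ⁻¹ ^ n * γ⁻¹ :=
        mul_le_mul_of_nonneg_right (pow_le_pow_left₀ hh.le hstep n) (by positivity)
    _ = γ⁻¹ ^ (n + 1) := (pow_succ _ _).symm

end Diag

end Admissible

/-! ### Bounds for one step of the recursion -/

section Step

variable {K M : ℕ} {ρ ν γ B ε τ : ℝ} {φ ψ : ℝ → ℝ}

/-- The majorant of the interaction sum in the equation for `z_{j,m}^k`. -/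
noncomputable def interBound (K : ℕ) {M : ℕ} [NeZero M]
    (z : ℕ → ZMod (2 * M) → (Fin (M + 1) → ℤ) → ℂ[X]) (m : ℕ) (j : ZMod (2 * M))
    (k : Fin (M + 1) → ℤ) : ℝ :=
  ∑ j₁ : ZMod (2 * M), ∑ k₁ ∈ (modes K j₁).filter (fun k₁ => k - k₁ ∈ modes K (j - j₁)),
    ∑ q ∈ Finset.HasAntidiagonal.antidiagonal m,
      coeffNorm (z q.1 j₁ k₁) * coeffNorm (z q.2 (j - j₁) (k - k₁))

theorem interBound_nonneg [NeZero M] (z : ℕ → ZMod (2 * M) → (Fin (M + 1) → ℤ) → ℂ[X]) (m : ℕ)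
    (j : ZMod (2 * M)) (k : Fin (M + 1) → ℤ) : 0 ≤ interBound K z m j k :=
  Finset.sum_nonneg fun _ _ => Finset.sum_nonneg fun _ _ => Finset.sum_nonneg fun _ _ =>
    mul_nonneg (coeffNorm_nonneg _) (coeffNorm_nonneg _)

/-- The factor that is gained when the equation for `z_{j,m}^k` is solved. -/
noncomputable def modeGain (ρ τ : ℝ) {M : ℕ} (j : ZMod (2 * M)) (k : Fin (M + 1) → ℤ) : ℝ :=
  freq ρ (absIdx j) *
    (1 + |Real.sin (dotFreq ρ k * τ)| / |Real.sin (τ * freq ρ (absIdx j))|)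

theorem freq_le_modeGain (ρ τ : ℝ) (j : ZMod (2 * M)) (k : Fin (M + 1) → ℤ) :
    freq ρ (absIdx j) ≤ modeGain ρ τ j k :=
  le_mul_of_one_le_right (Real.sqrt_nonneg _) (le_add_of_nonneg_right (by positivity))

theorem modeGain_nonneg (ρ τ : ℝ) (j : ZMod (2 * M)) (k : Fin (M + 1) → ℤ) :
    0 ≤ modeGain ρ τ j k := (Real.sqrt_nonneg _).trans (freq_le_modeGain ρ τ j k)

theorem coeffNorm_rhsPoly_le [NeZero M] (hφ : ∀ ξ, |φ ξ| ≤ B) {j : ZMod (2 * M)} {k : Fin (M + 1) → ℤ}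
    {c : ℝ} (hc : ∀ (j₁ : ZMod (2 * M)) (k₁ : Fin (M + 1) → ℤ), Real.sqrt ε ^
      (2 * ((level K j₁ k₁ : ℝ) + level K (j - j₁) (k - k₁) - level K j k) * ν) ≤ c)
    (z : ℕ → ZMod (2 * M) → (Fin (M + 1) → ℤ) → ℂ[X]) (m : ℕ) :
    coeffNorm (rhsPoly K ρ ν ε τ φ ψ z m j k) ≤
      τ ^ 2 * |ψ (τ * freq ρ (absIdx j))| * (c * (B ^ 2 * interBound K z m j k)) := by
  have hB : 0 ≤ B := (abs_nonneg _).trans (hφ 0)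
  unfold rhsPoly
  refine (coeffNorm_C_mul_le _ _).trans ?_
  rw [Complex.norm_real, Real.norm_eq_abs, abs_mul, abs_of_nonneg (sq_nonneg τ)]
  refine mul_le_mul_of_nonneg_left ?_ (by positivity)
  unfold interBound
  rw [Finset.mul_sum, Finset.mul_sum]
  refine (coeffNorm_sum_le _ _).trans (Finset.sum_le_sum fun j₁ _ => ?_)
  rw [Finset.mul_sum, Finset.mul_sum]
  refine (coeffNorm_sum_le _ _).trans (Finset.sum_le_sum fun k₁ _ => ?_)
  refine (coeffNorm_C_mul_le _ _).trans ?_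
  have h0 : 0 ≤ Real.sqrt ε ^
      (2 * ((level K j₁ k₁ : ℝ) + level K (j - j₁) (k - k₁) - level K j k) * ν) := by positivity
  rw [Complex.norm_real, Real.norm_of_nonneg h0]
  refine mul_le_mul (hc j₁ k₁) ?_ (coeffNorm_nonneg _) (h0.trans (hc j₁ k₁))
  rw [Finset.mul_sum]
  refine (coeffNorm_sum_le _ _).trans (Finset.sum_le_sum fun q _ => ?_)
  refine (coeffNorm_mul_le _ _).trans ?_
  have hfac : ∀ (ξ : ℝ) (p : ℂ[X]), coeffNorm (C (φ ξ : ℂ) * p) ≤ B * coeffNorm p := by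
    intro ξ p
    refine (coeffNorm_C_mul_le _ _).trans (mul_le_mul_of_nonneg_right ?_ (coeffNorm_nonneg _))
    rw [Complex.norm_real]
    exact hφ ξ
  calc _ ≤ (B * coeffNorm (z q.1 j₁ k₁)) * (B * coeffNorm (z q.2 (j - j₁) (k - k₁))) :=
        mul_le_mul (hfac _ _) (hfac _ _) (coeffNorm_nonneg _)
          (mul_nonneg hB (coeffNorm_nonneg _))
    _ = _ := by ring

/-- Order `0` vanishes, so both factors have order at least `1` and the degrees add up to at most
`(2m₁ - 1) + (2m₂ - 1) = 2m - 2`. The antiderivative on the diagonal brings the degree to `2m - 1`.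
-/
theorem natDegree_rhsPoly_le [NeZero M] {z : ℕ → ZMod (2 * M) → (Fin (M + 1) → ℤ) → ℂ[X]}
    (hz0 : ∀ j k, z 0 j k = 0) {m : ℕ} (hz : ∀ q < m, ∀ j k, (z q j k).natDegree ≤ 2 * q - 1)
    (j : ZMod (2 * M)) (k : Fin (M + 1) → ℤ) :
    (rhsPoly K ρ ν ε τ φ ψ z m j k).natDegree ≤ 2 * m - 2 := by
  unfold rhsPoly
  refine (natDegree_C_mul_le _ _).trans (natDegree_sum_le_of_forall_le _ _ fun j₁ _ =>
    natDegree_sum_le_of_forall_le _ _ fun k₁ _ => (natDegree_C_mul_le _ _).trans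
      (natDegree_sum_le_of_forall_le _ _ fun q hq => ?_))
  have hq' := Finset.HasAntidiagonal.mem_antidiagonal.1 hq
  rcases Nat.eq_zero_or_pos q.1 with h1 | h1
  · simp [h1, hz0]
  rcases Nat.eq_zero_or_pos q.2 with h2 | h2
  · simp [h2, hz0]
  refine natDegree_mul_le.trans ((Nat.add_le_add (natDegree_C_mul_le _ _)
    (natDegree_C_mul_le _ _)).trans ?_)
  have h3 := hz q.1 (by omega) j₁ k₁
  have h4 := hz q.2 (by omega) (j - j₁) (k - k₁)
  omega

theorem natDegree_preCoeff_le [NeZero M] {z : ℕ → ZMod (2 * M) → (Fin (M + 1) → ℤ) → ℂ[X]}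
    (hz0 : ∀ j k, z 0 j k = 0) {m : ℕ} (hm : 1 ≤ m)
    (hz : ∀ q < m, ∀ j k, (z q j k).natDegree ≤ 2 * q - 1)
    (j : ZMod (2 * M)) (k : Fin (M + 1) → ℤ) :
    (preCoeff K ρ ν ε τ φ ψ z m j k).natDegree ≤ 2 * m - 1 := by
  have h := natDegree_rhsPoly_le (K := K) (ρ := ρ) (ν := ν) (ε := ε) (τ := τ) (φ := φ) (ψ := ψ)
    hz0 hz j k
  unfold preCoeff
  split_ifs
  · simp
  · refine (natDegree_antideriv_le _).trans ?_
    rw [diagDeriv_eq]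
    have := natDegree_offDiagSol_le (fun l => symbolCoeff ρ ν ε τ j k (l + 1))
      (rhsPoly K ρ ν ε τ φ ψ z m j k)
    omega
  · refine (natDegree_offDiagSol_le _ _).trans ?_
    omega

namespace Admissible

theorem sqrt_rpow_le_one (H : Admissible K M ρ ν γ B ε τ φ ψ) {x : ℝ} (hx : 0 ≤ x) :
    Real.sqrt ε ^ x ≤ 1 :=
  Real.rpow_le_one (Real.sqrt_nonneg _) (Real.sqrt_le_one.2 H.eps_le) hx

theorem sqrt_rpow_le_loss (H : Admissible K M ρ ν γ B ε τ φ ψ) {x : ℝ} (hx : ν ≤ x) :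
    Real.sqrt ε ^ x ≤ ε ^ (ν / 2) := by
  have h : ε ^ (ν / 2) = Real.sqrt ε ^ ν := by
    rw [Real.sqrt_eq_rpow, ← Real.rpow_mul H.eps_pos.le]
    ring_nf
  rw [h]
  exact Real.rpow_le_rpow_of_exponent_ge (Real.sqrt_pos.2 H.eps_pos) (Real.sqrt_le_one.2 H.eps_le) hx

theorem sqrt_rpow_level_le_one (H : Admissible K M ρ ν γ B ε τ φ ψ) (j j₁ : ZMod (2 * M))
    (k k₁ : Fin (M + 1) → ℤ) : Real.sqrt ε ^
      (2 * ((level K j₁ k₁ : ℝ) + level K (j - j₁) (k - k₁) - level K j k) * ν) ≤ 1 := by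
  have h : (level K j k : ℝ) ≤ level K j₁ k₁ + level K (j - j₁) (k - k₁) := by
    exact_mod_cast level_le_add (by have := H.three_le; omega) j j₁ k k₁
  exact H.sqrt_rpow_le_one (mul_nonneg (by linarith) H.nu_nonneg)

/-- One extra level is worth `√ε^{2ν} = ε^ν`, which more than covers the loss `ε^{ν/2}` from a small
divisor. -/
theorem sqrt_rpow_level_le_loss [NeZero M] (H : Admissible K M ρ ν γ B ε τ φ ψ) {j : ZMod (2 * M)}
    {k : Fin (M + 1) → ℤ} (hjk : K < absIdx j ∨ k = unitVec j ∨ k = -unitVec j)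
    (j₁ : ZMod (2 * M)) (k₁ : Fin (M + 1) → ℤ) : Real.sqrt ε ^
      (2 * ((level K j₁ k₁ : ℝ) + level K (j - j₁) (k - k₁) - level K j k) * ν) ≤
        ε ^ (ν / 2) := by
  have h : (level K j k : ℝ) + 1 ≤ level K j₁ k₁ + level K (j - j₁) (k - k₁) := by
    exact_mod_cast level_lt_add (by have := H.three_le; omega) j j₁ k k₁ hjk
  refine H.sqrt_rpow_le_loss ?_
  nlinarith [H.nu_nonneg]

/-- Off the diagonal, the gain is bounded by the inverse of the smallest admissible divisor. -/
theorem modeGain_mul_le_of_sin_le [NeZero M] (H : Admissible K M ρ ν γ B ε τ φ ψ) {j : ZMod (2 * M)}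
    {k : Fin (M + 1) → ℤ} {c : ℝ} (hc : 0 < c)
    (ha : γ * (τ * c) ≤ |Real.sin (τ * (freq ρ (absIdx j) + dotFreq ρ k) / 2)|)
    (hb : γ * (τ * c) ≤ |Real.sin (τ * (freq ρ (absIdx j) - dotFreq ρ k) / 2)|) :
    modeGain ρ τ j k * (‖symbolCoeff ρ ν ε τ j k 0‖⁻¹ *
      (τ ^ 2 * |ψ (τ * freq ρ (absIdx j))| * c)) ≤ γ⁻¹ * B := by
  have hω := freq_pos H.rho_pos (absIdx j)
  have hτ := H.tau_pos
  have hγ := H.gamma_pos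
  have hB := H.bound_nonneg
  have hψ := H.tau_sq_mul_abs_filter_le j
  have hs0 := H.abs_sin_diag_pos j
  have hcc : 0 < γ * (τ * c) := by positivity
  rw [symbolCoeff_zero, Complex.norm_real, Real.norm_eq_abs, abs_mul, abs_mul,
    abs_of_pos (by norm_num : (0 : ℝ) < 4)]
  unfold modeGain
  set p := |Real.sin (τ * (freq ρ (absIdx j) + dotFreq ρ k) / 2)| with hp
  set q := |Real.sin (τ * (freq ρ (absIdx j) - dotFreq ρ k) / 2)| with hq
  have h1 : |Real.sin (dotFreq ρ k * τ)| ≤ p + q := by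
    rw [show dotFreq ρ k * τ = τ * (freq ρ (absIdx j) + dotFreq ρ k) / 2 -
      τ * (freq ρ (absIdx j) - dotFreq ρ k) / 2 by ring]
    exact abs_sin_sub_le _ _
  have h2 : |Real.sin (τ * freq ρ (absIdx j))| ≤ p + q := by
    rw [show τ * freq ρ (absIdx j) = τ * (freq ρ (absIdx j) + dotFreq ρ k) / 2 +
      τ * (freq ρ (absIdx j) - dotFreq ρ k) / 2 by ring]
    exact abs_sin_add_le _ _
  set s0 := |Real.sin (τ * freq ρ (absIdx j))| with hs0def
  set s1 := |Real.sin (dotFreq ρ k * τ)| with hs1def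
  set ω := freq ρ (absIdx j) with hωdef
  have hp0 := hcc.trans_le ha
  have hq0 := hcc.trans_le hb
  calc ω * (1 + s1 / s0) * ((4 * p * q)⁻¹ * (τ ^ 2 * |ψ (τ * ω)| * c))
      ≤ ω * (1 + s1 / s0) * ((4 * p * q)⁻¹ * (τ * s0 / ω * B * c)) := by
        gcongr
    _ = (s0 + s1) * (τ * B * c) / (4 * (p * q)) := by
        field_simp
    _ ≤ ((p + q) + (p + q)) * (τ * B * c) / (4 * (p * q)) := by
        gcongr
    -- Here `(p + q)/(pq) = 1/p + 1/q`: although the symbol is a product of two small sines, only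
    -- one factor `c⁻¹` is lost, and the weight `c` cancels it.
    _ = (p + q) / (p * q) * (τ * B * c / 2) := by
        field_simp
        ring
    _ ≤ 2 / (γ * (τ * c)) * (τ * B * c / 2) :=
        mul_le_mul_of_nonneg_right (add_div_mul_le hcc ha hb) (by positivity)
    _ = γ⁻¹ * B := by
        field_simp

theorem modeGain_mul_le_of_diag [NeZero M] (H : Admissible K M ρ ν γ B ε τ φ ψ) {j : ZMod (2 * M)}
    {k : Fin (M + 1) → ℤ} (hk : k = unitVec j ∨ k = -unitVec j) :
    modeGain ρ τ j k * (‖symbolCoeff ρ ν ε τ j k 1‖⁻¹ *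
      (τ ^ 2 * |ψ (τ * freq ρ (absIdx j))| * ε ^ (ν / 2))) ≤ γ⁻¹ * B := by
  have hω := freq_pos H.rho_pos (absIdx j)
  have hτ := H.tau_pos
  have hB := H.bound_nonneg
  have hψ := H.tau_sq_mul_abs_filter_le j
  have hs0 := H.abs_sin_diag_pos j
  have hθ := H.loss_pos
  unfold modeGain
  rw [H.norm_symbolCoeff_one_of_diag hk, abs_sin_dotFreq_of_diag hk, div_self hs0.ne']
  set s0 := |Real.sin (τ * freq ρ (absIdx j))| with hs0def
  set ω := freq ρ (absIdx j) with hωdef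
  set θ := ε ^ (ν / 2) with hθdef
  calc ω * (1 + 1) * ((2 * (τ * θ) * s0)⁻¹ * (τ ^ 2 * |ψ (τ * ω)| * θ))
      ≤ ω * (1 + 1) * ((2 * (τ * θ) * s0)⁻¹ * (τ * s0 / ω * B * θ)) := by
        gcongr
    _ = B := by
        field_simp
        norm_num
    _ ≤ γ⁻¹ * B := le_mul_of_one_le_left hB H.one_le_inv_gamma

/-- The constant in the bound for the solution of the equation for `z_{j,m}^k`. -/
noncomputable def solveConst (K : ℕ) (γ B : ℝ) : ℝ := γ⁻¹ * B ^ 3 * neumannBound γ⁻¹ (4 * K)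

theorem modeGain_mul_coeffNorm_preCoeff_le [NeZero M] (H : Admissible K M ρ ν γ B ε τ φ ψ)
    {z : ℕ → ZMod (2 * M) → (Fin (M + 1) → ℤ) → ℂ[X]} (hz0 : ∀ j k, z 0 j k = 0) {m : ℕ}
    (hm : m < 2 * K) (hz : ∀ q < m, ∀ j k, (z q j k).natDegree ≤ 2 * q - 1) {j : ZMod (2 * M)}
    {k : Fin (M + 1) → ℤ} (hk : k ∈ modes K j) :
    modeGain ρ τ j k * coeffNorm (preCoeff K ρ ν ε τ φ ψ z m j k) ≤
      solveConst K γ B * interBound K z m j k := by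
  have hγ : 0 ≤ γ⁻¹ := inv_nonneg.2 H.gamma_pos.le
  have hI := interBound_nonneg (K := K) z m j k
  have hG := neumannBound_nonneg hγ (4 * K)
  have hB := H.bound_nonneg
  have hgain := modeGain_nonneg ρ τ j k
  have hdeg : (rhsPoly K ρ ν ε τ φ ψ z m j k).natDegree ≤ 4 * K :=
    (natDegree_rhsPoly_le hz0 hz j k).trans (by omega)
  -- Common to all cases: `a` is the inverse of the leading symbol coefficient and `c` a bound for
  -- the weights in the recursion, which has to balance it.
  have key : ∀ {a c : ℝ}, 0 ≤ a → (∀ (j₁ : ZMod (2 * M)) (k₁ : Fin (M + 1) → ℤ), Real.sqrt ε ^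
      (2 * ((level K j₁ k₁ : ℝ) + level K (j - j₁) (k - k₁) - level K j k) * ν) ≤ c) →
      modeGain ρ τ j k * (a * (τ ^ 2 * |ψ (τ * freq ρ (absIdx j))| * c)) ≤ γ⁻¹ * B →
      ∀ {p : ℂ[X]}, coeffNorm p ≤ neumannBound γ⁻¹ (4 * K) *
        (a * coeffNorm (rhsPoly K ρ ν ε τ φ ψ z m j k)) →
      modeGain ρ τ j k * coeffNorm p ≤ solveConst K γ B * interBound K z m j k := by
    intro a c ha hc h1 p hp
    have h2 := coeffNorm_rhsPoly_le (ρ := ρ) (τ := τ) (ψ := ψ) H.filter_le hc z m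
    calc modeGain ρ τ j k * coeffNorm p
        ≤ modeGain ρ τ j k * (neumannBound γ⁻¹ (4 * K) * (a * (τ ^ 2 *
            |ψ (τ * freq ρ (absIdx j))| * (c * (B ^ 2 * interBound K z m j k))))) :=
          mul_le_mul_of_nonneg_left (hp.trans (mul_le_mul_of_nonneg_left
            (mul_le_mul_of_nonneg_left h2 ha) hG)) hgain
      _ = modeGain ρ τ j k * (a * (τ ^ 2 * |ψ (τ * freq ρ (absIdx j))| * c)) *
            (neumannBound γ⁻¹ (4 * K) * (B ^ 2 * interBound K z m j k)) := by ring
      _ ≤ γ⁻¹ * B * (neumannBound γ⁻¹ (4 * K) * (B ^ 2 * interBound K z m j k)) :=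
          mul_le_mul_of_nonneg_right h1 (by positivity)
      _ = _ := by
          unfold solveConst
          ring
  unfold preCoeff
  split_ifs with h1 h2
  · rw [coeffNorm_zero, mul_zero]
    exact mul_nonneg (by unfold solveConst; positivity) hI
  · refine key (inv_nonneg.2 (norm_nonneg (symbolCoeff ρ ν ε τ j k 1)))
      (H.sqrt_rpow_level_le_loss (Or.inr h2)) (H.modeGain_mul_le_of_diag h2) ?_
    refine (coeffNorm_antideriv_le _).trans ?_
    rw [diagDeriv_eq]
    have h3 := coeffNorm_offDiagSol_le (a := fun l => symbolCoeff ρ ν ε τ j k (l + 1)) hγ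
      (fun l hl => ?_) hdeg
    · simpa only [zero_add] using h3
    · simpa only [zero_add] using H.norm_symbolCoeff_succ_div_le h2 l hl
  · rw [not_or] at h2
    have h3 := coeffNorm_offDiagSol_le hγ (H.norm_symbolCoeff_div_le hk h2.1 h2.2) hdeg
    -- For `|j| > K` the weak divisors are paid for by the level gap. For `|j| ≤ K` there may be no
    -- gap, but the strong condition holds and `c = 1` suffices.
    rcases Nat.lt_or_ge K (absIdx j) with hj | hj
    · obtain ⟨ha, hb⟩ := H.abs_sin_offDiag hk h2.1 h2.2
      exact key (inv_nonneg.2 (norm_nonneg _)) (H.sqrt_rpow_level_le_loss (Or.inl hj))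
        (H.modeGain_mul_le_of_sin_le H.loss_pos ha hb) h3
    · obtain ⟨ha, hb⟩ := H.nonRes.2 j k (mem_modes.1 hk) hj h2.1 h2.2
      rw [← mul_one τ] at ha hb
      refine key (inv_nonneg.2 (norm_nonneg _)) (fun j₁ k₁ => H.sqrt_rpow_level_le_one j j₁ k k₁)
        (H.modeGain_mul_le_of_sin_le one_pos ?_ ?_) h3
      · simpa only [mul_one] using ha
      · simpa only [mul_one] using hb

end Admissible

end Step

/-! ### Bounds for the coefficients of the modulation functions -/

/-- Young's inequality `ℓ¹ * ℓ¹ ⊆ ℓ¹`, restricted to finite index sets that need not be closed under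
addition. -/
theorem sum_conv_le {A : Type*} [AddCommGroup A] [DecidableEq A] (r s t : Finset A) {f g : A → ℝ}
    (hf : ∀ a, 0 ≤ f a) (hg : ∀ a, 0 ≤ g a) :
    ∑ k ∈ r, ∑ k₁ ∈ s.filter (fun k₁ => k - k₁ ∈ t), f k₁ * g (k - k₁) ≤
      (∑ k ∈ s, f k) * ∑ k ∈ t, g k := by
  simp_rw [Finset.sum_filter]
  rw [Finset.sum_comm, Finset.sum_mul]
  refine Finset.sum_le_sum fun k₁ _ => ?_
  rw [← Finset.sum_filter, ← Finset.mul_sum]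
  refine mul_le_mul_of_nonneg_left ?_ (hf k₁)
  rw [← Finset.sum_image (f := g) (g := fun k => k - k₁) (fun a _ b _ h => sub_left_injective h)]
  refine Finset.sum_le_sum_of_subset_of_nonneg (fun a ha => ?_) fun a _ _ => hg a
  obtain ⟨k, hk, rfl⟩ := Finset.mem_image.1 ha
  exact (Finset.mem_filter.1 hk).2

/-- Since order `0` vanishes, both orders lie strictly below `m`, so the right-hand side involves
only coefficients already estimated. -/
theorem sum_antidiagonal_mul_le {f g : ℕ → ℝ} (hf : ∀ n, 0 ≤ f n) (hg : ∀ n, 0 ≤ g n)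
    (hf0 : f 0 = 0) (hg0 : g 0 = 0) (m : ℕ) :
    ∑ q ∈ Finset.HasAntidiagonal.antidiagonal m, f q.1 * g q.2 ≤
      (∑ q ∈ Finset.range m, f q) * ∑ q ∈ Finset.range m, g q := by
  rw [Finset.sum_mul_sum, ← Finset.sum_product',
    ← Finset.sum_filter_of_ne (p := fun q : ℕ × ℕ => q ∈ Finset.range m ×ˢ Finset.range m)]
  · exact Finset.sum_le_sum_of_subset_of_nonneg (fun q hq => (Finset.mem_filter.1 hq).2)
      fun q _ _ => mul_nonneg (hf _) (hg _)
  · intro q hq hne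
    have hq' := Finset.HasAntidiagonal.mem_antidiagonal.1 hq
    have h1 : q.1 ≠ 0 := fun h => hne (by rw [h, hf0, zero_mul])
    have h2 : q.2 ≠ 0 := fun h => hne (by rw [h, hg0, mul_zero])
    rw [Finset.mem_product, Finset.mem_range, Finset.mem_range]
    omega

section Bounds

variable {K M : ℕ} {ρ ν γ B ε τ : ℝ} {φ ψ : ℝ → ℝ}

/-- The sum of the norms of the coefficients of order less than `m` in the mode `j`. -/
noncomputable def modeMass (K : ℕ) {M : ℕ} (z : ℕ → ZMod (2 * M) → (Fin (M + 1) → ℤ) → ℂ[X])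
    (m : ℕ) (j : ZMod (2 * M)) : ℝ :=
  ∑ q ∈ Finset.range m, ∑ k ∈ modes K j, coeffNorm (z q j k)

theorem modeMass_nonneg (z : ℕ → ZMod (2 * M) → (Fin (M + 1) → ℤ) → ℂ[X]) (m : ℕ)
    (j : ZMod (2 * M)) : 0 ≤ modeMass K z m j :=
  Finset.sum_nonneg fun _ _ => Finset.sum_nonneg fun _ _ => coeffNorm_nonneg _

theorem sum_interBound_le [NeZero M] {z : ℕ → ZMod (2 * M) → (Fin (M + 1) → ℤ) → ℂ[X]}
    (hz0 : ∀ j k, z 0 j k = 0) (m : ℕ) (j : ZMod (2 * M)) :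
    ∑ k ∈ modes K j, interBound K z m j k ≤
      ∑ j₁, modeMass K z m j₁ * modeMass K z m (j - j₁) := by
  unfold interBound modeMass
  rw [Finset.sum_comm]
  refine Finset.sum_le_sum fun j₁ _ => ?_
  have h1 := sum_antidiagonal_mul_le
    (f := fun q => ∑ k ∈ modes K j₁, coeffNorm (z q j₁ k))
    (g := fun q => ∑ k ∈ modes K (j - j₁), coeffNorm (z q (j - j₁) k))
    (fun _ => Finset.sum_nonneg fun _ _ => coeffNorm_nonneg _)
    (fun _ => Finset.sum_nonneg fun _ _ => coeffNorm_nonneg _)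
    (by simp only [hz0, coeffNorm_zero, Finset.sum_const_zero])
    (by simp only [hz0, coeffNorm_zero, Finset.sum_const_zero]) m
  refine le_trans ?_ h1
  rw [Finset.sum_congr rfl fun k _ => Finset.sum_comm, Finset.sum_comm]
  exact Finset.sum_le_sum fun q _ => sum_conv_le (modes K j) (modes K j₁) (modes K (j - j₁))
    (f := fun k => coeffNorm (z q.1 j₁ k)) (g := fun k => coeffNorm (z q.2 (j - j₁) k))
    (fun _ => coeffNorm_nonneg _) fun _ => coeffNorm_nonneg _

/-- The contribution of the initial data to the coefficients of order `m`. -/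
noncomputable def dataBound (K : ℕ) (ρ ε : ℝ) {M : ℕ} (u v : ZMod (2 * M) → ℂ) (m : ℕ)
    (j : ZMod (2 * M)) : ℝ :=
  if m = profile K (absIdx j) then
    Real.sqrt ε ^ (-(profile K (absIdx j) : ℝ)) * (freq ρ (absIdx j) * ‖u j‖ + ‖v j‖)
  else 0

namespace Admissible

/-- The difference quotient supplies a factor `h = τε^{ν/2}`, which is at most `γ⁻¹ |sin(τω_j)|`;
this offsets the possibly small denominator `sinc(τω_j)`. -/
theorem norm_velocityTail_le [NeZero M] (H : Admissible K M ρ ν γ B ε τ φ ψ) (j : ZMod (2 * M))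
    (k : Fin (M + 1) → ℤ) {D : ℕ} {q : ℂ[X]} (hq : q.natDegree ≤ D) :
    ‖velocityTail ρ ν ε τ j k q‖ ≤ γ⁻¹ ^ (D + 1) * (freq ρ (absIdx j) * coeffNorm q) := by
  have hω := freq_pos H.rho_pos (absIdx j)
  have hτ := H.tau_pos
  have hγ := H.gamma_pos
  have hh := H.step_pos
  have hs := H.abs_sin_diag j
  have hs0 := H.abs_sin_diag_pos j
  have hq0 := coeffNorm_nonneg q
  have hnorm : ‖((τ * ε ^ (ν / 2) : ℝ) : ℂ)‖ = τ * ε ^ (ν / 2) := by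
    rw [Complex.norm_real, Real.norm_of_nonneg hh.le]
  have h1 := norm_eval_sub_eval_zero_le hq H.one_le_inv_gamma
    (x := ((τ * ε ^ (ν / 2) : ℝ) : ℂ)) (hnorm.le.trans H.step_le)
  have h2 := norm_eval_sub_eval_zero_le hq H.one_le_inv_gamma
    (x := -((τ * ε ^ (ν / 2) : ℝ) : ℂ)) (by rw [norm_neg]; exact hnorm.le.trans H.step_le)
  rw [norm_neg] at h2
  rw [hnorm] at h1 h2
  unfold velocityTail
  have hneg : -(Complex.I * ((dotFreq ρ k * τ : ℝ) : ℂ)) =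
      Complex.I * ((-(dotFreq ρ k * τ) : ℝ) : ℂ) := by
    push_cast
    ring
  rw [norm_div, hneg, Complex.norm_real, Real.norm_eq_abs, H.sinc_eq, abs_mul, abs_div,
    abs_of_pos (mul_pos two_pos hτ), abs_of_pos (mul_pos hτ hω)]
  set h := τ * ε ^ (ν / 2) with hdef
  set s0 := |Real.sin (τ * freq ρ (absIdx j))| with hs0def
  set ω := freq ρ (absIdx j) with hωdef
  have hden : 2 * τ * (s0 / (τ * ω)) = 2 * s0 / ω := by
    field_simp
  rw [hden, div_le_iff₀ (by positivity)]
  refine (norm_sub_le _ _).trans ?_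
  rw [norm_mul, norm_mul, Complex.norm_exp_I_mul_ofReal, Complex.norm_exp_I_mul_ofReal, one_mul,
    one_mul]
  refine (add_le_add h1 h2).trans ?_
  calc h * γ⁻¹ ^ D * coeffNorm q + h * γ⁻¹ ^ D * coeffNorm q
      = γ * h * (2 * γ⁻¹ ^ (D + 1) * coeffNorm q) := by
        rw [pow_succ]
        field_simp
        ring
    _ ≤ s0 * (2 * γ⁻¹ ^ (D + 1) * coeffNorm q) :=
        mul_le_mul_of_nonneg_right hs (by positivity)
    _ = _ := by
        field_simp

/-- The velocity condition multiplies `z_j^k(0)` by `ω_j sin(τ k·ω)/sin(τω_j)`. This explains the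
form of `modeGain`: the solution bound must be strong enough to survive this factor. -/
theorem abs_freq_add_le_modeGain [NeZero M] (H : Admissible K M ρ ν γ B ε τ φ ψ)
    (j : ZMod (2 * M)) (k : Fin (M + 1) → ℤ) {sg : ℝ} (hsg : |sg| = 1) :
    |freq ρ (absIdx j) + sg * dotFreq ρ k *
      (Real.sinc (τ * dotFreq ρ k) / Real.sinc (τ * freq ρ (absIdx j)))| ≤ modeGain ρ τ j k := by
  have hω := freq_pos H.rho_pos (absIdx j)
  have hτ := H.tau_pos
  have hs0 := H.abs_sin_diag_pos j
  have h1 : sg * dotFreq ρ k *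
      (Real.sinc (τ * dotFreq ρ k) / Real.sinc (τ * freq ρ (absIdx j))) =
      sg * (freq ρ (absIdx j) *
        (Real.sin (dotFreq ρ k * τ) / Real.sin (τ * freq ρ (absIdx j)))) := by
    have h2 := mul_sinc τ (dotFreq ρ k) hτ.ne'
    have h3 : Real.sin (τ * freq ρ (absIdx j)) ≠ 0 := abs_pos.1 hs0
    rw [H.sinc_eq, mul_div_assoc', mul_assoc sg, h2, mul_comm (dotFreq ρ k)]
    field_simp
  rw [h1]
  refine (abs_add_le _ _).trans (le_of_eq ?_)
  unfold modeGain
  rw [abs_mul, hsg, one_mul, abs_mul, abs_div, abs_of_pos hω]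
  ring

theorem freq_mul_norm_diagInit_le [NeZero M] (H : Admissible K M ρ ν γ B ε τ φ ψ)
    (u v : ZMod (2 * M) → ℂ) {sg : ℝ} (hsg : |sg| = 1)
    {z : ℕ → ZMod (2 * M) → (Fin (M + 1) → ℤ) → ℂ[X]} (hz0 : ∀ j k, z 0 j k = 0) {m : ℕ}
    (hm1 : 1 ≤ m) (hm : m < 2 * K) (hz : ∀ q < m, ∀ j k, (z q j k).natDegree ≤ 2 * q - 1)
    (j : ZMod (2 * M)) :
    freq ρ (absIdx j) * ‖diagInit K ρ ν ε τ φ ψ u v sg z m j‖ ≤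
      (1 + γ⁻¹ ^ (4 * K + 1)) * ∑ k ∈ modes K j,
        modeGain ρ τ j k * coeffNorm (preCoeff K ρ ν ε τ φ ψ z m j k) +
      dataBound K ρ ε u v m j := by
  have hω := freq_pos H.rho_pos (absIdx j)
  set X := ∑ k ∈ modes K j, modeGain ρ τ j k * coeffNorm (preCoeff K ρ ν ε τ φ ψ z m j k) with hX
  have hterm : ∀ k, 0 ≤ modeGain ρ τ j k * coeffNorm (preCoeff K ρ ν ε τ φ ψ z m j k) :=
    fun k => mul_nonneg (modeGain_nonneg _ _ _ _) (coeffNorm_nonneg _)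
  have hX0 : 0 ≤ X := Finset.sum_nonneg fun k _ => hterm k
  have hγ := H.gamma_pos
  have hpow : ∀ k : Fin (M + 1) → ℤ,
      Real.sqrt ε ^ (2 * ((level K j k : ℝ) - profile K (absIdx j)) * ν) ≤ 1 := by
    intro k
    have h : (profile K (absIdx j) : ℝ) ≤ level K j k := by exact_mod_cast profile_le_level j k
    exact H.sqrt_rpow_le_one (mul_nonneg (by linarith) H.nu_nonneg)
  have hpow0 : ∀ k : Fin (M + 1) → ℤ,
      0 ≤ Real.sqrt ε ^ (2 * ((level K j k : ℝ) - profile K (absIdx j)) * ν) := fun k => by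
    positivity
  have hsgC : ‖(sg : ℂ)‖ = 1 := by rw [Complex.norm_real, Real.norm_eq_abs, hsg]
  unfold diagInit
  set S₁ := ∑ k ∈ (modes K j).filter (fun k => k ≠ unitVec j ∧ k ≠ -unitVec j),
      ((Real.sqrt ε ^ (2 * ((level K j k : ℝ) - profile K (absIdx j)) * ν) *
        (freq ρ (absIdx j) + sg * dotFreq ρ k *
          (Real.sinc (τ * dotFreq ρ k) / Real.sinc (τ * freq ρ (absIdx j)))) : ℝ) : ℂ) *
      (preCoeff K ρ ν ε τ φ ψ z m j k).eval 0 with hS₁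
  set S₂ := ∑ k ∈ modes K j,
      ((Real.sqrt ε ^ (2 * ((level K j k : ℝ) - profile K (absIdx j)) * ν) : ℝ) : ℂ) *
      velocityTail ρ ν ε τ j k (preCoeff K ρ ν ε τ φ ψ z m j k) with hS₂
  have h1 : ‖S₁‖ ≤ X := by
    refine (norm_sum_le _ _).trans ((Finset.sum_le_sum fun k _ => ?_).trans
      (Finset.sum_le_sum_of_subset_of_nonneg (Finset.filter_subset _ _) fun k _ _ => hterm k))
    rw [norm_mul, Complex.norm_real, Real.norm_eq_abs, abs_mul, abs_of_nonneg (hpow0 k)]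
    refine mul_le_mul ?_ (norm_eval_le_coeffNorm _ (by simp)) (norm_nonneg _)
      (modeGain_nonneg _ _ _ _)
    exact (mul_le_of_le_one_left (abs_nonneg _) (hpow k)).trans
      (H.abs_freq_add_le_modeGain j k hsg)
  have h2 : ‖S₂‖ ≤ γ⁻¹ ^ (4 * K + 1) * X := by
    rw [hX, Finset.mul_sum]
    refine (norm_sum_le _ _).trans (Finset.sum_le_sum fun k _ => ?_)
    rw [norm_mul, Complex.norm_real, Real.norm_of_nonneg (hpow0 k)]
    refine (mul_le_of_le_one_left (norm_nonneg _) (hpow k)).trans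
      ((H.norm_velocityTail_le j k ((natDegree_preCoeff_le hz0 hm1 hz j k).trans
        (by omega : 2 * m - 1 ≤ 4 * K))).trans ?_)
    exact mul_le_mul_of_nonneg_left
      (mul_le_mul_of_nonneg_right (freq_le_modeGain _ _ _ _) (coeffNorm_nonneg _)) (by positivity)
  have h3 : ‖(if m = profile K (absIdx j) then
        ((Real.sqrt ε ^ (-(profile K (absIdx j) : ℝ)) : ℝ) : ℂ) *
          (Complex.I * freq ρ (absIdx j) * u j + (sg : ℂ) * v j)
      else 0)‖ ≤ dataBound K ρ ε u v m j := by
    unfold dataBound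
    split_ifs
    · rw [norm_mul, Complex.norm_real, Real.norm_of_nonneg (by positivity)]
      refine mul_le_mul_of_nonneg_left ((norm_add_le _ _).trans (le_of_eq ?_)) (by positivity)
      rw [norm_mul, norm_mul, norm_mul, Complex.norm_I, hsgC, Complex.norm_real,
        Real.norm_of_nonneg hω.le, one_mul, one_mul]
    · simp
  have hd0 : 0 ≤ dataBound K ρ ε u v m j := (norm_nonneg _).trans h3
  rw [norm_div, norm_mul, norm_mul, Complex.norm_I, Complex.norm_real, Real.norm_of_nonneg hω.le,
    Complex.norm_two, mul_one]
  -- Determining the initial values divides by `ω_j`; the weight `ω_j` on the left cancels this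
  -- exactly.
  have h4 : ∀ N : ℝ, freq ρ (absIdx j) * (N / (2 * freq ρ (absIdx j))) = N / 2 := fun N => by
    field_simp
  rw [h4]
  refine (half_le_self (norm_nonneg _)).trans ((norm_add_le _ _).trans (add_le_add ?_ h3))
  refine (norm_sub_le _ _).trans ?_
  rw [norm_mul, norm_mul, norm_neg, Complex.norm_I, hsgC, one_mul, one_mul, add_mul, one_mul]
  exact add_le_add h1 h2

/-- The constant in the bound for the new coefficients. -/
noncomputable def nextConst (K : ℕ) (γ B : ℝ) : ℝ :=
  (3 + 2 * γ⁻¹ ^ (4 * K + 1)) * solveConst K γ B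

theorem freq_mul_sum_coeffNorm_nextCoeff_le [NeZero M] (H : Admissible K M ρ ν γ B ε τ φ ψ)
    (u v : ZMod (2 * M) → ℂ)
    {z : ℕ → ZMod (2 * M) → (Fin (M + 1) → ℤ) → ℂ[X]} (hz0 : ∀ j k, z 0 j k = 0) {m : ℕ}
    (hm1 : 1 ≤ m) (hm : m < 2 * K) (hz : ∀ q < m, ∀ j k, (z q j k).natDegree ≤ 2 * q - 1)
    (j : ZMod (2 * M)) :
    freq ρ (absIdx j) * ∑ k ∈ modes K j, coeffNorm (nextCoeff K ρ ν ε τ φ ψ u v z m j k) ≤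
      nextConst K γ B * (∑ j₁, modeMass K z m j₁ * modeMass K z m (j - j₁)) +
        2 * dataBound K ρ ε u v m j := by
  have hω := freq_pos H.rho_pos (absIdx j)
  have hγ := H.gamma_pos
  set X := ∑ k ∈ modes K j, modeGain ρ τ j k * coeffNorm (preCoeff K ρ ν ε τ φ ψ z m j k) with hX
  set d₁ := diagInit K ρ ν ε τ φ ψ u v 1 z m j with hd₁
  set d₂ := diagInit K ρ ν ε τ φ ψ u v (-1) z m j with hd₂
  have h1 := H.freq_mul_norm_diagInit_le u v (sg := 1) (by simp) hz0 hm1 hm hz j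
  have h2 := H.freq_mul_norm_diagInit_le u v (sg := -1) (by simp) hz0 hm1 hm hz j
  rw [← hd₁, ← hX] at h1
  rw [← hd₂, ← hX] at h2
  have hnext : ∀ k ∈ modes K j, coeffNorm (nextCoeff K ρ ν ε τ φ ψ u v z m j k) ≤
      coeffNorm (preCoeff K ρ ν ε τ φ ψ z m j k) + ((if k = unitVec j then ‖d₁‖ else 0) +
        (if k = -unitVec j then ‖d₂‖ else 0)) := by
    intro k hk
    unfold nextCoeff
    have hp := coeffNorm_nonneg (preCoeff K ρ ν ε τ φ ψ z m j k)
    have hn : 0 ≤ (if k = unitVec j then ‖d₁‖ else 0) + (if k = -unitVec j then ‖d₂‖ else 0) :=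
      add_nonneg (by split_ifs <;> simp) (by split_ifs <;> simp)
    by_cases hc : k ∈ modes K j ∧ level K j k ≤ m
    · rw [if_pos hc]
      refine (coeffNorm_add_le _ _).trans (add_le_add le_rfl ?_)
      split_ifs <;> simp [coeffNorm_C, hd₁, hd₂]
    · rw [if_neg hc, coeffNorm_zero]
      exact add_nonneg hp hn
  have hsum : ∑ k ∈ modes K j, coeffNorm (nextCoeff K ρ ν ε τ φ ψ u v z m j k) ≤
      ∑ k ∈ modes K j, coeffNorm (preCoeff K ρ ν ε τ φ ψ z m j k) + (‖d₁‖ + ‖d₂‖) := by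
    refine (Finset.sum_le_sum hnext).trans ?_
    rw [Finset.sum_add_distrib, Finset.sum_add_distrib, Finset.sum_ite_eq', Finset.sum_ite_eq']
    refine add_le_add le_rfl (add_le_add ?_ ?_) <;> split_ifs <;> simp
  have hpre : freq ρ (absIdx j) * ∑ k ∈ modes K j, coeffNorm (preCoeff K ρ ν ε τ φ ψ z m j k) ≤
      X := by
    rw [Finset.mul_sum]
    exact Finset.sum_le_sum fun k _ =>
      mul_le_mul_of_nonneg_right (freq_le_modeGain _ _ _ _) (coeffNorm_nonneg _)
  have hXle : X ≤ solveConst K γ B * ∑ j₁, modeMass K z m j₁ * modeMass K z m (j - j₁) := by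
    refine (Finset.sum_le_sum fun k hk =>
      H.modeGain_mul_coeffNorm_preCoeff_le hz0 hm hz hk).trans ?_
    rw [← Finset.mul_sum]
    refine mul_le_mul_of_nonneg_left (sum_interBound_le hz0 m j) ?_
    have := neumannBound_nonneg (inv_nonneg.2 hγ.le) (4 * K)
    have := H.bound_nonneg
    unfold solveConst
    positivity
  calc _ ≤ freq ρ (absIdx j) * (∑ k ∈ modes K j, coeffNorm (preCoeff K ρ ν ε τ φ ψ z m j k) +
          (‖d₁‖ + ‖d₂‖)) := mul_le_mul_of_nonneg_left hsum hω.le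
    -- One `X` from the coefficients up to their initial values, and `1 + γ⁻¹ ^ (4K + 1)` from each
    -- of the two diagonal initial values.
    _ ≤ (3 + 2 * γ⁻¹ ^ (4 * K + 1)) * X + 2 * dataBound K ρ ε u v m j := by
        rw [mul_add, mul_add]
        linarith
    _ ≤ _ := by
        unfold nextConst
        rw [mul_assoc]
        exact add_le_add (mul_le_mul_of_nonneg_left hXle (by positivity)) le_rfl

end Admissible

end Bounds

/-! ### The table of coefficients and the size of the initial data -/

section Table

variable {K M : ℕ} {ρ ν γ B ε τ : ℝ} {φ ψ : ℝ → ℝ} {u v : ZMod (2 * M) → ℂ}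

theorem coeffTable_of_le [NeZero M] {N q : ℕ} (h : q ≤ N) :
    coeffTable K ρ ν ε τ φ ψ u v N q = coeffTable K ρ ν ε τ φ ψ u v q q := by
  induction N with
  | zero =>
    obtain rfl : q = 0 := by omega
    rfl
  | succ N ih =>
    rcases Nat.lt_or_ge N q with h1 | h1
    · obtain rfl : q = N + 1 := by omega
      rfl
    · rw [← ih h1]
      exact Function.update_of_ne (by omega) _ _

theorem coeffTable_zero [NeZero M] (N : ℕ) : coeffTable K ρ ν ε τ φ ψ u v N 0 = fun _ _ => 0 :=
  coeffTable_of_le (Nat.zero_le N)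

theorem coeffTable_succ_self [NeZero M] (N : ℕ) : coeffTable K ρ ν ε τ φ ψ u v (N + 1) (N + 1) =
    nextCoeff K ρ ν ε τ φ ψ u v (coeffTable K ρ ν ε τ φ ψ u v N) (N + 1) :=
  Function.update_self _ _ _

theorem natDegree_nextCoeff_le [NeZero M] {z : ℕ → ZMod (2 * M) → (Fin (M + 1) → ℤ) → ℂ[X]}
    (hz0 : ∀ j k, z 0 j k = 0) {m : ℕ} (hm : 1 ≤ m)
    (hz : ∀ q < m, ∀ j k, (z q j k).natDegree ≤ 2 * q - 1)
    (j : ZMod (2 * M)) (k : Fin (M + 1) → ℤ) :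
    (nextCoeff K ρ ν ε τ φ ψ u v z m j k).natDegree ≤ 2 * m - 1 := by
  unfold nextCoeff
  split_ifs
  · exact natDegree_add_le_of_degree_le (natDegree_preCoeff_le hz0 hm hz j k) (by simp)
  · exact natDegree_add_le_of_degree_le (natDegree_preCoeff_le hz0 hm hz j k) (by simp)
  · exact natDegree_add_le_of_degree_le (natDegree_preCoeff_le hz0 hm hz j k) (by simp)
  · simp

theorem natDegree_coeffTable_le [NeZero M] (m : ℕ) (j : ZMod (2 * M)) (k : Fin (M + 1) → ℤ) :
    (coeffTable K ρ ν ε τ φ ψ u v m m j k).natDegree ≤ 2 * m - 1 := by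
  induction m using Nat.strong_induction_on generalizing j k with
  | _ m ih =>
    rcases m with _ | m
    · simp [coeffTable_zero]
    · rw [coeffTable_succ_self]
      refine natDegree_nextCoeff_le (fun j k => by rw [coeffTable_zero]) (by omega)
        (fun q hq j k => ?_) j k
      rw [coeffTable_of_le (by omega)]
      exact ih q hq j k

/-- The right-hand side of order `m` sees only orders below `m`, so the partial table of the
recursion may be replaced by the final one. -/
theorem rhsPoly_congr [NeZero M] {z z' : ℕ → ZMod (2 * M) → (Fin (M + 1) → ℤ) → ℂ[X]}
    (hz : ∀ j k, z 0 j k = 0) (hz' : ∀ j k, z' 0 j k = 0) {m : ℕ} (h : ∀ q < m, z q = z' q)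
    (j : ZMod (2 * M)) (k : Fin (M + 1) → ℤ) :
    rhsPoly K ρ ν ε τ φ ψ z m j k = rhsPoly K ρ ν ε τ φ ψ z' m j k := by
  unfold rhsPoly
  refine congrArg (_ * ·) (Finset.sum_congr rfl fun j₁ _ => Finset.sum_congr rfl fun k₁ _ =>
    congrArg (_ * ·) (Finset.sum_congr rfl fun q hq => ?_))
  have hq' := Finset.HasAntidiagonal.mem_antidiagonal.1 hq
  rcases Nat.eq_zero_or_pos q.1 with h1 | h1
  · simp [h1, hz, hz']
  rcases Nat.eq_zero_or_pos q.2 with h2 | h2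
  · simp [h2, hz, hz']
  rw [h q.1 (by omega), h q.2 (by omega)]

theorem norm_eq_norm_absIdx {u : ZMod (2 * M) → ℂ} (hu : IsRealValued u) (j : ZMod (2 * M)) :
    ‖u j‖ = ‖u ((absIdx j : ℕ) : ZMod (2 * M))‖ := by
  rcases eq_or_eq_neg_of_absIdx_eq (rfl : absIdx j = absIdx j) with h | h
  · rw [← h]
  · conv_lhs => rw [h]
    rw [hu, RCLike.norm_conj]

theorem sqrt_rpow_sq (hε : 0 < ε) (x : ℝ) : (Real.sqrt ε ^ x) ^ 2 = ε ^ x := by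
  rw [Real.sqrt_eq_rpow, ← Real.rpow_mul hε.le, ← Real.rpow_natCast, ← Real.rpow_mul hε.le]
  congr 1
  push_cast
  ring

theorem absIdx_natCast {l : ℕ} (hl : l ≤ M) : absIdx (l : ZMod (2 * M)) = l := by
  unfold absIdx
  rw [ZMod.valMinAbs_natCast_of_le_half (by omega)]
  rfl

/-- The constant `8` is `4 · 2`: `(ω|u| + |v|)²` is at most four times the mode energy, and each
absolute value belongs to at most two indices `j`. Reality of the data makes `±j` have equal energy,
so the energies `E_l` control all modes. -/
theorem sum_weight_mul_dataBound_sq_le [NeZero M] {s C₀ : ℝ} (hs : 1 / 2 < s) (hε : 0 < ε)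
    (hu : IsRealValued u) (hv : IsRealValued v)
    (hE : ∑ l : Fin (M + 1), weight s l * ε ^ (-(profile K l : ℝ)) *
      modeEnergy ρ u v ((l : ℕ) : ZMod (2 * M)) ≤ C₀) (m : ℕ) :
    ∑ j : ZMod (2 * M), weight s (absIdx j) * dataBound K ρ ε u v m j ^ 2 ≤ 8 * C₀ := by
  set F : ℕ → ℝ := fun l => weight s l * ε ^ (-(profile K l : ℝ)) *
    (4 * modeEnergy ρ u v ((l : ℕ) : ZMod (2 * M))) with hF
  have hE0 : ∀ j : ZMod (2 * M), 0 ≤ modeEnergy ρ u v j := fun j => by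
    unfold modeEnergy
    positivity
  have hF0 : ∀ l, 0 ≤ F l := fun l =>
    mul_nonneg (mul_nonneg (weight_pos hs l).le (by positivity))
      (mul_nonneg (by norm_num) (hE0 _))
  have h1 : ∀ j : ZMod (2 * M), weight s (absIdx j) * dataBound K ρ ε u v m j ^ 2 ≤
      F (absIdx j) := by
    intro j
    simp only [hF]
    rw [mul_assoc]
    refine mul_le_mul_of_nonneg_left ?_ (weight_pos hs _).le
    unfold dataBound
    split_ifs
    · rw [mul_pow, sqrt_rpow_sq hε]
      refine mul_le_mul_of_nonneg_left ?_ (by positivity)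
      unfold modeEnergy
      rw [absIdx_natCast (absIdx_le j), norm_eq_norm_absIdx hu j, norm_eq_norm_absIdx hv j,
        norm_mul, Complex.norm_real, Real.norm_of_nonneg (r := freq ρ (absIdx j)) (Real.sqrt_nonneg _)]
      nlinarith [sq_nonneg (freq ρ (absIdx j) * ‖u ((absIdx j : ℕ) : ZMod (2 * M))‖ -
        ‖v ((absIdx j : ℕ) : ZMod (2 * M))‖)]
    · rw [zero_pow two_ne_zero]
      exact mul_nonneg (by positivity) (mul_nonneg (by norm_num) (hE0 _))
  refine (Finset.sum_le_sum fun j _ => h1 j).trans ((sum_comp_absIdx_le hF0).trans ?_)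
  rw [Finset.sum_range]
  have h2 : ∑ l : Fin (M + 1), F l = 4 * ∑ l : Fin (M + 1), weight s l *
      ε ^ (-(profile K l : ℝ)) * modeEnergy ρ u v ((l : ℕ) : ZMod (2 * M)) := by
    rw [Finset.mul_sum]
    exact Finset.sum_congr rfl fun l _ => by
      rw [hF]
      ring
  rw [h2]
  linarith

end Table

/-! ### The uniform bound for all coefficients -/

theorem Admissible.nextConst_nonneg {K M : ℕ} {ρ ν γ B ε τ : ℝ} {φ ψ : ℝ → ℝ}
    (H : Admissible K M ρ ν γ B ε τ φ ψ) : 0 ≤ Admissible.nextConst K γ B := by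
  have hγ := inv_nonneg.2 H.gamma_pos.le
  have := neumannBound_nonneg hγ (4 * K)
  have := H.bound_nonneg
  unfold Admissible.nextConst Admissible.solveConst
  positivity

theorem sum_weight_mul_sq_le {M : ℕ} [NeZero M] {s ρ : ℝ} (hs : 1 / 2 < s) (hρ : 0 < ρ)
    (f : ZMod (2 * M) → ℝ) : ∑ j, weight s (absIdx j) * f j ^ 2 ≤
      ρ⁻¹ * ∑ j, weight s (absIdx j) * (freq ρ (absIdx j) * f j) ^ 2 := by
  rw [Finset.mul_sum]
  refine Finset.sum_le_sum fun j _ => ?_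
  have h1 : ρ ≤ freq ρ (absIdx j) ^ 2 := by
    unfold freq
    rw [Real.sq_sqrt (by positivity)]
    exact le_add_of_nonneg_left (sq_nonneg _)
  have h2 : 1 ≤ ρ⁻¹ * freq ρ (absIdx j) ^ 2 := by
    rw [← inv_mul_cancel₀ hρ.ne']
    exact mul_le_mul_of_nonneg_left h1 (inv_nonneg.2 hρ.le)
  calc weight s (absIdx j) * f j ^ 2
      ≤ (ρ⁻¹ * freq ρ (absIdx j) ^ 2) * (weight s (absIdx j) * f j ^ 2) :=
        le_mul_of_one_le_left (mul_nonneg (weight_pos hs _).le (sq_nonneg _)) h2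
    _ = _ := by ring

/-- The coefficients of the modulation functions are bounded in the weighted `ℓ²` norm, uniformly
in `M`, `ε`, `τ`. -/
theorem exists_sum_weight_mul_modeMass_sq_le (K : ℕ) (ρ ν γ B C₀ : ℝ) {s : ℝ} (hs : 1 / 2 < s)
    (m : ℕ) (hm : m ≤ 2 * K) :
    ∃ c : ℝ, 0 ≤ c ∧ ∀ (M : ℕ) [NeZero M] (ε τ : ℝ) (φ ψ : ℝ → ℝ),
      Admissible K M ρ ν γ B ε τ φ ψ → ∀ u v : ZMod (2 * M) → ℂ,
      (∀ m, ∑ j : ZMod (2 * M), weight s (absIdx j) * dataBound K ρ ε u v m j ^ 2 ≤ C₀) →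
      ∑ j, weight s (absIdx j) * (freq ρ (absIdx j) *
        modeMass K (coeffTable K ρ ν ε τ φ ψ u v (2 * K - 1)) m j) ^ 2 ≤ c := by
  obtain ⟨A, hA0, hA⟩ := exists_sum_weight_mul_conv_sq_le hs
  induction m with
  | zero => exact ⟨0, le_rfl, fun M _ ε τ φ ψ _ u v _ => by simp [modeMass]⟩
  | succ m ih =>
    obtain ⟨c, hc0, hc⟩ := ih (by omega)
    -- From `(a + b)² ≤ 2a² + 2b²` and `b ≤ N w + 2d`, with `N` the step constant, `w` the
    -- convolution and `d` the data. The convolution is bounded by the algebra property; the factor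
    -- `ρ⁻¹` comes from dropping the frequency weight there.
    refine ⟨2 * c + 4 * (Admissible.nextConst K γ B ^ 2 * (A * (ρ⁻¹ * c) ^ 2)) + 16 * |C₀|,
      by positivity, fun M _ ε τ φ ψ H u v hdata => ?_⟩
    have hX := hc M ε τ φ ψ H u v hdata
    set Z := coeffTable K ρ ν ε τ φ ψ u v (2 * K - 1) with hZ
    have hσ : ∀ j : ZMod (2 * M), 0 < weight s (absIdx j) := fun j => weight_pos hs _
    have hmass : ∑ j, weight s (absIdx j) * modeMass K Z m j ^ 2 ≤ ρ⁻¹ * c :=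
      (sum_weight_mul_sq_le hs H.rho_pos _).trans
        (mul_le_mul_of_nonneg_left hX (inv_nonneg.2 H.rho_pos.le))
    have hconv := (hA M (modeMass K Z m)).trans (mul_le_mul_of_nonneg_left
      (pow_le_pow_left₀ (Finset.sum_nonneg fun j _ => mul_nonneg (hσ j).le (sq_nonneg _))
        hmass 2) hA0)
    have hstep : ∀ j, freq ρ (absIdx j) * ∑ k ∈ modes K j, coeffNorm (Z m j k) ≤
        Admissible.nextConst K γ B * (∑ j₁, modeMass K Z m j₁ * modeMass K Z m (j - j₁)) +
          2 * dataBound K ρ ε u v m j := by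
      intro j
      have hd : 0 ≤ dataBound K ρ ε u v m j := by
        have := (freq_pos H.rho_pos (absIdx j)).le
        unfold dataBound
        split_ifs <;> positivity
      have hcv : 0 ≤ ∑ j₁, modeMass K Z m j₁ * modeMass K Z m (j - j₁) :=
        Finset.sum_nonneg fun _ _ => mul_nonneg (modeMass_nonneg _ _ _) (modeMass_nonneg _ _ _)
      rcases m with _ | m
      · rw [hZ, coeffTable_zero]
        simp only [coeffNorm_zero, Finset.sum_const_zero, mul_zero]
        exact add_nonneg (mul_nonneg H.nextConst_nonneg hcv) (mul_nonneg zero_le_two hd)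
      · set z := coeffTable K ρ ν ε τ φ ψ u v m with hz
        have hzZ : ∀ q < m + 1, z q = Z q := fun q hq => by
          rw [hz, hZ, coeffTable_of_le (by omega), coeffTable_of_le (N := 2 * K - 1) (by omega)]
        have hZm : Z (m + 1) = nextCoeff K ρ ν ε τ φ ψ u v z (m + 1) := by
          rw [hZ, coeffTable_of_le (by omega), coeffTable_succ_self]
        have hmm : modeMass K Z (m + 1) = modeMass K z (m + 1) := by
          funext j
          unfold modeMass
          exact Finset.sum_congr rfl fun q hq => by rw [hzZ q (Finset.mem_range.1 hq)]
        rw [hZm, hmm]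
        refine H.freq_mul_sum_coeffNorm_nextCoeff_le u v (fun j k => ?_) (by omega) (by omega)
          (fun q hq j k => ?_) j
        · rw [hz, coeffTable_zero]
        · rw [hz, coeffTable_of_le (by omega)]
          exact natDegree_coeffTable_le q j k
    have hpt : ∀ j, weight s (absIdx j) * (freq ρ (absIdx j) * modeMass K Z (m + 1) j) ^ 2 ≤
        2 * (weight s (absIdx j) * (freq ρ (absIdx j) * modeMass K Z m j) ^ 2) +
        4 * (Admissible.nextConst K γ B ^ 2 * (weight s (absIdx j) *
          (∑ j₁, modeMass K Z m j₁ * modeMass K Z m (j - j₁)) ^ 2)) +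
        16 * (weight s (absIdx j) * dataBound K ρ ε u v m j ^ 2) := by
      intro j
      have h1 : modeMass K Z (m + 1) j =
          modeMass K Z m j + ∑ k ∈ modes K j, coeffNorm (Z m j k) := Finset.sum_range_succ _ _
      have h2 : 0 ≤ freq ρ (absIdx j) * ∑ k ∈ modes K j, coeffNorm (Z m j k) :=
        mul_nonneg (freq_pos H.rho_pos _).le (Finset.sum_nonneg fun _ _ => coeffNorm_nonneg _)
      have h3 := hstep j
      rw [h1, mul_add]
      set a := freq ρ (absIdx j) * modeMass K Z m j
      set b := freq ρ (absIdx j) * ∑ k ∈ modes K j, coeffNorm (Z m j k)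
      set w := ∑ j₁, modeMass K Z m j₁ * modeMass K Z m (j - j₁)
      set d := dataBound K ρ ε u v m j
      have h4 : b ^ 2 ≤ (Admissible.nextConst K γ B * w + 2 * d) ^ 2 := pow_le_pow_left₀ h2 h3 2
      have h5 : (a + b) ^ 2 ≤ 2 * a ^ 2 +
          4 * (Admissible.nextConst K γ B ^ 2 * w ^ 2) + 16 * d ^ 2 := by
        nlinarith [sq_nonneg (a - b), sq_nonneg (Admissible.nextConst K γ B * w - 2 * d)]
      refine (mul_le_mul_of_nonneg_left h5 (hσ j).le).trans (le_of_eq ?_)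
      ring
    refine (Finset.sum_le_sum fun j _ => hpt j).trans ?_
    rw [Finset.sum_add_distrib, Finset.sum_add_distrib, ← Finset.mul_sum, ← Finset.mul_sum,
      ← Finset.mul_sum, ← Finset.mul_sum]
    have h6 := mul_le_mul_of_nonneg_left hconv (sq_nonneg (Admissible.nextConst K γ B))
    have h7 := (hdata m).trans (le_abs_self C₀)
    linarith

/-! ### The invariance of the interaction potential -/

theorem sum_filter_sub_mem_eq {A R : Type*} [AddCommGroup A] [DecidableEq A] [CommRing R]
    (s : Finset A) (g : A → R) (a : A) :
    ∑ b ∈ s.filter (fun b => a - b ∈ s), g b * g (a - b) =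
      ∑ b ∈ s, ∑ c ∈ s, if b + c = a then g b * g c else 0 := by
  rw [Finset.sum_filter]
  refine Finset.sum_congr rfl fun b _ => ?_
  have h : ∀ c, (b + c = a) ↔ (c = a - b) := fun c => by rw [eq_sub_iff_add_eq, add_comm]
  simp_rw [h]
  rw [Finset.sum_ite_eq']

/-- The cubic potential `∑_{a+b+c=0} g(a) g(b) g(c)` is invariant under the flows generated by
additive weights. -/
theorem sum_additive_mul_cubic_eq_zero {A : Type*} [AddCommGroup A] [DecidableEq A]
    {s : Finset A} (hs : ∀ a ∈ s, -a ∈ s) (w : A →+ ℂ) (g : A → ℂ) :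
    ∑ a ∈ s, w a * g (-a) * ∑ b ∈ s.filter (fun b => a - b ∈ s), g b * g (a - b) = 0 := by
  -- Substituting `a ↦ -a` puts the sum over triples with `a + b + c = 0` into symmetric form. Only
  -- closure of `s` under negation is needed, not under addition.
  have h1 : ∑ a ∈ s, w a * g (-a) * ∑ b ∈ s.filter (fun b => a - b ∈ s), g b * g (a - b) =
      -∑ a ∈ s, ∑ b ∈ s, ∑ c ∈ s, if a + b + c = 0 then w a * (g a * g b * g c) else 0 := by
    rw [← Finset.sum_neg_distrib]
    refine Finset.sum_bij' (fun a _ => -a) (fun a _ => -a) hs hs (by simp) (by simp) ?_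
    intro a _
    rw [sum_filter_sub_mem_eq, Finset.mul_sum, ← Finset.sum_neg_distrib]
    refine Finset.sum_congr rfl fun b _ => ?_
    rw [Finset.mul_sum, ← Finset.sum_neg_distrib]
    refine Finset.sum_congr rfl fun c _ => ?_
    have h : (-a + b + c = 0) ↔ (b + c = a) := by
      rw [add_assoc, neg_add_eq_zero, eq_comm]
    simp only [h]
    split_ifs
    · rw [map_neg]
      ring
    · simp
  have h2 : ∑ a ∈ s, ∑ b ∈ s, ∑ c ∈ s, (if a + b + c = 0 then w a * (g a * g b * g c) else 0) =
      ∑ a ∈ s, ∑ b ∈ s, ∑ c ∈ s, if a + b + c = 0 then w b * (g a * g b * g c) else 0 := by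
    rw [Finset.sum_comm]
    refine Finset.sum_congr rfl fun a _ => Finset.sum_congr rfl fun b _ =>
      Finset.sum_congr rfl fun c _ => ?_
    rw [add_comm b a, mul_comm (g b) (g a)]
  have h3 : ∑ a ∈ s, ∑ b ∈ s, ∑ c ∈ s, (if a + b + c = 0 then w b * (g a * g b * g c) else 0) =
      ∑ a ∈ s, ∑ b ∈ s, ∑ c ∈ s, if a + b + c = 0 then w c * (g a * g b * g c) else 0 := by
    refine Finset.sum_congr rfl fun a _ => ?_
    rw [Finset.sum_comm]
    refine Finset.sum_congr rfl fun b _ => Finset.sum_congr rfl fun c _ => ?_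
    rw [add_right_comm, mul_right_comm]
  -- By symmetry the weight may sit on any of the three indices; the three versions are equal and
  -- add up to zero since `w(a) + w(b) + w(c) = w(0) = 0`.
  have h4 : ∑ a ∈ s, ∑ b ∈ s, ∑ c ∈ s, (if a + b + c = 0 then w a * (g a * g b * g c) else 0) +
      ∑ a ∈ s, ∑ b ∈ s, ∑ c ∈ s, (if a + b + c = 0 then w b * (g a * g b * g c) else 0) +
      ∑ a ∈ s, ∑ b ∈ s, ∑ c ∈ s, (if a + b + c = 0 then w c * (g a * g b * g c) else 0) = 0 := by
    simp_rw [← Finset.sum_add_distrib]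
    refine Finset.sum_eq_zero fun a _ => Finset.sum_eq_zero fun b _ =>
      Finset.sum_eq_zero fun c _ => ?_
    split_ifs with h
    · rw [← add_mul, ← add_mul, ← map_add, ← map_add, h, map_zero, zero_mul]
    · simp
  rw [← h3, ← h2] at h4
  rw [h1, neg_eq_zero]
  have h5 : ∀ x : ℂ, x + x + x = 0 → x = 0 := fun x hx => by
    have h6 : (3 : ℂ) * x = 0 := by linear_combination hx
    simpa using h6
  exact h5 _ h4

/-- The invariance applied in the group of pairs `(j, k)`, with the additive weight `(j, k) ↦ k_l`.
-/
theorem sum_modes_cubic_eq_zero (K : ℕ) {M : ℕ} [NeZero M] (l : Fin (M + 1))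
    (g : ZMod (2 * M) → (Fin (M + 1) → ℤ) → ℂ) :
    ∑ j : ZMod (2 * M), ∑ k ∈ modes K j, (k l : ℂ) * g (-j) (-k) *
      ∑ j₁ : ZMod (2 * M), ∑ k₁ ∈ (modes K j₁).filter (fun k₁ => k - k₁ ∈ modes K (j - j₁)),
        g j₁ k₁ * g (j - j₁) (k - k₁) = 0 := by
  classical
  set s : Finset (ZMod (2 * M) × (Fin (M + 1) → ℤ)) :=
    (Finset.univ.sigma fun j => modes K j).image fun p => (p.1, p.2) with hs
  have hmem : ∀ p, p ∈ s ↔ p.1 ∈ (Finset.univ : Finset (ZMod (2 * M))) ∧ p.2 ∈ modes K p.1 := by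
    intro p
    rw [hs, Finset.mem_image]
    constructor
    · rintro ⟨q, hq, rfl⟩
      exact Finset.mem_sigma.1 hq
    · intro hp
      exact ⟨⟨p.1, p.2⟩, Finset.mem_sigma.2 hp, rfl⟩
  let w : ZMod (2 * M) × (Fin (M + 1) → ℤ) →+ ℂ :=
    { toFun := fun p => (p.2 l : ℂ)
      map_zero' := by simp
      map_add' := fun p q => by simp }
  have h := sum_additive_mul_cubic_eq_zero (s := s)
    (fun p hp => (hmem _).2 ⟨Finset.mem_univ _, neg_mem_modes ((hmem p).1 hp).2⟩) w
    (fun p => g p.1 p.2)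
  rw [Finset.sum_finset_product s Finset.univ (fun j => modes K j) hmem] at h
  refine Eq.trans (Finset.sum_congr rfl fun j _ => Finset.sum_congr rfl fun k _ => ?_) h
  rw [Finset.sum_finset_product (s.filter fun b => (j, k) - b ∈ s) Finset.univ
    (fun j₁ => (modes K j₁).filter fun k₁ => k - k₁ ∈ modes K (j - j₁))]
  · rfl
  · intro p
    rw [Finset.mem_filter, hmem, hmem, Finset.mem_filter]
    simp

theorem sum_range_mul_sum_range_eq {R : Type*} [CommRing R] (n : ℕ) (f g : ℕ → R) :
    (∑ a ∈ Finset.range n, f a) * ∑ a ∈ Finset.range n, g a =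
      ∑ m ∈ Finset.range n, ∑ q ∈ Finset.HasAntidiagonal.antidiagonal m, f q.1 * g q.2 +
      ∑ q ∈ (Finset.range n ×ˢ Finset.range n).filter (fun q => n ≤ q.1 + q.2),
        f q.1 * g q.2 := by
  rw [Finset.sum_mul_sum, ← Finset.sum_product', ← Finset.sum_filter_add_sum_filter_not
    (Finset.range n ×ˢ Finset.range n) (fun q : ℕ × ℕ => q.1 + q.2 < n)]
  simp only [not_lt]
  congr 1
  rw [← Finset.sum_fiberwise_of_maps_to (t := Finset.range n) (g := fun q : ℕ × ℕ => q.1 + q.2)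
    (fun q hq => Finset.mem_range.2 (Finset.mem_filter.1 hq).2)]
  refine Finset.sum_congr rfl fun m hm => Finset.sum_congr ?_ fun _ _ => rfl
  ext q
  rw [Finset.mem_range] at hm
  simp only [Finset.mem_filter, Finset.mem_product, Finset.mem_range,
    Finset.HasAntidiagonal.mem_antidiagonal]
  omega

/-! ### The modulation equations -/

section Modulation

variable {K M : ℕ} {ρ ν γ B ε τ : ℝ} {φ ψ : ℝ → ℝ} {u v : ZMod (2 * M) → ℂ}

theorem sum_smul_iterate_derivative_C (a : ℕ → ℂ) (N : ℕ) (c : ℂ) :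
    ∑ l ∈ Finset.range (N + 1), a l • derivative^[l] (C c) = a 0 • C c := by
  rw [Finset.sum_range_succ', Function.iterate_zero_apply]
  refine add_eq_right.2 (Finset.sum_eq_zero fun l _ => ?_)
  rw [Function.iterate_succ_apply, derivative_C, iterate_derivative_zero, smul_zero]

theorem coeffTable_eq_zero [NeZero M] {N m : ℕ} {j : ZMod (2 * M)} {k : Fin (M + 1) → ℤ}
    (hm : m ≤ N) (h : ¬(k ∈ modes K j ∧ level K j k ≤ m)) :
    coeffTable K ρ ν ε τ φ ψ u v N m j k = 0 := by
  rw [coeffTable_of_le hm]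
  rcases m with _ | m
  · rw [coeffTable_zero]
  · rw [coeffTable_succ_self]
    unfold nextCoeff
    rw [if_neg h]

/-- A product of total order below the level has a factor whose order is below its own level. Hence
the modulation equations also hold, trivially, for `m < m(j, k)`. -/
theorem rhsPoly_eq_zero [NeZero M] (hK : 2 ≤ K)
    {z : ℕ → ZMod (2 * M) → (Fin (M + 1) → ℤ) → ℂ[X]} {m : ℕ} {j : ZMod (2 * M)}
    {k : Fin (M + 1) → ℤ} (hm : m < level K j k)
    (hz : ∀ q ≤ m, ∀ j k, q < level K j k → z q j k = 0) :
    rhsPoly K ρ ν ε τ φ ψ z m j k = 0 := by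
  unfold rhsPoly
  refine mul_eq_zero_of_right _ (Finset.sum_eq_zero fun j₁ _ => Finset.sum_eq_zero fun k₁ _ =>
    mul_eq_zero_of_right _ (Finset.sum_eq_zero fun q hq => ?_))
  have hq' := Finset.HasAntidiagonal.mem_antidiagonal.1 hq
  have hl := level_le_add hK j j₁ k k₁
  rcases Nat.lt_or_ge q.1 (level K j₁ k₁) with h | h
  · rw [hz _ (by omega) _ _ h, mul_zero, zero_mul]
  · rw [hz q.2 (by omega) (j - j₁) (k - k₁) (by omega), mul_zero, mul_zero]

/-- The coefficients satisfy the modulation equations. -/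
theorem Admissible.sum_symbolCoeff_coeffTable [NeZero M] (H : Admissible K M ρ ν γ B ε τ φ ψ)
    (u v : ZMod (2 * M) → ℂ) {m : ℕ} (hm : m < 2 * K) {j : ZMod (2 * M)}
    {k : Fin (M + 1) → ℤ} (hk : k ∈ modes K j) :
    ∑ l ∈ Finset.range (4 * K + 1), symbolCoeff ρ ν ε τ j k l •
        derivative^[l] (coeffTable K ρ ν ε τ φ ψ u v (2 * K - 1) m j k) =
      rhsPoly K ρ ν ε τ φ ψ (coeffTable K ρ ν ε τ φ ψ u v (2 * K - 1)) m j k := by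
  have hK : 2 ≤ K := by have := H.three_le; omega
  rcases Nat.lt_or_ge m (level K j k) with hlt | hge
  · rw [coeffTable_eq_zero (by omega) (by omega), rhsPoly_eq_zero hK hlt
      fun q hq j k h => coeffTable_eq_zero (by omega) (by omega)]
    exact Finset.sum_eq_zero fun l _ => by rw [iterate_derivative_zero, smul_zero]
  · have h1 := one_le_level (by omega : 1 ≤ K) j k
    obtain ⟨m, rfl⟩ : ∃ m', m = m' + 1 := ⟨m - 1, by omega⟩
    have hz0 : ∀ (N : ℕ) (j : ZMod (2 * M)) (k : Fin (M + 1) → ℤ),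
        coeffTable K ρ ν ε τ φ ψ u v N 0 j k = 0 := fun N j k => by rw [coeffTable_zero]
    have hrhs := rhsPoly_congr (K := K) (ρ := ρ) (ν := ν) (ε := ε) (τ := τ) (φ := φ) (ψ := ψ)
      (hz0 (2 * K - 1)) (hz0 m) (m := m + 1) (fun q hq => by
        rw [coeffTable_of_le (by omega), coeffTable_of_le (N := m) (by omega)]) j k
    have hdeg := natDegree_rhsPoly_le (K := K) (ρ := ρ) (ν := ν) (ε := ε) (τ := τ) (φ := φ)
      (ψ := ψ) (hz0 m) (m := m + 1) (fun q hq j k => by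
        rw [coeffTable_of_le (by omega)]
        exact natDegree_coeffTable_le q j k) j k
    rw [hrhs, coeffTable_of_le (by omega), coeffTable_succ_self]
    unfold nextCoeff
    rw [if_pos ⟨hk, hge⟩]
    unfold preCoeff
    rw [if_neg (not_lt.2 hge)]
    set p := rhsPoly K ρ ν ε τ φ ψ (coeffTable K ρ ν ε τ φ ψ u v m) (m + 1) j k with hp
    by_cases hd : k = unitVec j ∨ k = -unitVec j
    · rw [if_pos hd]
      -- On the diagonal `a_0 = 0`, so the constants fixed by the initial values lie in the kernel.
      have key : ∀ c : ℂ, ∑ l ∈ Finset.range (4 * K + 1), symbolCoeff ρ ν ε τ j k l •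
          derivative^[l] (antideriv (diagDeriv (symbolCoeff ρ ν ε τ j k) p) + C c) = p := by
        intro c
        simp only [iterate_map_add, smul_add, Finset.sum_add_distrib]
        rw [sum_smul_iterate_derivative_C, symbolCoeff_zero_of_diag hd, zero_smul, add_zero]
        exact sum_smul_iterate_derivative_antideriv_diagDeriv (symbolCoeff_zero_of_diag hd)
          (H.symbolCoeff_one_ne_zero hd) p (by omega)
      split_ifs
      · exact key _
      · exact key _
      · simpa only [C_0] using key 0
    · rw [if_neg hd]
      rw [not_or] at hd
      rw [if_neg hd.1, if_neg hd.2, add_zero]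
      exact sum_smul_iterate_derivative_offDiagSol (H.symbolCoeff_zero_ne_zero hk hd.1 hd.2) p
        (by omega)

/-- The coefficient `z_{j,m}^k` with the power of `√ε` that it carries in the modulation
function, evaluated at `x`. -/
noncomputable def scaledEval (K : ℕ) (ν ε : ℝ) {M : ℕ}
    (z : ℕ → ZMod (2 * M) → (Fin (M + 1) → ℤ) → ℂ[X]) (x : ℂ) (m : ℕ) (j : ZMod (2 * M))
    (k : Fin (M + 1) → ℤ) : ℂ :=
  ((Real.sqrt ε ^ ((m : ℝ) * (1 - 2 * ν) + 2 * ν * level K j k) : ℝ) : ℂ) * (z m j k).eval x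

theorem eval_modFun [NeZero M] (hK : 2 ≤ K) (hε : 0 < ε) (u v : ZMod (2 * M) → ℂ)
    (j : ZMod (2 * M)) (k : Fin (M + 1) → ℤ) (x : ℂ) :
    (modFun K ρ ν ε τ φ ψ u v j k).eval x = ∑ m ∈ Finset.range (2 * K),
      scaledEval K ν ε (coeffTable K ρ ν ε τ φ ψ u v (2 * K - 1)) x m j k := by
  unfold modFun
  rw [eval_finsetSum]
  have hsub : Finset.Icc (level K j k) (2 * K - 1) ⊆ Finset.range (2 * K) := by
    intro m hm
    have := Finset.mem_Icc.1 hm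
    exact Finset.mem_range.2 (by omega)
  rw [← Finset.sum_subset hsub]
  · refine Finset.sum_congr rfl fun m _ => ?_
    unfold scaledEval
    rw [eval_mul, eval_C, ← Real.rpow_add (Real.sqrt_pos.2 hε)]
    ring_nf
  · intro m hm hm'
    rw [Finset.mem_range] at hm
    rw [Finset.mem_Icc] at hm'
    unfold scaledEval
    rw [coeffTable_eq_zero (by omega) (by omega), eval_zero, mul_zero]

/-- The exponent `m(1 - 2ν) + 2ν m(j, k)` is chosen so that the weights in the recursion disappear:
the rescaled coefficients obey a plain convolution equation, to which the invariance of the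
potential applies. -/
theorem sqrt_rpow_mul_eval_rhsPoly [NeZero M] (hε : 0 < ε)
    (z : ℕ → ZMod (2 * M) → (Fin (M + 1) → ℤ) → ℂ[X]) (m : ℕ) (j : ZMod (2 * M))
    (k : Fin (M + 1) → ℤ) (x : ℂ) :
    ((Real.sqrt ε ^ ((m : ℝ) * (1 - 2 * ν) + 2 * ν * level K j k) : ℝ) : ℂ) *
        (rhsPoly K ρ ν ε τ φ ψ z m j k).eval x =
      ((τ ^ 2 * ψ (τ * freq ρ (absIdx j)) : ℝ) : ℂ) * ∑ j₁ : ZMod (2 * M),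
        ∑ k₁ ∈ (modes K j₁).filter (fun k₁ => k - k₁ ∈ modes K (j - j₁)),
        ∑ q ∈ Finset.HasAntidiagonal.antidiagonal m,
          ((φ (τ * freq ρ (absIdx j₁)) : ℂ) * scaledEval K ν ε z x q.1 j₁ k₁) *
          ((φ (τ * freq ρ (absIdx (j - j₁))) : ℂ) *
            scaledEval K ν ε z x q.2 (j - j₁) (k - k₁)) := by
  have hpos := Real.sqrt_pos.2 hε
  unfold rhsPoly
  rw [eval_mul, eval_C, mul_left_comm, eval_finsetSum, Finset.mul_sum]
  refine congrArg (_ * ·) (Finset.sum_congr rfl fun j₁ _ => ?_)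
  rw [eval_finsetSum, Finset.mul_sum]
  refine Finset.sum_congr rfl fun k₁ _ => ?_
  rw [eval_mul, eval_C, eval_finsetSum, Finset.mul_sum, Finset.mul_sum]
  refine Finset.sum_congr rfl fun q hq => ?_
  have hq' : (q.1 : ℝ) + q.2 = m := by
    exact_mod_cast Finset.HasAntidiagonal.mem_antidiagonal.1 hq
  have h : Real.sqrt ε ^ ((m : ℝ) * (1 - 2 * ν) + 2 * ν * level K j k) * Real.sqrt ε ^
      (2 * ((level K j₁ k₁ : ℝ) + level K (j - j₁) (k - k₁) - level K j k) * ν) =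
      Real.sqrt ε ^ ((q.1 : ℝ) * (1 - 2 * ν) + 2 * ν * level K j₁ k₁) *
      Real.sqrt ε ^ ((q.2 : ℝ) * (1 - 2 * ν) + 2 * ν * level K (j - j₁) (k - k₁)) := by
    rw [← Real.rpow_add hpos, ← Real.rpow_add hpos, ← hq']
    ring_nf
  unfold scaledEval
  rw [← mul_assoc, ← Complex.ofReal_mul, h, eval_mul, eval_mul, eval_mul, eval_C, eval_C]
  push_cast
  ring

/-- The defect of the modulation functions: the products of total order at least `2K`. -/
noncomputable def defect (K : ℕ) (ρ ν ε τ : ℝ) (φ : ℝ → ℝ) {M : ℕ} [NeZero M]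
    (z : ℕ → ZMod (2 * M) → (Fin (M + 1) → ℤ) → ℂ[X]) (x : ℂ) (j : ZMod (2 * M))
    (k : Fin (M + 1) → ℤ) : ℂ :=
  ∑ j₁ : ZMod (2 * M), ∑ k₁ ∈ (modes K j₁).filter (fun k₁ => k - k₁ ∈ modes K (j - j₁)),
    ∑ q ∈ (Finset.range (2 * K) ×ˢ Finset.range (2 * K)).filter (fun q => 2 * K ≤ q.1 + q.2),
      ((φ (τ * freq ρ (absIdx j₁)) : ℂ) * scaledEval K ν ε z x q.1 j₁ k₁) *
      ((φ (τ * freq ρ (absIdx (j - j₁))) : ℂ) * scaledEval K ν ε z x q.2 (j - j₁) (k - k₁))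

/-- Summing the equations of orders below `2K` gives the full product of the truncated sums, except
for the pairs of total order at least `2K`; these form the defect. -/
theorem Admissible.modFun_equation [NeZero M] (H : Admissible K M ρ ν γ B ε τ φ ψ)
    (u v : ZMod (2 * M) → ℂ) {j : ZMod (2 * M)} {k : Fin (M + 1) → ℤ} (hk : k ∈ modes K j)
    (x : ℂ) :
    Complex.exp (Complex.I * (dotFreq ρ k * τ : ℝ)) *
        (modFun K ρ ν ε τ φ ψ u v j k).eval (x + ((τ * ε ^ (ν / 2) : ℝ) : ℂ))
      - 2 * (Real.cos (τ * freq ρ (absIdx j)) : ℂ) * (modFun K ρ ν ε τ φ ψ u v j k).eval x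
      + Complex.exp (-(Complex.I * (dotFreq ρ k * τ : ℝ))) *
        (modFun K ρ ν ε τ φ ψ u v j k).eval (x - ((τ * ε ^ (ν / 2) : ℝ) : ℂ)) =
    ((τ ^ 2 * ψ (τ * freq ρ (absIdx j)) : ℝ) : ℂ) * (∑ j₁ : ZMod (2 * M),
        ∑ k₁ ∈ (modes K j₁).filter (fun k₁ => k - k₁ ∈ modes K (j - j₁)),
          ((φ (τ * freq ρ (absIdx j₁)) : ℂ) * (modFun K ρ ν ε τ φ ψ u v j₁ k₁).eval x) *
          ((φ (τ * freq ρ (absIdx (j - j₁))) : ℂ) *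
            (modFun K ρ ν ε τ φ ψ u v (j - j₁) (k - k₁)).eval x) -
      defect K ρ ν ε τ φ (coeffTable K ρ ν ε τ φ ψ u v (2 * K - 1)) x j k) := by
  have hK : 2 ≤ K := by have := H.three_le; omega
  have hev := fun j k x => eval_modFun (K := K) (ρ := ρ) (ν := ν) (τ := τ) (φ := φ) (ψ := ψ)
    hK H.eps_pos u v j k x
  set Z := coeffTable K ρ ν ε τ φ ψ u v (2 * K - 1) with hZ
  have hord : ∀ m ∈ Finset.range (2 * K),
      Complex.exp (Complex.I * (dotFreq ρ k * τ : ℝ)) *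
        scaledEval K ν ε Z (x + ((τ * ε ^ (ν / 2) : ℝ) : ℂ)) m j k
      - 2 * (Real.cos (τ * freq ρ (absIdx j)) : ℂ) * scaledEval K ν ε Z x m j k
      + Complex.exp (-(Complex.I * (dotFreq ρ k * τ : ℝ))) *
        scaledEval K ν ε Z (x - ((τ * ε ^ (ν / 2) : ℝ) : ℂ)) m j k =
      ((τ ^ 2 * ψ (τ * freq ρ (absIdx j)) : ℝ) : ℂ) * ∑ j₁ : ZMod (2 * M),
        ∑ k₁ ∈ (modes K j₁).filter (fun k₁ => k - k₁ ∈ modes K (j - j₁)),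
        ∑ q ∈ Finset.HasAntidiagonal.antidiagonal m,
          ((φ (τ * freq ρ (absIdx j₁)) : ℂ) * scaledEval K ν ε Z x q.1 j₁ k₁) *
          ((φ (τ * freq ρ (absIdx (j - j₁))) : ℂ) *
            scaledEval K ν ε Z x q.2 (j - j₁) (k - k₁)) := by
    intro m hm
    rw [Finset.mem_range] at hm
    rw [← sqrt_rpow_mul_eval_rhsPoly H.eps_pos, hZ, ← H.sum_symbolCoeff_coeffTable u v hm hk,
      sum_symbolCoeff_mul_eval]
    · unfold scaledEval
      ring
    · rw [coeffTable_of_le (by omega)]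
      have := natDegree_coeffTable_le (K := K) (ρ := ρ) (ν := ν) (ε := ε) (τ := τ) (φ := φ)
        (ψ := ψ) (u := u) (v := v) m j k
      omega
  have hsum := Finset.sum_congr rfl hord
  rw [Finset.sum_add_distrib, Finset.sum_sub_distrib, ← Finset.mul_sum, ← Finset.mul_sum,
    ← Finset.mul_sum, ← hev, ← hev, ← hev, ← Finset.mul_sum] at hsum
  rw [hsum]
  refine congrArg (_ * ·) ?_
  rw [eq_sub_iff_add_eq, defect, Finset.sum_comm, ← Finset.sum_add_distrib]
  refine Finset.sum_congr rfl fun j₁ _ => ?_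
  rw [Finset.sum_comm, ← Finset.sum_add_distrib]
  refine Finset.sum_congr rfl fun k₁ _ => ?_
  rw [hev, hev, Finset.mul_sum, Finset.mul_sum, sum_range_mul_sum_range_eq]

theorem eval_add_step (q : ℂ[X]) (ε ν τ t : ℝ) :
    q.eval ((ε ^ (ν / 2) * (t + τ) : ℝ) : ℂ) =
      q.eval (((ε ^ (ν / 2) * t : ℝ) : ℂ) + ((τ * ε ^ (ν / 2) : ℝ) : ℂ)) := by
  congr 1
  push_cast
  ring

/-- One step of the almost-invariant energies. -/
theorem Admissible.almostInvEnergy_step [NeZero M] (H : Admissible K M ρ ν γ B ε τ φ ψ)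
    (u v : ZMod (2 * M) → ℂ) (l : Fin (M + 1)) (t : ℝ) :
    almostInvEnergy K ρ ν ε τ φ ψ u v l (t + τ) - almostInvEnergy K ρ ν ε τ φ ψ u v l t =
      Complex.I / 2 * ((τ * freq ρ l : ℝ) : ℂ) * ∑ j : ZMod (2 * M), ∑ k ∈ modes K j,
        (k l : ℂ) * (φ (τ * freq ρ (absIdx j)) : ℂ) *
        (modFun K ρ ν ε τ φ ψ u v (-j) (-k)).eval ((ε ^ (ν / 2) * (t + τ) : ℝ) : ℂ) *
        defect K ρ ν ε τ φ (coeffTable K ρ ν ε τ φ ψ u v (2 * K - 1))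
          ((ε ^ (ν / 2) * (t + τ) : ℝ) : ℂ) j k := by
  set h : ℂ := ((τ * ε ^ (ν / 2) : ℝ) : ℂ) with hh
  set x : ℂ := ((ε ^ (ν / 2) * (t + τ) : ℝ) : ℂ) with hx
  have hx0 : ((ε ^ (ν / 2) * t : ℝ) : ℂ) = x - h := by
    rw [hx, hh]
    push_cast
    ring
  set ζ : ZMod (2 * M) → (Fin (M + 1) → ℤ) → ℂ[X] := modFun K ρ ν ε τ φ ψ u v with hζ
  set c : ZMod (2 * M) → (Fin (M + 1) → ℤ) → ℂ := fun j k =>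
    (((k l : ℝ) * freq ρ l / (τ * Real.sinc (τ * freq ρ (absIdx j))) : ℝ) : ℂ) with hc
  set g : ZMod (2 * M) → (Fin (M + 1) → ℤ) → ℂ := fun j k =>
    (φ (τ * freq ρ (absIdx j)) : ℂ) * (ζ j k).eval x with hg
  have hcneg : ∀ j k, c (-j) (-k) = -c j k := fun j k => by
    simp only [hc, absIdx_neg, Pi.neg_apply]
    push_cast
    ring
  have h1 : almostInvEnergy K ρ ν ε τ φ ψ u v l (t + τ) = -(Complex.I / 2) *
      ∑ j : ZMod (2 * M), ∑ k ∈ modes K j, c j k * (ζ (-j) (-k)).eval x *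
        (Complex.exp (Complex.I * (dotFreq ρ k * τ : ℝ)) * (ζ j k).eval (x + h)) := by
    unfold almostInvEnergy
    refine congrArg (_ * ·) (Finset.sum_congr rfl fun j _ => Finset.sum_congr rfl fun k _ => ?_)
    rw [eval_add_step _ ε ν τ (t + τ), ← hx, ← hh, mul_assoc (_ * _)]
  -- Replacing `(j, k)` by `(-j, -k)` flips the sign of `c` and of the phase, so both energies
  -- contain `z_{-j}^{-k}` at the same point `x`.
  have h2 : almostInvEnergy K ρ ν ε τ φ ψ u v l t = -(Complex.I / 2) *
      ∑ j : ZMod (2 * M), ∑ k ∈ modes K j, -(c j k * (ζ (-j) (-k)).eval x *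
        (Complex.exp (-(Complex.I * (dotFreq ρ k * τ : ℝ))) * (ζ j k).eval (x - h))) := by
    unfold almostInvEnergy
    rw [hx0, ← hx, ← hζ, ← sum_modes_neg]
    refine congrArg (_ * ·) (Finset.sum_congr rfl fun j _ => Finset.sum_congr rfl fun k _ => ?_)
    have h3 := hcneg j k
    simp only [hc] at h3 ⊢
    rw [h3, neg_neg, neg_neg, dotFreq_neg]
    push_cast
    ring_nf
  -- The summand is odd under `(j, k) ↦ (-j, -k)`.
  have hdiag : ∑ j : ZMod (2 * M), ∑ k ∈ modes K j, c j k * (ζ (-j) (-k)).eval x *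
      (2 * (Real.cos (τ * freq ρ (absIdx j)) : ℂ) * (ζ j k).eval x) = 0 := by
    have h3 := sum_modes_neg (K := K) (M := M) (fun j k => c j k * (ζ (-j) (-k)).eval x *
      (2 * (Real.cos (τ * freq ρ (absIdx j)) : ℂ) * (ζ j k).eval x))
    simp only [neg_neg, hcneg, absIdx_neg] at h3
    refine self_eq_neg.1 (h3.symm.trans ?_)
    rw [← Finset.sum_neg_distrib]
    refine Finset.sum_congr rfl fun j _ => ?_
    rw [← Finset.sum_neg_distrib]
    exact Finset.sum_congr rfl fun k _ => by ring
  have hpot := sum_modes_cubic_eq_zero K l g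
  set G : ZMod (2 * M) → (Fin (M + 1) → ℤ) → ℂ := fun j k => ∑ j₁ : ZMod (2 * M),
    ∑ k₁ ∈ (modes K j₁).filter (fun k₁ => k - k₁ ∈ modes K (j - j₁)),
      g j₁ k₁ * g (j - j₁) (k - k₁) with hG
  set D : ZMod (2 * M) → (Fin (M + 1) → ℤ) → ℂ :=
    defect K ρ ν ε τ φ (coeffTable K ρ ν ε τ φ ψ u v (2 * K - 1)) x with hD
  -- Symplecticity enters here: `sinc` cancels and leaves one `φ` for the mode `-j`, matching the
  -- two filters of the quadratic term.
  have hcψ : ∀ j k, c j k * ((τ ^ 2 * ψ (τ * freq ρ (absIdx j)) : ℝ) : ℂ) =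
      ((τ * freq ρ l : ℝ) : ℂ) * ((k l : ℂ) * (φ (τ * freq ρ (absIdx j)) : ℂ)) := by
    intro j k
    have hs := H.sinc_ne_zero j
    have hτ := H.tau_pos.ne'
    have h4 : (k l : ℝ) * freq ρ l / (τ * Real.sinc (τ * freq ρ (absIdx j))) *
        (τ ^ 2 * ψ (τ * freq ρ (absIdx j))) =
        τ * freq ρ l * ((k l : ℝ) * φ (τ * freq ρ (absIdx j))) := by
      rw [H.filter_eq]
      field_simp
    simp only [hc]
    rw [← Complex.ofReal_mul, h4]
    push_cast
    ring
  have hterm : ∀ j, ∀ k ∈ modes K j, c j k * (ζ (-j) (-k)).eval x *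
        (Complex.exp (Complex.I * (dotFreq ρ k * τ : ℝ)) * (ζ j k).eval (x + h)) +
      c j k * (ζ (-j) (-k)).eval x *
        (Complex.exp (-(Complex.I * (dotFreq ρ k * τ : ℝ))) * (ζ j k).eval (x - h)) =
      c j k * (ζ (-j) (-k)).eval x *
        (2 * (Real.cos (τ * freq ρ (absIdx j)) : ℂ) * (ζ j k).eval x) +
      ((τ * freq ρ l : ℝ) : ℂ) * ((k l : ℂ) * g (-j) (-k) * G j k) -
      ((τ * freq ρ l : ℝ) : ℂ) * ((k l : ℂ) * (φ (τ * freq ρ (absIdx j)) : ℂ) *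
        (ζ (-j) (-k)).eval x * D j k) := by
    intro j k hk
    have h5 := H.modFun_equation u v hk x
    rw [← hh, ← hζ, ← hD] at h5
    have h6 : g (-j) (-k) = (φ (τ * freq ρ (absIdx j)) : ℂ) * (ζ (-j) (-k)).eval x := by
      simp only [hg, absIdx_neg]
    have h7 := hcψ j k
    rw [h6]
    simp only [hG, hg]
    linear_combination c j k * (ζ (-j) (-k)).eval x * h5 + (ζ (-j) (-k)).eval x *
      (∑ j₁ : ZMod (2 * M), ∑ k₁ ∈ (modes K j₁).filter (fun k₁ => k - k₁ ∈ modes K (j - j₁)),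
        ((φ (τ * freq ρ (absIdx j₁)) : ℂ) * (ζ j₁ k₁).eval x) *
          ((φ (τ * freq ρ (absIdx (j - j₁))) : ℂ) * (ζ (j - j₁) (k - k₁)).eval x) - D j k) * h7
  rw [h1, h2, ← mul_sub, ← Finset.sum_sub_distrib]
  simp only [← Finset.sum_sub_distrib, sub_neg_eq_add]
  rw [Finset.sum_congr rfl fun j _ => Finset.sum_congr rfl (hterm j)]
  simp only [Finset.sum_sub_distrib, Finset.sum_add_distrib, ← Finset.mul_sum]
  rw [hdiag, hpot]
  ring

end Modulation

/-! ### Bounds for the defect and for the change of the almost-invariant energies -/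

section Defect

variable {K M : ℕ} {ρ ν γ B ε τ : ℝ} {φ ψ : ℝ → ℝ}

/-- The sum of the norms of all coefficients in the mode `(j, k)`. -/
noncomputable def pairMass (K : ℕ) {M : ℕ} (z : ℕ → ZMod (2 * M) → (Fin (M + 1) → ℤ) → ℂ[X])
    (j : ZMod (2 * M)) (k : Fin (M + 1) → ℤ) : ℝ :=
  ∑ q ∈ Finset.range (2 * K), coeffNorm (z q j k)

/-- The convolution of `pairMass` with itself. -/
noncomputable def pairConv (K : ℕ) {M : ℕ} [NeZero M]
    (z : ℕ → ZMod (2 * M) → (Fin (M + 1) → ℤ) → ℂ[X]) (j : ZMod (2 * M))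
    (k : Fin (M + 1) → ℤ) : ℝ :=
  ∑ j₁ : ZMod (2 * M), ∑ k₁ ∈ (modes K j₁).filter (fun k₁ => k - k₁ ∈ modes K (j - j₁)),
    pairMass K z j₁ k₁ * pairMass K z (j - j₁) (k - k₁)

theorem pairMass_nonneg (z : ℕ → ZMod (2 * M) → (Fin (M + 1) → ℤ) → ℂ[X]) (j : ZMod (2 * M))
    (k : Fin (M + 1) → ℤ) : 0 ≤ pairMass K z j k :=
  Finset.sum_nonneg fun _ _ => coeffNorm_nonneg _

theorem pairConv_nonneg [NeZero M] (z : ℕ → ZMod (2 * M) → (Fin (M + 1) → ℤ) → ℂ[X]) (j : ZMod (2 * M))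
    (k : Fin (M + 1) → ℤ) : 0 ≤ pairConv K z j k :=
  Finset.sum_nonneg fun _ _ => Finset.sum_nonneg fun _ _ =>
    mul_nonneg (pairMass_nonneg _ _ _) (pairMass_nonneg _ _ _)

theorem sum_pairMass (z : ℕ → ZMod (2 * M) → (Fin (M + 1) → ℤ) → ℂ[X]) (j : ZMod (2 * M)) :
    ∑ k ∈ modes K j, pairMass K z j k = modeMass K z (2 * K) j := Finset.sum_comm

theorem sum_pairConv_le [NeZero M] (z : ℕ → ZMod (2 * M) → (Fin (M + 1) → ℤ) → ℂ[X]) (j : ZMod (2 * M)) :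
    ∑ k ∈ modes K j, pairConv K z j k ≤
      ∑ j₁, modeMass K z (2 * K) j₁ * modeMass K z (2 * K) (j - j₁) := by
  unfold pairConv
  rw [Finset.sum_comm]
  refine Finset.sum_le_sum fun j₁ _ => ?_
  rw [← sum_pairMass, ← sum_pairMass]
  exact sum_conv_le (modes K j) (modes K j₁) (modes K (j - j₁)) (f := pairMass K z j₁)
    (g := pairMass K z (j - j₁)) (pairMass_nonneg z j₁) (pairMass_nonneg z (j - j₁))

theorem sum_pairMass_neg_mul_pairConv_le [NeZero M] (z : ℕ → ZMod (2 * M) → (Fin (M + 1) → ℤ) → ℂ[X])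
    (j : ZMod (2 * M)) :
    ∑ k ∈ modes K j, pairMass K z (-j) (-k) * pairConv K z j k ≤
      modeMass K z (2 * K) (-j) *
        ∑ j₁, modeMass K z (2 * K) j₁ * modeMass K z (2 * K) (j - j₁) := by
  have h1 : ∑ k ∈ modes K j, pairMass K z (-j) (-k) = modeMass K z (2 * K) (-j) := by
    rw [sum_modes_neg_apply j (pairMass K z (-j)), sum_pairMass]
  refine le_trans ?_ (mul_le_mul_of_nonneg_left (sum_pairConv_le z j) (modeMass_nonneg _ _ _))
  rw [← h1, Finset.mul_sum]
  refine Finset.sum_le_sum fun k hk => mul_le_mul_of_nonneg_right ?_ (pairConv_nonneg z j k)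
  exact Finset.single_le_sum (f := fun k => pairMass K z (-j) (-k))
    (fun _ _ => pairMass_nonneg _ _ _) hk

theorem norm_scaledEval_le (z : ℕ → ZMod (2 * M) → (Fin (M + 1) → ℤ) → ℂ[X]) {x : ℂ}
    (hx : ‖x‖ ≤ 1) (m : ℕ) (j : ZMod (2 * M)) (k : Fin (M + 1) → ℤ) :
    ‖scaledEval K ν ε z x m j k‖ ≤
      Real.sqrt ε ^ ((m : ℝ) * (1 - 2 * ν) + 2 * ν * level K j k) * coeffNorm (z m j k) := by
  unfold scaledEval
  rw [norm_mul, Complex.norm_real, Real.norm_of_nonneg (by positivity)]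
  exact mul_le_mul_of_nonneg_left (norm_eval_le_coeffNorm _ hx) (by positivity)

namespace Admissible

theorem sqrt_rpow_antitone (H : Admissible K M ρ ν γ B ε τ φ ψ) {x y : ℝ} (h : x ≤ y) :
    Real.sqrt ε ^ y ≤ Real.sqrt ε ^ x :=
  Real.rpow_le_rpow_of_exponent_ge (Real.sqrt_pos.2 H.eps_pos) (Real.sqrt_le_one.2 H.eps_le) h

theorem norm_defect_le [NeZero M] (H : Admissible K M ρ ν γ B ε τ φ ψ)
    (z : ℕ → ZMod (2 * M) → (Fin (M + 1) → ℤ) → ℂ[X]) {x : ℂ} (hx : ‖x‖ ≤ 1)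
    (j : ZMod (2 * M)) (k : Fin (M + 1) → ℤ) :
    ‖defect K ρ ν ε τ φ z x j k‖ ≤
      Real.sqrt ε ^ (2 * K * (1 - 2 * ν) + 2 * ν * level K j k) * B ^ 2 * pairConv K z j k := by
  have hB := H.bound_nonneg
  have hpos := Real.sqrt_pos.2 H.eps_pos
  unfold defect pairConv
  rw [Finset.mul_sum]
  refine (norm_sum_le _ _).trans (Finset.sum_le_sum fun j₁ _ => ?_)
  rw [Finset.mul_sum]
  refine (norm_sum_le _ _).trans (Finset.sum_le_sum fun k₁ _ => ?_)
  unfold pairMass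
  rw [Finset.sum_mul_sum, ← Finset.sum_product', Finset.mul_sum]
  refine (norm_sum_le _ _).trans ((Finset.sum_le_sum fun q hq => ?_).trans
    (Finset.sum_le_sum_of_subset_of_nonneg (Finset.filter_subset _ _) fun q _ _ =>
      mul_nonneg (by positivity) (mul_nonneg (coeffNorm_nonneg _) (coeffNorm_nonneg _))))
  have hq' : 2 * (K : ℝ) ≤ q.1 + q.2 := by exact_mod_cast (Finset.mem_filter.1 hq).2
  have hl : (level K j k : ℝ) ≤ level K j₁ k₁ + level K (j - j₁) (k - k₁) := by
    exact_mod_cast level_le_add (by have := H.three_le; omega) j j₁ k k₁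
  have hfac : ∀ (ξ : ℝ) (m : ℕ) (j : ZMod (2 * M)) (k : Fin (M + 1) → ℤ),
      ‖(φ ξ : ℂ) * scaledEval K ν ε z x m j k‖ ≤ B *
        (Real.sqrt ε ^ ((m : ℝ) * (1 - 2 * ν) + 2 * ν * level K j k) * coeffNorm (z m j k)) := by
    intro ξ m j k
    rw [norm_mul, Complex.norm_real]
    exact mul_le_mul (H.filter_le ξ) (norm_scaledEval_le z hx m j k) (norm_nonneg _) hB
  rw [norm_mul]
  refine (mul_le_mul (hfac _ _ _ _) (hfac _ _ _ _) (norm_nonneg _)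
    (mul_nonneg hB (mul_nonneg (by positivity) (coeffNorm_nonneg _)))).trans ?_
  have h1 : Real.sqrt ε ^ ((q.1 : ℝ) * (1 - 2 * ν) + 2 * ν * level K j₁ k₁) *
      Real.sqrt ε ^ ((q.2 : ℝ) * (1 - 2 * ν) + 2 * ν * level K (j - j₁) (k - k₁)) ≤
      Real.sqrt ε ^ (2 * K * (1 - 2 * ν) + 2 * ν * level K j k) := by
    rw [← Real.rpow_add hpos]
    refine H.sqrt_rpow_antitone ?_
    have h2 := mul_le_mul_of_nonneg_right hq' (by linarith [H.nu_lt] : 0 ≤ 1 - 2 * ν)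
    have h3 := mul_le_mul_of_nonneg_left hl (by linarith [H.nu_nonneg] : 0 ≤ 2 * ν)
    linarith
  calc _ = Real.sqrt ε ^ ((q.1 : ℝ) * (1 - 2 * ν) + 2 * ν * level K j₁ k₁) *
      Real.sqrt ε ^ ((q.2 : ℝ) * (1 - 2 * ν) + 2 * ν * level K (j - j₁) (k - k₁)) * (B ^ 2 *
        (coeffNorm (z q.1 j₁ k₁) * coeffNorm (z q.2 (j - j₁) (k - k₁)))) := by ring
    _ ≤ _ := by
        rw [mul_assoc (Real.sqrt ε ^ (2 * K * (1 - 2 * ν) + 2 * ν * level K j k))]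
        exact mul_le_mul_of_nonneg_right h1 (mul_nonneg (sq_nonneg B)
          (mul_nonneg (coeffNorm_nonneg _) (coeffNorm_nonneg _)))

theorem norm_eval_modFun_le [NeZero M] (H : Admissible K M ρ ν γ B ε τ φ ψ) (u v : ZMod (2 * M) → ℂ)
    {x : ℂ} (hx : ‖x‖ ≤ 1) (j : ZMod (2 * M)) (k : Fin (M + 1) → ℤ) :
    ‖(modFun K ρ ν ε τ φ ψ u v j k).eval x‖ ≤ Real.sqrt ε ^ (level K j k : ℝ) *
      pairMass K (coeffTable K ρ ν ε τ φ ψ u v (2 * K - 1)) j k := by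
  rw [eval_modFun (by have := H.three_le; omega) H.eps_pos, pairMass, Finset.mul_sum]
  refine (norm_sum_le _ _).trans (Finset.sum_le_sum fun m hm => ?_)
  refine (norm_scaledEval_le _ hx m j k).trans ?_
  rw [Finset.mem_range] at hm
  rcases Nat.lt_or_ge m (level K j k) with h | h
  · rw [coeffTable_eq_zero (by omega) (by omega), coeffNorm_zero, mul_zero, mul_zero]
  · refine mul_le_mul_of_nonneg_right (H.sqrt_rpow_antitone ?_) (coeffNorm_nonneg _)
    have h' : (level K j k : ℝ) ≤ m := by exact_mod_cast h
    nlinarith [H.nu_lt]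

/-- The bound for the rate of change of `𝓔_l`. -/
noncomputable def driftBound (K : ℕ) (ρ ν ε : ℝ) {M : ℕ} [NeZero M]
    (z : ℕ → ZMod (2 * M) → (Fin (M + 1) → ℤ) → ℂ[X]) (l : Fin (M + 1)) : ℝ :=
  freq ρ l * ∑ j : ZMod (2 * M), ∑ k ∈ modes K j, |(k l : ℝ)| *
    Real.sqrt ε ^ ((level K j k : ℝ) + (2 * K * (1 - 2 * ν) + 2 * ν * level K j k)) *
    (pairMass K z (-j) (-k) * pairConv K z j k)

theorem norm_almostInvEnergy_step_le [NeZero M] (H : Admissible K M ρ ν γ B ε τ φ ψ)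
    (u v : ZMod (2 * M) → ℂ) (l : Fin (M + 1)) {t : ℝ} (ht : 0 ≤ t) (ht1 : t + τ ≤ 1) :
    ‖almostInvEnergy K ρ ν ε τ φ ψ u v l (t + τ) - almostInvEnergy K ρ ν ε τ φ ψ u v l t‖ ≤
      τ * (B ^ 3 * driftBound K ρ ν ε (coeffTable K ρ ν ε τ φ ψ u v (2 * K - 1)) l) := by
  have hτ := H.tau_pos
  have hB := H.bound_nonneg
  have hω := freq_pos H.rho_pos l
  have hpos := Real.sqrt_pos.2 H.eps_pos
  have hx : ‖((ε ^ (ν / 2) * (t + τ) : ℝ) : ℂ)‖ ≤ 1 := by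
    rw [Complex.norm_real, Real.norm_of_nonneg (mul_nonneg H.loss_pos.le (by linarith))]
    exact mul_le_one₀ H.loss_le_one (by linarith) ht1
  rw [H.almostInvEnergy_step, norm_mul, norm_mul, norm_div, Complex.norm_I, Complex.norm_two,
    Complex.norm_real, Real.norm_of_nonneg (mul_pos hτ hω).le]
  have hsum : ∀ S T : ℝ, 0 ≤ S → S ≤ B ^ 3 * T →
      1 / 2 * (τ * freq ρ l) * S ≤ τ * (B ^ 3 * (freq ρ l * T)) := by
    intro S T hS hST
    have h1 := mul_le_mul_of_nonneg_left hST (mul_pos hτ hω).le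
    have h2 := mul_nonneg (mul_pos hτ hω).le hS
    linarith
  unfold driftBound
  refine hsum _ _ (norm_nonneg _) ?_
  rw [Finset.mul_sum]
  refine (norm_sum_le _ _).trans (Finset.sum_le_sum fun j _ => ?_)
  rw [Finset.mul_sum]
  refine (norm_sum_le _ _).trans (Finset.sum_le_sum fun k _ => ?_)
  have h1 := H.norm_eval_modFun_le u v hx (-j) (-k)
  have h2 := H.norm_defect_le (coeffTable K ρ ν ε τ φ ψ u v (2 * K - 1)) hx j k
  rw [level_neg] at h1
  rw [norm_mul, norm_mul, norm_mul, Complex.norm_intCast, Complex.norm_real, Real.norm_eq_abs,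
    Real.rpow_add hpos]
  set Z := coeffTable K ρ ν ε τ φ ψ u v (2 * K - 1)
  have hm := pairMass_nonneg (K := K) Z (-j) (-k)
  calc _ ≤ |(k l : ℝ)| * B * (Real.sqrt ε ^ (level K j k : ℝ) * pairMass K Z (-j) (-k)) *
        (Real.sqrt ε ^ (2 * K * (1 - 2 * ν) + 2 * ν * level K j k) * B ^ 2 *
          pairConv K Z j k) := by
        refine mul_le_mul (mul_le_mul (mul_le_mul_of_nonneg_left (H.filter_le _)
          (abs_nonneg _)) h1 (norm_nonneg _) (by positivity)) h2 (norm_nonneg _) (by positivity)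
    _ = _ := by ring

/-- The one-step bound carries a factor `τ`, so `n` steps add up to at most `nτ ≤ 1` times the
drift. -/
theorem norm_almostInvEnergy_sub_le [NeZero M] (H : Admissible K M ρ ν γ B ε τ φ ψ)
    (u v : ZMod (2 * M) → ℂ) (l : Fin (M + 1)) (n : ℕ) (hn : (n : ℝ) * τ ≤ 1) :
    ‖almostInvEnergy K ρ ν ε τ φ ψ u v l ((n : ℝ) * τ) -
        almostInvEnergy K ρ ν ε τ φ ψ u v l 0‖ ≤
      B ^ 3 * driftBound K ρ ν ε (coeffTable K ρ ν ε τ φ ψ u v (2 * K - 1)) l := by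
  have hτ := H.tau_pos
  set R := B ^ 3 * driftBound K ρ ν ε (coeffTable K ρ ν ε τ φ ψ u v (2 * K - 1)) l with hR
  have hR0 : 0 ≤ R := by
    have hB := H.bound_nonneg
    have hω := (freq_pos H.rho_pos l).le
    unfold driftBound at hR
    rw [hR]
    refine mul_nonneg (by positivity) (mul_nonneg hω (Finset.sum_nonneg fun _ _ =>
      Finset.sum_nonneg fun _ _ => mul_nonneg (by positivity)
        (mul_nonneg (pairMass_nonneg _ _ _) (pairConv_nonneg _ _ _))))
  have key : ∀ n : ℕ, (n : ℝ) * τ ≤ 1 → ‖almostInvEnergy K ρ ν ε τ φ ψ u v l ((n : ℝ) * τ) -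
        almostInvEnergy K ρ ν ε τ φ ψ u v l 0‖ ≤ (n : ℝ) * τ * R := by
    intro n
    induction n with
    | zero => simp
    | succ n ih =>
      intro h
      have hcast : ((n + 1 : ℕ) : ℝ) * τ = (n : ℝ) * τ + τ := by
        push_cast
        ring
      rw [hcast] at h ⊢
      have h1 := H.norm_almostInvEnergy_step_le u v l (t := (n : ℝ) * τ) (by positivity) h
      have h2 := ih (by linarith)
      have h3 := norm_sub_le_norm_sub_add_norm_sub
        (almostInvEnergy K ρ ν ε τ φ ψ u v l ((n : ℝ) * τ + τ))
        (almostInvEnergy K ρ ν ε τ φ ψ u v l ((n : ℝ) * τ))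
        (almostInvEnergy K ρ ν ε τ φ ψ u v l 0)
      rw [← hR] at h1
      linarith
  exact (key n hn).trans (mul_le_of_le_one_left hR0 hn)

theorem eps_rpow_eq (H : Admissible K M ρ ν γ B ε τ φ ψ) (x : ℝ) :
    ε ^ x = Real.sqrt ε ^ (2 * x) := by
  rw [Real.sqrt_eq_rpow, ← Real.rpow_mul H.eps_pos.le]
  ring_nf

/-- The weight at `l` is traded for the weight at `j`, after which `l` enters only through `∑ |k_l|
≤ 2K`. The real variable `L` stands for the level, so `x` is a power of `√ε` valid for every
possible level. -/
theorem sum_weight_mul_driftBound_le [NeZero M] (H : Admissible K M ρ ν γ B ε τ φ ψ) {s A : ℝ}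
    (hs : 1 / 2 < s) (hA0 : 0 ≤ A)
    (hA : ∀ l l' : ℕ, l ≤ l' + K → weight s l * freq ρ l ≤ A * (weight s l' * freq ρ l'))
    (z : ℕ → ZMod (2 * M) → (Fin (M + 1) → ℤ) → ℂ[X]) (I : Finset (Fin (M + 1))) {x : ℝ}
    (hx : ∀ l ∈ I, ∀ L : ℝ, (profile K l : ℝ) ≤ L → L ≤ K →
      x ≤ 2 * -(profile K l : ℝ) + (L + (2 * K * (1 - 2 * ν) + 2 * ν * L))) :
    ∑ l ∈ I, weight s l * ε ^ (-(profile K l : ℝ)) * driftBound K ρ ν ε z l ≤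
      2 * K * A * Real.sqrt ε ^ x * ∑ j, weight s (absIdx j) * (freq ρ (absIdx j) *
        modeMass K z (2 * K) (-j) *
          ∑ j₁, modeMass K z (2 * K) j₁ * modeMass K z (2 * K) (j - j₁)) := by
  have hpos := Real.sqrt_pos.2 H.eps_pos
  have hK : 2 ≤ K := by have := H.three_le; omega
  have hpt : ∀ l ∈ I, ∀ j, ∀ k ∈ modes K j, weight s l * ε ^ (-(profile K l : ℝ)) *
      (freq ρ l * (|(k l : ℝ)| * Real.sqrt ε ^ ((level K j k : ℝ) +
        (2 * K * (1 - 2 * ν) + 2 * ν * level K j k)) *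
        (pairMass K z (-j) (-k) * pairConv K z j k))) ≤
      |(k l : ℝ)| * (A * Real.sqrt ε ^ x * (weight s (absIdx j) * freq ρ (absIdx j) *
        (pairMass K z (-j) (-k) * pairConv K z j k))) := by
    intro l hl j k hk
    have hY : 0 ≤ pairMass K z (-j) (-k) * pairConv K z j k :=
      mul_nonneg (pairMass_nonneg _ _ _) (pairConv_nonneg _ _ _)
    by_cases hkl : k l = 0
    · simp [hkl]
    have h1 := hA l (absIdx j) ((mem_modes.1 hk).le_absIdx_add (by omega) hkl)
    have h2 : ε ^ (-(profile K l : ℝ)) * Real.sqrt ε ^ ((level K j k : ℝ) +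
        (2 * K * (1 - 2 * ν) + 2 * ν * level K j k)) ≤ Real.sqrt ε ^ x := by
      rw [H.eps_rpow_eq, ← Real.rpow_add hpos]
      exact H.sqrt_rpow_antitone (hx l hl _
        (by exact_mod_cast profile_le_level_of_ne_zero j hkl)
        (by exact_mod_cast level_le_self hK j k))
    have hω := freq_pos H.rho_pos (absIdx j)
    have hσ := weight_pos hs (absIdx j)
    have h3 : 0 ≤ ε ^ (-(profile K l : ℝ)) * Real.sqrt ε ^ ((level K j k : ℝ) +
        (2 * K * (1 - 2 * ν) + 2 * ν * level K j k)) :=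
      mul_nonneg (Real.rpow_nonneg H.eps_pos.le _) (Real.rpow_nonneg hpos.le _)
    have h4 := mul_le_mul h1 h2 h3 (mul_nonneg hA0 (mul_pos hσ hω).le)
    calc _ = weight s l * freq ρ l * (ε ^ (-(profile K l : ℝ)) * Real.sqrt ε ^
          ((level K j k : ℝ) + (2 * K * (1 - 2 * ν) + 2 * ν * level K j k))) *
          (|(k l : ℝ)| * (pairMass K z (-j) (-k) * pairConv K z j k)) := by ring
      _ ≤ A * (weight s (absIdx j) * freq ρ (absIdx j)) * Real.sqrt ε ^ x *
          (|(k l : ℝ)| * (pairMass K z (-j) (-k) * pairConv K z j k)) :=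
          mul_le_mul_of_nonneg_right h4 (mul_nonneg (abs_nonneg _) hY)
      _ = _ := by ring
  have hk : ∀ j, ∀ k ∈ modes K j, ∑ l ∈ I, |(k l : ℝ)| ≤ 2 * K := by
    intro j k hk
    have h1 := (mem_modes.1 hk).sum_natAbs_le (by omega)
    have h2 : ∑ l, |(k l : ℝ)| = ((∑ l, (k l).natAbs : ℕ) : ℝ) := by
      rw [Nat.cast_sum]
      exact Finset.sum_congr rfl fun l _ => by rw [Nat.cast_natAbs, Int.cast_abs]
    refine (Finset.sum_le_sum_of_subset_of_nonneg (Finset.subset_univ I)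
      fun _ _ _ => abs_nonneg _).trans ?_
    rw [h2]
    exact_mod_cast h1
  unfold driftBound
  calc _ ≤ ∑ l ∈ I, ∑ j, ∑ k ∈ modes K j, |(k l : ℝ)| * (A * Real.sqrt ε ^ x *
        (weight s (absIdx j) * freq ρ (absIdx j) *
          (pairMass K z (-j) (-k) * pairConv K z j k))) := by
        refine Finset.sum_le_sum fun l hl => ?_
        rw [Finset.mul_sum, Finset.mul_sum]
        refine Finset.sum_le_sum fun j _ => ?_
        rw [Finset.mul_sum, Finset.mul_sum]
        exact Finset.sum_le_sum fun k hk => hpt l hl j k hk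
    _ = ∑ j, ∑ k ∈ modes K j, (∑ l ∈ I, |(k l : ℝ)|) * (A * Real.sqrt ε ^ x *
        (weight s (absIdx j) * freq ρ (absIdx j) *
          (pairMass K z (-j) (-k) * pairConv K z j k))) := by
        rw [Finset.sum_comm]
        refine Finset.sum_congr rfl fun j _ => ?_
        rw [Finset.sum_comm]
        exact Finset.sum_congr rfl fun k _ => by rw [Finset.sum_mul]
    _ ≤ ∑ j, ∑ k ∈ modes K j, (2 * K) * (A * Real.sqrt ε ^ x *
        (weight s (absIdx j) * freq ρ (absIdx j) *
          (pairMass K z (-j) (-k) * pairConv K z j k))) := by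
        refine Finset.sum_le_sum fun j _ => Finset.sum_le_sum fun k hkm =>
          mul_le_mul_of_nonneg_right (hk j k hkm) ?_
        exact mul_nonneg (mul_nonneg hA0 (Real.rpow_nonneg hpos.le _))
          (mul_nonneg (mul_pos (weight_pos hs _) (freq_pos H.rho_pos _)).le
            (mul_nonneg (pairMass_nonneg _ _ _) (pairConv_nonneg _ _ _)))
    _ = 2 * K * A * Real.sqrt ε ^ x * ∑ j, weight s (absIdx j) * (freq ρ (absIdx j) *
          ∑ k ∈ modes K j, pairMass K z (-j) (-k) * pairConv K z j k) := by
        rw [Finset.mul_sum]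
        refine Finset.sum_congr rfl fun j _ => ?_
        rw [← Finset.mul_sum, ← Finset.mul_sum, ← Finset.mul_sum]
        ring
    _ ≤ _ := by
        refine mul_le_mul_of_nonneg_left (Finset.sum_le_sum fun j _ => ?_)
          (mul_nonneg (by positivity) (Real.rpow_nonneg hpos.le _))
        refine mul_le_mul_of_nonneg_left ?_ (weight_pos hs _).le
        rw [mul_assoc]
        exact mul_le_mul_of_nonneg_left (sum_pairMass_neg_mul_pairConv_le z j)
          (freq_pos H.rho_pos _).le

end Admissible

end Defect

/-- Cauchy–Schwarz and the algebra property for the trilinear form in the energy estimate. -/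
theorem sum_weight_mul_trilinear_le {M : ℕ} [NeZero M] {s ρ A c : ℝ} (hs : 1 / 2 < s)
    (hρ : 0 < ρ) (hA0 : 0 ≤ A) (f : ZMod (2 * M) → ℝ)
    (hA : ∑ j, weight s (absIdx j) * (∑ j₁, f j₁ * f (j - j₁)) ^ 2 ≤
      A * (∑ j, weight s (absIdx j) * f j ^ 2) ^ 2)
    (hf : ∑ j, weight s (absIdx j) * (freq ρ (absIdx j) * f j) ^ 2 ≤ c) :
    ∑ j, weight s (absIdx j) * (freq ρ (absIdx j) * f (-j) * ∑ j₁, f j₁ * f (j - j₁)) ≤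
      c + A * (ρ⁻¹ * c) ^ 2 := by
  have h0 : ∀ g : ZMod (2 * M) → ℝ, 0 ≤ ∑ j, weight s (absIdx j) * g j ^ 2 := fun g =>
    Finset.sum_nonneg fun j _ => mul_nonneg (weight_pos hs _).le (sq_nonneg _)
  have h1 := (sum_weight_mul_sq_le hs hρ f).trans
    (mul_le_mul_of_nonneg_left hf (inv_nonneg.2 hρ.le))
  have h2 := hA.trans (mul_le_mul_of_nonneg_left (pow_le_pow_left₀ (h0 f) h1 2) hA0)
  have h3 : ∑ j, weight s (absIdx j) * (freq ρ (absIdx j) * f (-j)) ^ 2 ≤ c := by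
    refine le_trans (le_of_eq ?_) hf
    rw [← Equiv.sum_comp (Equiv.neg (ZMod (2 * M)))]
    refine Finset.sum_congr rfl fun j _ => ?_
    rw [Equiv.neg_apply, absIdx_neg, neg_neg]
  refine le_trans ?_ (add_le_add h3 h2)
  rw [← Finset.sum_add_distrib]
  refine Finset.sum_le_sum fun j _ => ?_
  rw [← mul_add]
  refine mul_le_mul_of_nonneg_left ?_ (weight_pos hs _).le
  nlinarith [sq_nonneg (freq ρ (absIdx j) * f (-j) - ∑ j₁, f j₁ * f (j - j₁)),
    sq_nonneg (freq ρ (absIdx j) * f (-j)), sq_nonneg (∑ j₁, f j₁ * f (j - j₁))]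

end TrigInt

/-! ### The theorem -/

theorem theorem4 (K : ℕ) (hK : 3 ≤ K) (ν s ρ γ B C₀ : ℝ) (hν : 0 ≤ ν) (hν' : ν < 1 / 2)
    (hs : 1 / 2 < s) (hρ : 0 < ρ) (hγ : 0 < γ) (hγ' : γ ≤ 1) :
    ∃ ε₀ : ℝ, 0 < ε₀ ∧ ∃ C : ℝ, 0 < C ∧
      ∀ (φ ψ : ℝ → ℝ), φ 0 = 1 → (∀ ξ, φ (-ξ) = φ ξ) → (∀ ξ, |φ ξ| ≤ B) →
        (∀ ξ, ψ ξ = Real.sinc ξ * φ ξ) →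
      ∀ (M : ℕ) [NeZero M], K ≤ M →
      ∀ (τ ε : ℝ), 0 < τ → 0 < ε → ε ≤ ε₀ → NonResonant K M ρ ν γ ε τ →
      ∀ (u v : ZMod (2 * M) → ℂ), IsRealValued u → IsRealValued v →
        ∑ l : Fin (M + 1), weight s l * ε ^ (-(profile K l : ℝ)) *
          modeEnergy ρ u v ((l : ℕ) : ZMod (2 * M)) ≤ C₀ →
      ∀ n : ℕ, (n : ℝ) * τ ≤ 1 →
        ∑ l : Fin (M + 1), weight s l * ε ^ (-(profile K l : ℝ)) *
            ‖almostInvEnergy K ρ ν ε τ φ ψ u v l ((n : ℝ) * τ) -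
              almostInvEnergy K ρ ν ε τ φ ψ u v l 0‖
          ≤ C * ε ^ ((K : ℝ) * (1 - 2 * ν) / 2) ∧
        ε ^ (-(profile K 1 : ℝ)) *
            ‖almostInvEnergy K ρ ν ε τ φ ψ u v 1 ((n : ℝ) * τ) -
              almostInvEnergy K ρ ν ε τ φ ψ u v 1 0‖
          ≤ C * (ε ^ (((K : ℝ) - 1) * (1 - 2 * ν) / 2) * ε ^ ((K : ℝ) * (1 - 2 * ν) / 2)) := by
  obtain ⟨A, hA0, hA⟩ := exists_sum_weight_mul_conv_sq_le hs
  obtain ⟨A', hA'0, hA'⟩ := exists_weight_mul_freq_le hs hρ K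
  obtain ⟨c, hc0, hc⟩ := exists_sum_weight_mul_modeMass_sq_le K ρ ν γ B (8 * C₀) hs (2 * K) le_rfl
  -- No smallness beyond `ε ≤ 1` is needed. `|B|` and `+ 1` keep the constant positive, since `B ≥
  -- 0` is known only once a filter `φ` is given.
  refine ⟨1, one_pos, |B| ^ 3 * (2 * K * A' * (c + A * (ρ⁻¹ * c) ^ 2)) + 1, by positivity, ?_⟩
  intro φ ψ _ _ hφ hψ M _ hM τ ε hτ hε hε1 hnr u v hu hv hE n hn
  have H : Admissible K M ρ ν γ B ε τ φ ψ :=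
    ⟨hK, hν, hν', hρ, hγ, hγ', hτ, hε, hε1, hφ, hψ, hnr⟩
  have hT := sum_weight_mul_trilinear_le hs hρ hA0 _ (hA M _)
    (hc M ε τ φ ψ H u v fun m => sum_weight_mul_dataBound_sq_le hs hε hu hv hE m)
  have hB := H.bound_nonneg
  have key : ∀ (I : Finset (Fin (M + 1))) (x : ℝ),
      (∀ l ∈ I, ∀ L : ℝ, (profile K l : ℝ) ≤ L → L ≤ K →
        x ≤ 2 * -(profile K l : ℝ) + (L + (2 * K * (1 - 2 * ν) + 2 * ν * L))) →
      ∑ l ∈ I, weight s l * ε ^ (-(profile K l : ℝ)) *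
        ‖almostInvEnergy K ρ ν ε τ φ ψ u v l ((n : ℝ) * τ) -
          almostInvEnergy K ρ ν ε τ φ ψ u v l 0‖ ≤
      (|B| ^ 3 * (2 * K * A' * (c + A * (ρ⁻¹ * c) ^ 2)) + 1) * Real.sqrt ε ^ x := by
    intro I x hx
    have hx0 : 0 ≤ Real.sqrt ε ^ x := Real.rpow_nonneg (Real.sqrt_nonneg _) _
    have h1 := H.sum_weight_mul_driftBound_le hs hA'0 hA'
      (coeffTable K ρ ν ε τ φ ψ u v (2 * K - 1)) I hx
    have h2 := h1.trans (mul_le_mul_of_nonneg_left hT (by positivity))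
    rw [abs_of_nonneg hB]
    calc _ ≤ ∑ l ∈ I, B ^ 3 * (weight s l * ε ^ (-(profile K l : ℝ)) *
          Admissible.driftBound K ρ ν ε (coeffTable K ρ ν ε τ φ ψ u v (2 * K - 1)) l) := by
          refine Finset.sum_le_sum fun l _ => ?_
          rw [mul_left_comm]
          exact mul_le_mul_of_nonneg_left (H.norm_almostInvEnergy_sub_le u v l n hn)
            (mul_nonneg (weight_pos hs _).le (Real.rpow_nonneg hε.le _))
      _ ≤ B ^ 3 * (2 * K * A' * Real.sqrt ε ^ x * (c + A * (ρ⁻¹ * c) ^ 2)) := by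
          rw [← Finset.mul_sum]
          exact mul_le_mul_of_nonneg_left h2 (by positivity)
      _ ≤ _ := by
          rw [add_mul, one_mul]
          refine le_add_of_le_of_nonneg (le_of_eq ?_) hx0
          ring
  constructor
  -- Using `L ≥ e(l)`, the exponent is at least `(2K - e(l))(1 - 2ν)`, and `e(l) ≤ K`.
  · have h := key Finset.univ (K * (1 - 2 * ν)) fun l _ L hl hL => by nlinarith
    rwa [H.eps_rpow_eq, mul_div_cancel₀ _ (two_ne_zero' ℝ)]
  · have hval : (((1 : Fin (M + 1)) : ℕ)) = 1 := by
      rw [Fin.val_one', Nat.mod_eq_of_lt (by omega)]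
    have hprof : profile K 1 = 1 := by
      unfold profile
      rw [if_neg one_ne_zero, if_pos (by omega)]
    -- The same bound with `e(1) = 1`; no other `l` contributes.
    have h := key {1} ((2 * K - 1) * (1 - 2 * ν)) fun l hl L hlL hL => by
      rw [Finset.mem_singleton] at hl
      rw [hl, hval, hprof] at hlL ⊢
      push_cast at hlL ⊢
      nlinarith
    rw [Finset.sum_singleton, hval] at h
    have hw : weight s 1 = 1 := by simp [weight]
    rw [hw, one_mul] at h
    refine h.trans (le_of_eq ?_)
    rw [← Real.rpow_add hε, H.eps_rpow_eq]
    congr 2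
    ring
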